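/- Let $a:(0,1]\to[0,\infty]$ be a measurable function such that (i) for every $\varepsilon>0$ there is $c(\varepsilon)>0$ with $a(r)\ge c(\varepsilon)$ and $a(r)^{-1}\ge c(\varepsilon)$ for all $r\in(0,1]$ with $r>\varepsilon$; (ii) $\int_0^1 \frac{a(r)}{r}\,dr<\infty$ and $\int_0^1\frac{r}{a(r)}\,dr<\infty$; (iii) there is a constant $K>0$ such that $\frac1{\varepsilon^2}\int_0^\varepsilon a(r)^{-1}\,r\int_0^r\frac{a(s)}{s}\,ds\,dr<K$ for all $\varepsilon\in(0,1)$. Let $Q_1,Q_2,Q_3,Q_4$ be the open quadrants of $\mathbb R^2$, counted anti-clockwise from the top-right one, and let $\rho(x)=a(|x|)^{-1}$ for $x\in(Q_1\cup Q_3)\cap B(0,1)$, $\rho(x)=a(|x|)$ for $x\in(Q_2\cup Q_4)\cap B(0,1)$, and $\rho(x)=1$ otherwise. Put $\mathcal E_1(u,u)=\int_{\mathbb R^2}|\nabla u|^2\rho\,dx+\int_{\mathbb R^2}u^2\rho\,dx$ and let $\mathcal W$ be the space of all $u\in W^{1,1}_{\mathrm{loc}}(\mathbb R^2)$ with $\mathcal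 E_1(u,u)<\infty$. Let $\mathcal H$ and $\mathcal H_0$ be the closures in $\mathcal W$, with respect to the norm $\mathcal E_1(u,u)^{1/2}$, of $C_0^\infty(\mathbb R^2)$ and of $C_0^\infty(\mathbb R^2\setminus\{0\})$ (smooth functions with compact support in $\mathbb R^2$, respectively in $\mathbb R^2\setminus\{0\}$). Let $u\in\mathcal W$. Then $u$ has a version, written $u(r,\theta)$ in polar coordinates, which for almost every $\theta$ is locally absolutely continuous in $r\in(0,\infty)$. For every such version, the functions $\theta\mapsto u(r,\theta)$ and $\theta\mapsto u(r,\theta+\pi)$ are integrable on $(0,\pi/2)$ for every $r>0$, and the limits $$\ell^+(u)=\lim_{r\downarrow0}\frac2\pi\int_0^{\pi/2}u(r,\theta)\,d\theta,\qquad \ell^-(u)=\lim_{r\downarrow0}\frac2\pi\int_0^{\pi/2}u(r,\theta+\pi)\,d\theta$$ exist in $\mathbb R$ and do not depend on the version. Moreover, $$u\in\mathcal H\iff \ell^+(u)=\ell^-(u),\qquad\qquad u\in\mathcal H_0\iff \ell^+(u)=\ell^-(u)=0.$$ -/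

import Mathlib

open MeasureTheory Set Filter Topology
open scoped ENNReal NNReal

noncomputable section

namespace WeightedPlane

/-- The Euclidean plane. -/
abbrev Plane : Type := EuclideanSpace ℝ (Fin 2)

/-- The four open quadrants, counted anti-clockwise from the top-right one. -/
def Q₁ : Set Plane := {x | 0 < x 0 ∧ 0 < x 1}
def Q₂ : Set Plane := {x | x 0 < 0 ∧ 0 < x 1}
def Q₃ : Set Plane := {x | x 0 < 0 ∧ x 1 < 0}
def Q₄ : Set Plane := {x | 0 < x 0 ∧ x 1 < 0}

open Classical in
/-- The weight `ρ`: it is `a(|x|)⁻¹` on `Q₁ ∪ Q₃` and `a(|x|)` on `Q₂ ∪ Q₄` inside the unit ball,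
and `1` elsewhere. Only the values of `a` on `(0, 1]` are used; the axes are a null set. -/
def weight (a : ℝ → ℝ≥0∞) (x : Plane) : ℝ≥0∞ :=
  if x ∈ (Q₁ ∪ Q₃) ∩ Metric.ball 0 1 then (a ‖x‖)⁻¹
  else if x ∈ (Q₂ ∪ Q₄) ∩ Metric.ball 0 1 then a ‖x‖
  else 1

/-- `C₀^∞(ℝ²)`. -/
def testFunctions : Set (Plane → ℝ) := {φ | ContDiff ℝ ((⊤ : ℕ∞) : WithTop ℕ∞) φ ∧ HasCompactSupport φ}

/-- `C₀^∞(ℝ² \ {0})`. -/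
def puncturedTestFunctions : Set (Plane → ℝ) := {φ | φ ∈ testFunctions ∧ (0 : Plane) ∉ tsupport φ}

/-- `u` belongs to `W^{1,1}_loc(ℝ²)` and `g` is its weak gradient. -/
structure HasWeakGradient (u : Plane → ℝ) (g : Plane → Plane) : Prop where
  locallyIntegrable : LocallyIntegrable u
  locallyIntegrable_grad : LocallyIntegrable g
  integral_eq : ∀ φ ∈ testFunctions, ∀ i : Fin 2,
    ∫ x, u x * fderiv ℝ φ x (EuclideanSpace.single i 1) = - ∫ x, g x i * φ x

/-- `W^{1,1}_loc(ℝ²)`. -/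
def W11loc : Set (Plane → ℝ) := {u | ∃ g, HasWeakGradient u g}

open Classical in
/-- The weak gradient of a function of `W^{1,1}_loc(ℝ²)` (unique up to a null set). -/
def weakGradient (u : Plane → ℝ) : Plane → Plane :=
  if h : ∃ g, HasWeakGradient u g then h.choose else 0

/-- The quadratic form `𝓔₁(u, u) = ∫ |∇u|² ρ dx + ∫ u² ρ dx`. -/
def energyOne (ρ : Plane → ℝ≥0∞) (u : Plane → ℝ) : ℝ≥0∞ :=
  (∫⁻ x, ‖weakGradient u x‖ₑ ^ 2 * ρ x) + ∫⁻ x, ‖u x‖ₑ ^ 2 * ρ x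

/-- The weighted Sobolev space `𝓦`. -/
def spaceW (ρ : Plane → ℝ≥0∞) : Set (Plane → ℝ) := {u | u ∈ W11loc ∧ energyOne ρ u < ∞}

/-- The closure of a set `D` of functions in `𝓦`, for the norm `𝓔₁(u, u)^{1/2}`. -/
def closureInW (ρ : Plane → ℝ≥0∞) (D : Set (Plane → ℝ)) : Set (Plane → ℝ) :=
  {u | u ∈ spaceW ρ ∧ ∀ ε : ℝ≥0∞, 0 < ε → ∃ φ ∈ D ∩ spaceW ρ, energyOne ρ (u - φ) < ε}

/-- `𝓗`, the closure of `C₀^∞(ℝ²)` in `𝓦`. -/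
def spaceH (ρ : Plane → ℝ≥0∞) : Set (Plane → ℝ) := closureInW ρ testFunctions

/-- `𝓗₀`, the closure of `C₀^∞(ℝ² \ {0})` in `𝓦`. -/
def spaceH₀ (ρ : Plane → ℝ≥0∞) : Set (Plane → ℝ) := closureInW ρ puncturedTestFunctions

/-- The point with polar coordinates `(r, θ)`. -/
def polarPoint (r θ : ℝ) : Plane := !₂[r * Real.cos θ, r * Real.sin θ]

/-- `v` is a version of `u` which, for almost every angle `θ`, is (locally) absolutely continuous
in the radius `r ∈ (0, ∞)`. -/
structure IsRadialVersion (u v : Plane → ℝ) : Prop where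
  ae_eq : v =ᵐ[volume] u
  absolutelyContinuous : ∀ᵐ θ : ℝ, ∀ r₁ r₂ : ℝ, 0 < r₁ → r₁ ≤ r₂ →
    AbsolutelyContinuousOnInterval (fun r => v (polarPoint r θ)) r₁ r₂

open Classical in
/-- A fixed radially absolutely continuous version of `u`. -/
def radialVersion (u : Plane → ℝ) : Plane → ℝ :=
  if h : ∃ v, IsRadialVersion u v then h.choose else u

/-- The average of `v` over the quarter circle of radius `r` and angles in `(α, α + π / 2)`. -/
def quarterMean (v : Plane → ℝ) (α r : ℝ) : ℝ :=
  2 / Real.pi * ∫ θ in (0 : ℝ)..(Real.pi / 2), v (polarPoint r (θ + α))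

/-- `ℓ⁺(u)`, the limit at the origin of the averages over quarter circles in `Q₁`. -/
def ellPlus (u : Plane → ℝ) : ℝ := limUnder (𝓝[>] 0) (quarterMean (radialVersion u) 0)

/-- `ℓ⁻(u)`, the limit at the origin of the averages over quarter circles in `Q₃`. -/
def ellMinus (u : Plane → ℝ) : ℝ := limUnder (𝓝[>] 0) (quarterMean (radialVersion u) Real.pi)

/-- `L` is, in the proper sense and whatever radially absolutely continuous version is chosen, the
limit at the origin of the averages of `u` over quarter circles with angles in `(α, α + π / 2)`. -/
def IsQuarterLimit (u : Plane → ℝ) (α L : ℝ) : Prop :=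
  (∃ v, IsRadialVersion u v) ∧
    ∀ v, IsRadialVersion u v →
      (∀ r : ℝ, 0 < r → IntervalIntegrable (fun θ => v (polarPoint r (θ + α))) volume
        0 (Real.pi / 2)) ∧
      Tendsto (quarterMean v α) (𝓝[>] 0) (𝓝 L)

end WeightedPlane

end

open WeightedPlane

/-!
The proof rests on the behaviour of the means of `u` over the quarter circles in `Q₁` and `Q₃`,
where the weight is `a(r)⁻¹`.

*Existence of the limits.* A Sobolev function and its gradient are approximated by test functions
and their gradients, almost everywhere and dominated by one locally integrable function, so that the
approximation also holds on almost every ray and almost every circle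
(`HasWeakGradient.exists_dominated_approx`, `HasWeakGradient.exists_radial_version`). The limit is a
version `v` that is the integral of its radial derivative on almost every ray, and whose oscillation
over almost every quarter circle is at most the integral of the gradient over it. By Cauchy–Schwarz,
with `∫ a(r) / r dr < ∞` and the energy `∫ ‖g‖² r / a(r)` of the quadrant, the radial derivative is
integrable up to the origin, so the quarter means converge (`exists_tendsto_quarterMean`). Two
radially continuous versions agree on almost every ray, hence the limit does not depend on the
version. The same estimate makes the limits continuous functionals for the energy
(`exists_sq_enorm_quarterLimit_le`). As they both equal `φ(0)` on a test function `φ`, this gives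
the two forward implications.

*Density.* Conversely, let both limits vanish. Composing with the bounded truncations `t ↦ s⁻¹ sin
(s t)` reduces to a bounded `w` with `|w| ≤ |v|` (`tendsto_energyOne_sub_truncation`). Cutting `w`
off in the disc of radius `ε`, and outside a disc of radius of order `1 / ε`, costs `ε⁻² ∫ w² ρ`
over the small disc up to terms that vanish with `ε` (`tendsto_energyOne_sub_cutoff`). This integral
tends to `0` as well (`tendsto_lintegral_ball_zero`): in `Q₁` and `Q₃`, where `v` is the sum of its
mean, which is controlled by the radial derivative and the third hypothesis on `a`, and of the
oscillation on circles, by `lintegral_sector_sq_le`; in `Q₂` and `Q₄` because `w` is bounded and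
`a(r) / r` is integrable. Away from the origin the weight is bounded above and below, so what
remains can be mollified. If the two limits are merely equal, a multiple of a bump function is
subtracted first.
-/

/-! ### Polar coordinates -/

namespace WeightedPlane

@[simp] lemma polarPoint_zero_coord (r θ : ℝ) : polarPoint r θ 0 = r * Real.cos θ := rfl

@[simp] lemma polarPoint_one_coord (r θ : ℝ) : polarPoint r θ 1 = r * Real.sin θ := rfl

lemma continuous_polarPoint : Continuous fun p : ℝ × ℝ => polarPoint p.1 p.2 := by
  unfold polarPoint
  refine (PiLp.continuous_toLp 2 _).comp (continuous_pi fun i => ?_)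
  fin_cases i
  · exact continuous_fst.mul (Real.continuous_cos.comp continuous_snd)
  · exact continuous_fst.mul (Real.continuous_sin.comp continuous_snd)

lemma norm_polarPoint (r θ : ℝ) : ‖polarPoint r θ‖ = |r| := by
  rw [EuclideanSpace.norm_eq, Fin.sum_univ_two, ← Real.sqrt_sq_eq_abs]
  congr 1
  simp only [polarPoint_zero_coord, polarPoint_one_coord, Real.norm_eq_abs, sq_abs]
  nlinarith [Real.sin_sq_add_cos_sq θ]

lemma polarPoint_eq_smul (r θ : ℝ) : polarPoint r θ = r • polarPoint 1 θ := by
  ext i; fin_cases i <;> simp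

lemma polarPoint_add_two_pi (r θ : ℝ) : polarPoint r (θ + 2 * Real.pi) = polarPoint r θ := by
  ext i; fin_cases i <;> simp

lemma periodic_comp_polarPoint {β : Type*} (f : Plane → β) (r : ℝ) :
    Function.Periodic (fun θ => f (polarPoint r θ)) (2 * Real.pi) := fun θ => by
  simp only [polarPoint_add_two_pi]

lemma _root_.Function.Periodic.setLIntegral_Ioc_add_eq {f : ℝ → ℝ≥0∞} {T : ℝ}
    (hf : Function.Periodic f T) (hT : 0 < T) (s t : ℝ) :
    ∫⁻ x in Ioc s (s + T), f x = ∫⁻ x in Ioc t (t + T), f x := by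
  have : VAddInvariantMeasure (AddSubgroup.zmultiples T) ℝ volume :=
    ⟨fun c s _ => measure_preimage_add _ _ _⟩
  refine (isAddFundamentalDomain_Ioc hT s).setLIntegral_eq (isAddFundamentalDomain_Ioc hT t) f ?_
  exact hf.map_vadd_zmultiples

lemma measurable_comp_polarPoint {β : Type*} [MeasurableSpace β] {f : Plane → β}
    (hf : Measurable f) : Measurable fun p : ℝ × ℝ => f (polarPoint p.1 p.2) :=
  hf.comp continuous_polarPoint.measurable

lemma measurable_comp_polarPoint_right {β : Type*} [MeasurableSpace β] {f : Plane → β}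
    (hf : Measurable f) (r : ℝ) : Measurable fun θ : ℝ => f (polarPoint r θ) :=
  (measurable_comp_polarPoint hf).comp (measurable_const.prodMk measurable_id)

lemma measurable_comp_polarPoint_left {β : Type*} [MeasurableSpace β] {f : Plane → β}
    (hf : Measurable f) (θ : ℝ) : Measurable fun r : ℝ => f (polarPoint r θ) :=
  (measurable_comp_polarPoint hf).comp (measurable_id.prodMk measurable_const)

lemma measurable_ofReal_mul_comp_polarPoint {f : Plane → ℝ≥0∞} (hf : Measurable f) :
    Measurable fun p : ℝ × ℝ => ENNReal.ofReal p.1 * f (polarPoint p.1 p.2) :=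
  (ENNReal.measurable_ofReal.comp measurable_fst).mul (measurable_comp_polarPoint hf)

/-- Integration in polar coordinates, with angles in an arbitrary interval of length `2π`. -/
lemma lintegral_polar {f : Plane → ℝ≥0∞} (hf : Measurable f) (t : ℝ) :
    ∫⁻ x, f x = ∫⁻ r in Ioi (0 : ℝ), ENNReal.ofReal r *
      ∫⁻ θ in Ioc t (t + 2 * Real.pi), f (polarPoint r θ) := by
  have e1 : ∫⁻ x, f x = ∫⁻ q : ℝ × ℝ, f (!₂[q.1, q.2]) := by
    rw [← ((PiLp.volume_preserving_toLp (Fin 2)).comp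
      ((volume_preserving_finTwoArrow ℝ).symm _)).lintegral_comp hf]
    rfl
  rw [e1, ← lintegral_comp_polarCoord_symm]
  have e2 : polarCoord.target = Ioi (0 : ℝ) ×ˢ Ioo (-Real.pi) Real.pi := rfl
  rw [e2, Measure.volume_eq_prod, ← Measure.prod_restrict]
  have e3 : (fun p : ℝ × ℝ => ENNReal.ofReal p.1 •
      f !₂[(polarCoord.symm p).1, (polarCoord.symm p).2]) =
      fun p : ℝ × ℝ => ENNReal.ofReal p.1 * f (polarPoint p.1 p.2) := rfl
  rw [e3, lintegral_prod _ (measurable_ofReal_mul_comp_polarPoint hf).aemeasurable]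
  refine lintegral_congr fun r => ?_
  dsimp only
  rw [lintegral_const_mul _ (measurable_comp_polarPoint_right hf r)]
  congr 1
  rw [(periodic_comp_polarPoint f r).setLIntegral_Ioc_add_eq Real.two_pi_pos t (-Real.pi)]
  have : -Real.pi + 2 * Real.pi = Real.pi := by ring
  rw [this]
  exact setLIntegral_congr Ioo_ae_eq_Ioc

/-- The measure `dθ` on the angles `(0, π / 2)`. -/
noncomputable def arc : Measure ℝ := volume.restrict (Ioo 0 (Real.pi / 2))

instance : IsFiniteMeasure arc := by unfold arc; infer_instance

lemma arc_univ : arc univ = ENNReal.ofReal (Real.pi / 2) := by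
  simp [arc]

lemma integral_quarter (f : ℝ → ℝ) :
    ∫ θ in (0 : ℝ)..(Real.pi / 2), f θ = ∫ θ, f θ ∂arc := by
  rw [intervalIntegral.integral_of_le (by positivity), integral_Ioc_eq_integral_Ioo, arc]

lemma intervalIntegrable_quarter_iff {f : ℝ → ℝ} :
    IntervalIntegrable f volume 0 (Real.pi / 2) ↔ Integrable f arc := by
  rw [intervalIntegrable_iff_integrableOn_Ioo_of_le (by positivity), arc, IntegrableOn]

lemma measurable_comp_polarPoint_add {β : Type*} [MeasurableSpace β] {f : Plane → β}
    (hf : Measurable f) (α : ℝ) : Measurable fun p : ℝ × ℝ => f (polarPoint p.1 (p.2 + α)) :=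
  hf.comp (continuous_polarPoint.comp
    (continuous_fst.prodMk (continuous_snd.add continuous_const))).measurable

lemma lintegral_sector_le {f : Plane → ℝ≥0∞} (hf : Measurable f) (α : ℝ) :
    ∫⁻ r in Ioi (0 : ℝ), ENNReal.ofReal r * ∫⁻ θ, f (polarPoint r (θ + α)) ∂arc ≤
      ∫⁻ x, f x := by
  rw [lintegral_polar hf α]
  refine lintegral_mono fun r => mul_le_mul_right ?_ _
  have : ∫⁻ θ, f (polarPoint r (θ + α)) ∂arc ≤
      ∫⁻ θ in Ioc 0 (2 * Real.pi), f (polarPoint r (θ + α)) := by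
    refine lintegral_mono_set fun θ hθ => ⟨hθ.1, ?_⟩
    linarith [hθ.2, Real.pi_pos]
  refine this.trans (le_of_eq ?_)
  have h2 : MeasurableEmbedding fun θ : ℝ => θ + α := measurableEmbedding_addRight α
  rw [← (measurePreserving_add_right volume α).setLIntegral_comp_preimage_emb h2
    (fun θ => f (polarPoint r θ)) (Ioc α (α + 2 * Real.pi))]
  congr 2
  ext θ
  simp [add_comm]

/-- Polar coordinates pull null sets back to null sets, with the angle ranging over all of `ℝ`. -/
lemma ae_polar {P : Plane → Prop} (h : ∀ᵐ x, P x) :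
    ∀ᵐ p ∂((volume.restrict (Ioi (0 : ℝ))).prod volume), P (polarPoint p.1 p.2) := by
  obtain ⟨N, hN, hNm, hN0⟩ := exists_measurable_superset_of_null (ae_iff.1 h)
  have key : ∀ᵐ p ∂((volume.restrict (Ioi (0 : ℝ))).prod (volume : Measure ℝ)),
      polarPoint p.1 p.2 ∉ N := by
    have hms : MeasurableSet {p : ℝ × ℝ | polarPoint p.1 p.2 ∈ N} :=
      hNm.preimage continuous_polarPoint.measurable
    -- the angles are cut into intervals of length `2π`, on each of which `lintegral_polar` applies
    have hn : ∀ k : ℤ, ∀ᵐ r ∂(volume.restrict (Ioi (0 : ℝ))),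
        ∀ᵐ θ ∂(volume.restrict (Ioc (k * (2 * Real.pi)) (k * (2 * Real.pi) + 2 * Real.pi))),
          polarPoint r θ ∉ N := by
      intro k
      have h0 : ∫⁻ x, N.indicator (fun _ => (1 : ℝ≥0∞)) x = 0 := by
        rw [lintegral_indicator hNm]; simp [hN0]
      rw [lintegral_polar (measurable_const.indicator hNm) (k * (2 * Real.pi))] at h0
      have hm : Measurable (N.indicator (fun _ => (1 : ℝ≥0∞))) := measurable_const.indicator hNm
      have hm1 := ENNReal.measurable_ofReal.mul
        ((measurable_comp_polarPoint hm).lintegral_prod_right'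
          (ν := volume.restrict (Ioc (k * (2 * Real.pi)) (k * (2 * Real.pi) + 2 * Real.pi))))
      have h0 := (lintegral_eq_zero_iff hm1).1 h0
      filter_upwards [h0, ae_restrict_mem measurableSet_Ioi] with r hr hr0
      have hr1 : ENNReal.ofReal r ≠ 0 := by simpa using hr0
      simp only [Pi.mul_apply, Pi.zero_apply, mul_eq_zero, hr1, false_or] at hr
      rw [lintegral_eq_zero_iff (measurable_comp_polarPoint_right hm r)] at hr
      filter_upwards [hr] with θ hθ hmem
      simp [hmem] at hθ
    refine (Measure.ae_prod_iff_ae_ae (p := fun p : ℝ × ℝ => polarPoint p.1 p.2 ∉ N)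
      hms.compl).2 ?_
    filter_upwards [ae_all_iff.2 hn] with r hr
    have : ∀ᵐ θ ∂(volume.restrict (⋃ k : ℤ, Ioc ((k : ℝ) * (2 * Real.pi))
        (k * (2 * Real.pi) + 2 * Real.pi))), polarPoint r θ ∉ N := by
      rw [ae_restrict_iUnion_iff]; exact hr
    have hU : (⋃ k : ℤ, Ioc ((k : ℝ) * (2 * Real.pi))
        (k * (2 * Real.pi) + 2 * Real.pi)) = univ := by
      have := iUnion_Ioc_zsmul Real.two_pi_pos
      simpa [add_mul] using this
    rwa [hU, Measure.restrict_univ] at this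
  filter_upwards [key] with p hp
  by_contra hc
  exact hp (hN hc)

lemma ae_circle_of_ae {P : Plane → Prop} (h : ∀ᵐ x, P x) :
    ∀ᵐ r ∂(volume.restrict (Ioi (0 : ℝ))), ∀ᵐ θ : ℝ, P (polarPoint r θ) :=
  Measure.ae_ae_of_ae_prod (ae_polar h)

lemma ae_ray_of_ae {P : Plane → Prop} (h : ∀ᵐ x, P x) :
    ∀ᵐ θ : ℝ, ∀ᵐ r ∂(volume.restrict (Ioi (0 : ℝ))), P (polarPoint r θ) := by
  have := (Measure.measurePreserving_swap (μ := (volume : Measure ℝ))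
    (ν := volume.restrict (Ioi (0 : ℝ)))).quasiMeasurePreserving.ae (ae_polar h)
  exact Measure.ae_ae_of_ae_prod this

lemma ae_add_right {P : ℝ → Prop} (h : ∀ᵐ θ : ℝ, P θ) (α : ℝ) : ∀ᵐ θ : ℝ, P (θ + α) :=
  (measurePreserving_add_right volume α).quasiMeasurePreserving.ae h

lemma ae_arc {P : ℝ → Prop} (h : ∀ᵐ θ : ℝ, P θ) : ∀ᵐ θ ∂arc, P θ := ae_restrict_of_ae h

lemma ae_arc_add {P : ℝ → Prop} (h : ∀ᵐ θ : ℝ, P θ) (α : ℝ) : ∀ᵐ θ ∂arc, P (θ + α) :=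
  ae_arc (ae_add_right h α)

/-- A function that is integrable on balls is integrable on almost every ray, away from `0`. -/
lemma ae_ray_lintegral_lt_top {S : Plane → ℝ≥0∞} (hS : Measurable S)
    (h : ∀ R : ℕ, ∫⁻ x in Metric.ball 0 (R : ℝ), S x < ∞) :
    ∀ᵐ θ : ℝ, ∀ r₁ r₂ : ℝ, 0 < r₁ → ∫⁻ r in Icc r₁ r₂, S (polarPoint r θ) < ∞ := by
  have hm := measurable_ofReal_mul_comp_polarPoint hS
  have key : ∀ k : ℤ, ∀ R : ℕ, ∀ᵐ θ ∂(volume.restrict (Ioc (k * (2 * Real.pi))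
      (k * (2 * Real.pi) + 2 * Real.pi))),
      ∫⁻ r in Ioo 0 (R : ℝ), ENNReal.ofReal r * S (polarPoint r θ) < ∞ := by
    intro k R
    have h0 := h R
    rw [← lintegral_indicator Metric.isOpen_ball.measurableSet,
      lintegral_polar (hS.indicator Metric.isOpen_ball.measurableSet) (k * (2 * Real.pi))] at h0
    have h1 : ∫⁻ r in Ioo 0 (R : ℝ), ∫⁻ θ in Ioc (k * (2 * Real.pi))
        (k * (2 * Real.pi) + 2 * Real.pi), ENNReal.ofReal r * S (polarPoint r θ) < ∞ := by
      refine lt_of_le_of_lt ?_ h0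
      refine le_trans ?_ (lintegral_mono_set (Ioo_subset_Ioi_self : Ioo 0 (R : ℝ) ⊆ Ioi 0))
      refine le_of_eq (setLIntegral_congr_fun measurableSet_Ioo fun r hr => ?_)
      have : ∀ θ, polarPoint r θ ∈ Metric.ball (0 : Plane) R := fun θ => by
        rw [mem_ball_zero_iff, norm_polarPoint, abs_of_pos hr.1]; exact hr.2
      simp only [indicator_of_mem (this _)]
      rw [lintegral_const_mul _ (measurable_comp_polarPoint_right hS r)]
    rw [lintegral_lintegral_swap (f := fun r θ => ENNReal.ofReal r * S (polarPoint r θ))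
      hm.aemeasurable] at h1
    exact ae_lt_top hm.lintegral_prod_left' h1.ne
  have key2 : ∀ᵐ θ : ℝ, ∀ R : ℕ,
      ∫⁻ r in Ioo 0 (R : ℝ), ENNReal.ofReal r * S (polarPoint r θ) < ∞ := by
    rw [ae_all_iff]
    intro R
    have : ∀ᵐ θ ∂(volume.restrict (⋃ k : ℤ, Ioc ((k : ℝ) * (2 * Real.pi))
        (k * (2 * Real.pi) + 2 * Real.pi))),
        ∫⁻ r in Ioo 0 (R : ℝ), ENNReal.ofReal r * S (polarPoint r θ) < ∞ := by
      rw [ae_restrict_iUnion_iff]; exact fun k => key k R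
    have hU : (⋃ k : ℤ, Ioc ((k : ℝ) * (2 * Real.pi))
        (k * (2 * Real.pi) + 2 * Real.pi)) = univ := by
      have := iUnion_Ioc_zsmul Real.two_pi_pos
      simpa [add_mul] using this
    rwa [hU, Measure.restrict_univ] at this
  filter_upwards [key2] with θ hθ r₁ r₂ h1
  obtain ⟨R, hR⟩ := exists_nat_gt r₂
  have h2 : ENNReal.ofReal r₁ * ∫⁻ r in Icc r₁ r₂, S (polarPoint r θ) < ∞ := by
    rw [← lintegral_const_mul _ (measurable_comp_polarPoint_left hS θ)]
    refine lt_of_le_of_lt (le_trans (setLIntegral_mono' measurableSet_Icc fun r hr => ?_)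
      (lintegral_mono_set (t := Ioo 0 (R : ℝ)) fun r hr =>
        ⟨h1.trans_le hr.1, hr.2.trans_lt hR⟩)) (hθ R)
    gcongr
    exact hr.1
  by_contra hc
  rw [not_lt, top_le_iff] at hc
  rw [hc, ENNReal.mul_top (by simpa using h1)] at h2
  exact lt_irrefl _ h2

/-- A function that is integrable on balls is integrable on quarters of almost every circle. -/
lemma ae_circle_lintegral_lt_top {S : Plane → ℝ≥0∞} (hS : Measurable S)
    (h : ∀ R : ℕ, ∫⁻ x in Metric.ball 0 (R : ℝ), S x < ∞) (α : ℝ) :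
    ∀ᵐ r ∂(volume.restrict (Ioi (0 : ℝ))), ∫⁻ θ, S (polarPoint r (θ + α)) ∂arc < ∞ := by
  have hm := measurable_comp_polarPoint_add hS α
  have key : ∀ᵐ r ∂(volume.restrict (Ioi (0 : ℝ))), ∀ R : ℕ, r < (R : ℝ) →
      ∫⁻ θ, S (polarPoint r (θ + α)) ∂arc < ∞ := by
    rw [ae_all_iff]
    intro R
    have h0 := h R
    rw [← lintegral_indicator Metric.isOpen_ball.measurableSet] at h0
    have h1 := (lintegral_sector_le (hS.indicator Metric.isOpen_ball.measurableSet) α).trans_lt h0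
    have hm' := measurable_comp_polarPoint_add (hS.indicator
      (Metric.isOpen_ball (x := (0 : Plane)) (ε := (R : ℝ))).measurableSet) α
    have h2 := ae_lt_top (ENNReal.measurable_ofReal.mul
      hm'.lintegral_prod_right') h1.ne
    filter_upwards [h2, ae_restrict_mem measurableSet_Ioi]
      with r hr hr0 hrR
    simp only [Pi.mul_apply] at hr
    have hr0' : 0 < r := hr0
    have : ∀ θ, polarPoint r θ ∈ Metric.ball (0 : Plane) R := fun θ => by
      rw [mem_ball_zero_iff, norm_polarPoint, abs_of_pos hr0']; exact hrR
    simp only [indicator_of_mem (this _)] at hr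
    by_contra hc
    rw [not_lt, top_le_iff] at hc
    rw [hc, ENNReal.mul_top (by simpa using hr0')] at hr
    exact lt_irrefl _ hr
  filter_upwards [key] with r hr
  obtain ⟨R, hR⟩ := exists_nat_gt r
  exact hr R hR

end WeightedPlane

/-! ### Calculus of weak gradients -/

namespace WeightedPlane

lemma gradient_apply_coord (φ : Plane → ℝ) (x : Plane) (i : Fin 2) :
    gradient φ x i = fderiv ℝ φ x (EuclideanSpace.single i 1) := by
  have h : inner ℝ (gradient φ x) (EuclideanSpace.single i (1 : ℝ)) =
      fderiv ℝ φ x (EuclideanSpace.single i 1) := by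
    rw [gradient, InnerProductSpace.toDual_symm_apply]
  rw [← h, EuclideanSpace.inner_single_right]
  simp

lemma inner_gradient (φ : Plane → ℝ) (x v : Plane) :
    inner ℝ (gradient φ x) v = fderiv ℝ φ x v := by
  rw [gradient, InnerProductSpace.toDual_symm_apply]

lemma continuous_gradient {φ : Plane → ℝ} (h : ContDiff ℝ 1 φ) : Continuous (gradient φ) :=
  (LinearIsometryEquiv.continuous _).comp (h.continuous_fderiv one_ne_zero)

lemma gradient_eq_zero_of_notMem_tsupport {φ : Plane → ℝ} {x : Plane} (h : x ∉ tsupport φ) :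
    gradient φ x = 0 := by
  have : fderiv ℝ φ x = 0 := by
    by_contra hc
    exact h (support_fderiv_subset ℝ (by simpa using hc))
  simp [gradient, this]

lemma gradient_sub' {φ ψ : Plane → ℝ} {x : Plane} (hφ : DifferentiableAt ℝ φ x)
    (hψ : DifferentiableAt ℝ ψ x) :
    gradient (fun y => φ y - ψ y) x = gradient φ x - gradient ψ x := by
  unfold gradient
  rw [fderiv_fun_sub hφ hψ, map_sub]

lemma testFunctions.contDiff_one {φ : Plane → ℝ} (h : φ ∈ testFunctions) : ContDiff ℝ 1 φ :=
  h.1.of_le (by exact_mod_cast le_top)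

lemma testFunctions.mul_left {η φ : Plane → ℝ} (hη : ContDiff ℝ ((⊤ : ℕ∞) : WithTop ℕ∞) η)
    (h : φ ∈ testFunctions) : (fun x => η x * φ x) ∈ testFunctions :=
  ⟨hη.mul h.1, h.2.mul_left⟩

lemma testFunctions.sub {φ ψ : Plane → ℝ} (hφ : φ ∈ testFunctions) (hψ : ψ ∈ testFunctions) :
    φ - ψ ∈ testFunctions := ⟨hφ.1.sub hψ.1, hφ.2.sub hψ.2⟩

lemma testFunctions.add {φ ψ : Plane → ℝ} (hφ : φ ∈ testFunctions) (hψ : ψ ∈ testFunctions) :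
    φ + ψ ∈ testFunctions := ⟨hφ.1.add hψ.1, hφ.2.add hψ.2⟩

lemma testFunctions.continuous_fderiv_apply {φ : Plane → ℝ} (h : φ ∈ testFunctions) (v : Plane) :
    Continuous fun x => fderiv ℝ φ x v :=
  ((testFunctions.contDiff_one h).continuous_fderiv one_ne_zero).clm_apply continuous_const

lemma testFunctions.hasCompactSupport_fderiv_apply {φ : Plane → ℝ} (h : φ ∈ testFunctions)
    (v : Plane) : HasCompactSupport fun x => fderiv ℝ φ x v := h.2.fderiv_apply ℝ v

lemma _root_.MeasureTheory.LocallyIntegrable.integrable_mul_of_hasCompactSupport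
    {u ψ : Plane → ℝ} (hu : LocallyIntegrable u) (h : Continuous ψ) (hc : HasCompactSupport ψ) :
    Integrable fun x => u x * ψ x := by
  simpa [mul_comm] using hu.integrable_smul_left_of_hasCompactSupport h hc

lemma _root_.MeasureTheory.LocallyIntegrable.coord {g : Plane → Plane} (hg : LocallyIntegrable g)
    (i : Fin 2) : LocallyIntegrable fun x => g x i := fun x => by
  obtain ⟨s, hs, h⟩ := hg x
  exact ⟨s, hs, (EuclideanSpace.proj (𝕜 := ℝ) i).integrable_comp h⟩

namespace HasWeakGradient

variable {u w : Plane → ℝ} {g h : Plane → Plane}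

lemma congr_fun_ae (hu : HasWeakGradient u g) (hw : u =ᵐ[volume] w) : HasWeakGradient w g where
  locallyIntegrable := hu.1.congr hw
  locallyIntegrable_grad := hu.2
  integral_eq φ hφ i := by
    rw [← hu.3 φ hφ i]
    refine integral_congr_ae ?_
    filter_upwards [hw] with x hx
    rw [hx]

lemma congr_grad_ae (hu : HasWeakGradient u g) (hh : g =ᵐ[volume] h) : HasWeakGradient u h where
  locallyIntegrable := hu.1
  locallyIntegrable_grad := hu.2.congr hh
  integral_eq φ hφ i := by
    rw [hu.3 φ hφ i]
    congr 1
    refine integral_congr_ae ?_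
    filter_upwards [hh] with x hx
    rw [hx]

/-- The weak gradient is unique up to a null set. -/
lemma ae_eq (hg : HasWeakGradient u g) (hh : HasWeakGradient u h) : g =ᵐ[volume] h := by
  have key : ∀ i : Fin 2, ∀ᵐ x, g x i = h x i := fun i => by
    refine ae_eq_of_integral_contDiff_smul_eq (hg.2.coord i) (hh.2.coord i) fun φ h1 h2 => ?_
    have e1 := hg.3 φ ⟨h1, h2⟩ i
    rw [hh.3 φ ⟨h1, h2⟩ i] at e1
    simp only [smul_eq_mul, mul_comm (φ _)]
    linarith
  filter_upwards [key 0, key 1] with x h0 h1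
  ext i; fin_cases i
  · exact h0
  · exact h1

lemma sub (hu : HasWeakGradient u g) (hw : HasWeakGradient w h) :
    HasWeakGradient (u - w) (g - h) where
  locallyIntegrable := hu.1.sub hw.1
  locallyIntegrable_grad := hu.2.sub hw.2
  integral_eq φ hφ i := by
    have c1 := testFunctions.continuous_fderiv_apply hφ (EuclideanSpace.single i 1)
    have c2 := testFunctions.hasCompactSupport_fderiv_apply hφ (EuclideanSpace.single i 1)
    simp only [Pi.sub_apply, PiLp.sub_apply, sub_mul]
    rw [integral_sub (hu.1.integrable_mul_of_hasCompactSupport c1 c2)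
      (hw.1.integrable_mul_of_hasCompactSupport c1 c2),
      integral_sub ((hu.2.coord i).integrable_mul_of_hasCompactSupport hφ.1.continuous hφ.2)
      ((hw.2.coord i).integrable_mul_of_hasCompactSupport hφ.1.continuous hφ.2),
      hu.3 φ hφ i, hw.3 φ hφ i]
    ring

/-- The weak gradient of a continuously differentiable function is its gradient. -/
lemma of_contDiff {f : Plane → ℝ} (hf : ContDiff ℝ 1 f) : HasWeakGradient f (gradient f) where
  locallyIntegrable := hf.continuous.locallyIntegrable
  locallyIntegrable_grad := (continuous_gradient hf).locallyIntegrable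
  integral_eq φ hφ i := by
    have c1 := testFunctions.continuous_fderiv_apply hφ (EuclideanSpace.single i 1)
    have c2 := testFunctions.hasCompactSupport_fderiv_apply hφ (EuclideanSpace.single i 1)
    have l1 := hf.continuous.locallyIntegrable (μ := (volume : Measure Plane))
    have l2 := ((continuous_gradient hf).locallyIntegrable (μ := (volume : Measure Plane))).coord i
    simp only [gradient_apply_coord] at l2 ⊢
    exact integral_mul_fderiv_eq_neg_fderiv_mul_of_integrable
      (l2.integrable_mul_of_hasCompactSupport hφ.1.continuous hφ.2)
      (l1.integrable_mul_of_hasCompactSupport c1 c2)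
      (l1.integrable_mul_of_hasCompactSupport hφ.1.continuous hφ.2)
      (fun x _ => hf.differentiable one_ne_zero x)
      (fun x _ => (testFunctions.contDiff_one hφ).differentiable one_ne_zero x)

/-- Leibniz rule for the product with a smooth function. -/
lemma mul_left {η : Plane → ℝ} (hη : ContDiff ℝ ((⊤ : ℕ∞) : WithTop ℕ∞) η)
    (hu : HasWeakGradient u g) :
    HasWeakGradient (fun x => η x * u x) (fun x => η x • g x + u x • gradient η x) where
  locallyIntegrable := by
    simpa [mul_comm] using
      hu.1.continuous_smul (g := fun x => η x) hη.continuous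
  locallyIntegrable_grad := by
    have hη1 : ContDiff ℝ 1 η := hη.of_le (by exact_mod_cast le_top)
    exact (hu.2.continuous_smul hη.continuous).add
      (hu.1.smul_continuous (continuous_gradient hη1))
  integral_eq φ hφ i := by
    have hη1 : ContDiff ℝ 1 η := hη.of_le (by exact_mod_cast le_top)
    set e : Plane := EuclideanSpace.single i 1 with he
    have key := hu.3 _ (testFunctions.mul_left hη hφ) i
    have hd : ∀ x, fderiv ℝ (fun y => η y * φ y) x e =
        η x * fderiv ℝ φ x e + φ x * fderiv ℝ η x e := fun x => by
      rw [fderiv_fun_mul (hη1.differentiable one_ne_zero x)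
        ((testFunctions.contDiff_one hφ).differentiable one_ne_zero x)]
      simp
    simp only [← he, hd, mul_add] at key
    have c1 := testFunctions.continuous_fderiv_apply hφ e
    have c2 := testFunctions.hasCompactSupport_fderiv_apply hφ e
    have c3 : Continuous fun x => fderiv ℝ η x e :=
      (hη1.continuous_fderiv one_ne_zero).clm_apply continuous_const
    have i1 : Integrable fun x => u x * (η x * fderiv ℝ φ x e) :=
      hu.1.integrable_mul_of_hasCompactSupport (hη.continuous.mul c1) c2.mul_left
    have i2 : Integrable fun x => u x * (φ x * fderiv ℝ η x e) :=
      hu.1.integrable_mul_of_hasCompactSupport (hφ.1.continuous.mul c3) hφ.2.mul_right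
    have i3 : Integrable fun x => g x i * (η x * φ x) :=
      (hu.2.coord i).integrable_mul_of_hasCompactSupport (hη.continuous.mul hφ.1.continuous)
        hφ.2.mul_left
    rw [integral_add i1 i2] at key
    have e1 : ∫ x, η x * u x * fderiv ℝ φ x e = ∫ x, u x * (η x * fderiv ℝ φ x e) :=
      integral_congr_ae (ae_of_all _ fun x => by ring)
    have e2 : ∫ x, (η x • g x + u x • gradient η x) i * φ x =
        (∫ x, g x i * (η x * φ x)) + ∫ x, u x * (φ x * fderiv ℝ η x e) := by
      rw [← integral_add i3 i2]
      refine integral_congr_ae (ae_of_all _ fun x => ?_)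
      simp only [PiLp.add_apply, PiLp.smul_apply, smul_eq_mul, gradient_apply_coord, ← he]
      ring
    rw [e1, e2]
    linarith

lemma exists_measurable (hu : HasWeakGradient u g) :
    ∃ g', Measurable g' ∧ HasWeakGradient u g' := by
  have hm : AEStronglyMeasurable g := hu.2.aestronglyMeasurable
  exact ⟨hm.mk g, hm.stronglyMeasurable_mk.measurable, hu.congr_grad_ae hm.ae_eq_mk⟩

end HasWeakGradient

lemma hasWeakGradient_weakGradient {u : Plane → ℝ} (hu : u ∈ W11loc) :
    HasWeakGradient u (weakGradient u) := by
  have h : ∃ g, HasWeakGradient u g := hu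
  rw [weakGradient, dif_pos h]
  exact h.choose_spec

/-- The energy may be computed with any weak gradient. -/
lemma energyOne_eq {u : Plane → ℝ} {g : Plane → Plane} (hu : HasWeakGradient u g)
    (ρ : Plane → ℝ≥0∞) :
    energyOne ρ u = (∫⁻ x, ‖g x‖ₑ ^ 2 * ρ x) + ∫⁻ x, ‖u x‖ₑ ^ 2 * ρ x := by
  rw [energyOne]
  congr 1
  refine lintegral_congr_ae ?_
  filter_upwards [(hasWeakGradient_weakGradient ⟨g, hu⟩).ae_eq hu] with x hx
  rw [hx]

lemma enorm_sub_sq_le {E : Type*} [NormedAddCommGroup E] (x y : E) :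
    ‖x - y‖ₑ ^ 2 ≤ 2 * ‖x‖ₑ ^ 2 + 2 * ‖y‖ₑ ^ 2 := by
  have h : ‖x - y‖₊ ^ 2 ≤ 2 * ‖x‖₊ ^ 2 + 2 * ‖y‖₊ ^ 2 := by
    rw [← NNReal.coe_le_coe]
    push_cast
    nlinarith [norm_sub_le x y, norm_nonneg (x - y), sq_nonneg (‖x‖ - ‖y‖)]
  simp only [enorm_eq_nnnorm]
  exact_mod_cast h

lemma enorm_add_sq_le {E : Type*} [NormedAddCommGroup E] (x y : E) :
    ‖x + y‖ₑ ^ 2 ≤ 2 * ‖x‖ₑ ^ 2 + 2 * ‖y‖ₑ ^ 2 := by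
  simpa using enorm_sub_sq_le x (-y)

lemma energyOne_sub_le {u w : Plane → ℝ} (hu : u ∈ W11loc) (hw : w ∈ W11loc)
    {ρ : Plane → ℝ≥0∞} (hρ : Measurable ρ) :
    energyOne ρ (u - w) ≤ 2 * energyOne ρ u + 2 * energyOne ρ w := by
  obtain ⟨g, hg⟩ := hu
  obtain ⟨h, hh⟩ := hw
  rw [energyOne_eq (hg.sub hh), energyOne_eq hg, energyOne_eq hh]
  have key : ∀ {E : Type} [NormedAddCommGroup E] (f f' : Plane → E),
      AEStronglyMeasurable f → AEStronglyMeasurable f' →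
      ∫⁻ x, ‖(f - f') x‖ₑ ^ 2 * ρ x ≤
        2 * (∫⁻ x, ‖f x‖ₑ ^ 2 * ρ x) + 2 * ∫⁻ x, ‖f' x‖ₑ ^ 2 * ρ x := by
    intro E _ f f' hf hf'
    have m1 : AEMeasurable fun x => ‖f x‖ₑ ^ 2 * ρ x := (hf.enorm.pow_const 2).mul hρ.aemeasurable
    rw [← lintegral_const_mul' _ _ (by simp), ← lintegral_const_mul' _ _ (by simp),
      ← lintegral_add_left' (m1.const_mul 2)]
    refine lintegral_mono fun x => ?_
    rw [← mul_assoc, ← mul_assoc, ← add_mul]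
    gcongr
    exact enorm_sub_sq_le _ _
  refine (add_le_add (key g h hg.2.aestronglyMeasurable hh.2.aestronglyMeasurable)
    (key u w hg.1.aestronglyMeasurable hh.1.aestronglyMeasurable)).trans (le_of_eq ?_)
  ring

lemma sub_mem_spaceW {u w : Plane → ℝ} {ρ : Plane → ℝ≥0∞} (hρ : Measurable ρ)
    (hu : u ∈ spaceW ρ) (hw : w ∈ spaceW ρ) : u - w ∈ spaceW ρ := by
  obtain ⟨g, hg⟩ := hu.1
  obtain ⟨h, hh⟩ := hw.1
  refine ⟨⟨_, hg.sub hh⟩, (energyOne_sub_le hu.1 hw.1 hρ).trans_lt ?_⟩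
  exact ENNReal.add_lt_top.2 ⟨ENNReal.mul_lt_top (by simp) hu.2, ENNReal.mul_lt_top (by simp) hw.2⟩

lemma testFunctions_subset_W11loc {φ : Plane → ℝ} (hφ : φ ∈ testFunctions) : φ ∈ W11loc :=
  ⟨_, .of_contDiff (testFunctions.contDiff_one hφ)⟩

end WeightedPlane

/-! ### Mollification -/

namespace WeightedPlane

variable {E : Type*} [NormedAddCommGroup E]

/-- Translations act continuously on `L^p`. -/
lemma exists_eLpNorm_translate_sub_le {p : ℝ≥0∞} (hp1 : 1 ≤ p) (hp : p ≠ ∞) {f : Plane → E}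
    (hf : MemLp f p) {ε : ℝ≥0∞} (hε : 0 < ε) :
    ∃ δ > 0, ∀ t : Plane, ‖t‖ < δ → eLpNorm (fun x => f (x - t) - f x) p ≤ ε := by
  have := Fact.mk hp1
  have := Fact.mk hp
  have hcont : Continuous fun t : Plane => (DomAddAct.mk t) +ᵥ hf.toLp f :=
    DomAddAct.continuous_mk.vadd continuous_const
  have h0 := (hcont.tendsto 0).eventually (Metric.eball_mem_nhds _ hε)
  rw [Metric.eventually_nhds_iff] at h0
  obtain ⟨δ, hδ, h⟩ := h0
  refine ⟨δ, hδ, fun t ht => ?_⟩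
  have h1 := h (y := -t) (by simpa using ht)
  rw [DomAddAct.mk_vadd_toLp, DomAddAct.mk_vadd_toLp, Lp.edist_toLp_toLp] at h1
  refine le_trans (le_of_eq ?_) h1.le
  congr 1
  ext x
  simp [sub_eq_neg_add]

variable [NormedSpace ℝ E]

/-- The mollification of `f` by a normalized bump function. -/
noncomputable def mollify (b : ContDiffBump (0 : Plane)) (f : Plane → E) (x : Plane) : E :=
  ∫ t, b.normed volume t • f (x - t)

lemma mollify_eq_convolution (b : ContDiffBump (0 : Plane)) (f : Plane → E) :
    mollify b f = MeasureTheory.convolution (b.normed volume) f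
      (ContinuousLinearMap.lsmul ℝ ℝ) volume := by
  ext x; rfl

/-- The probability measure whose density is a normalized bump function. -/
noncomputable def bumpMeasure (b : ContDiffBump (0 : Plane)) : Measure Plane :=
  volume.withDensity fun t => ENNReal.ofReal (b.normed volume t)

instance (b : ContDiffBump (0 : Plane)) : IsProbabilityMeasure (bumpMeasure b) := ⟨by
  rw [bumpMeasure, withDensity_apply _ MeasurableSet.univ, Measure.restrict_univ,
    ← ofReal_integral_eq_lintegral_ofReal b.integrable_normed
      (ae_of_all _ fun t => b.nonneg_normed t), b.integral_normed, ENNReal.ofReal_one]⟩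

lemma lintegral_bumpMeasure (b : ContDiffBump (0 : Plane)) (F : Plane → ℝ≥0∞) :
    ∫⁻ t, F t ∂bumpMeasure b = ∫⁻ t, ENNReal.ofReal (b.normed volume t) * F t := by
  rw [bumpMeasure, lintegral_withDensity_eq_lintegral_mul_non_measurable]
  · rfl
  · exact ENNReal.measurable_ofReal.comp b.continuous_normed.measurable
  · exact ae_of_all _ fun _ => ENNReal.ofReal_lt_top

lemma integrable_normed_smul_comp_sub {f : Plane → E} (hf : LocallyIntegrable f)
    (b : ContDiffBump (0 : Plane)) (x : Plane) :
    Integrable fun t => b.normed volume t • f (x - t) :=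
  (HasCompactSupport.convolutionExists_left (L := ContinuousLinearMap.lsmul ℝ ℝ)
    b.hasCompactSupport_normed b.continuous_normed hf x)

lemma enorm_mollify_sub_le [CompleteSpace E] {f : Plane → E} (hf : LocallyIntegrable f)
    (b : ContDiffBump (0 : Plane)) (x : Plane) :
    ‖mollify b f x - f x‖ₑ ≤ ∫⁻ t, ‖f (x - t) - f x‖ₑ ∂bumpMeasure b := by
  have h1 : mollify b f x - f x = ∫ t, b.normed volume t • (f (x - t) - f x) := by
    simp only [smul_sub]
    rw [integral_sub (integrable_normed_smul_comp_sub hf b x) (b.integrable_normed.smul_const _),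
      b.integral_normed_smul]
    rfl
  rw [h1, lintegral_bumpMeasure]
  refine (enorm_integral_le_lintegral_enorm _).trans (le_of_eq ?_)
  refine lintegral_congr fun t => ?_
  rw [enorm_smul, Real.enorm_eq_ofReal (b.nonneg_normed t)]

/-- Mollification at a scale at which the translates of `f` are `L^p`-close to `f`. -/
lemma eLpNorm_mollify_sub_le [CompleteSpace E] {p : ℝ≥0∞} (hp1 : 1 ≤ p) (hp : p ≠ ∞)
    {f : Plane → E} (hf : MemLp f p) (b : ContDiffBump (0 : Plane)) {ε : ℝ≥0∞}
    (h : ∀ t : Plane, ‖t‖ < b.rOut → eLpNorm (fun x => f (x - t) - f x) p ≤ ε) :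
    eLpNorm (fun x => mollify b f x - f x) p ≤ ε := by
  have hp0 : p ≠ 0 := (zero_lt_one.trans_le hp1).ne'
  have hpt : 1 ≤ p.toReal := by
    rw [← ENNReal.toReal_one]; exact ENNReal.toReal_mono hp hp1
  have hpt0 : 0 < p.toReal := by linarith
  have hloc : LocallyIntegrable f := hf.locallyIntegrable hp1
  rw [eLpNorm_eq_lintegral_rpow_enorm_toReal hp0 hp]
  have hm : AEStronglyMeasurable (fun q : Plane × Plane => f (q.1 - q.2) - f q.1)
      (volume.prod (bumpMeasure b)) := by
    have hac : (volume : Measure Plane).prod (bumpMeasure b) ≪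
        (volume : Measure Plane).prod volume :=
      (Measure.AbsolutelyContinuous.refl _).prod
        (withDensity_absolutelyContinuous (volume : Measure Plane) _)
    have h1 : AEStronglyMeasurable (fun q : Plane × Plane => f (q.1 - q.2))
        (volume.prod volume) := hf.1.comp_quasiMeasurePreserving
      (quasiMeasurePreserving_sub_of_right_invariant (volume : Measure Plane) volume)
    have h2 : AEStronglyMeasurable (fun q : Plane × Plane => f q.1)
        (volume.prod volume) := hf.1.comp_fst
    exact (h1.sub h2).mono_ac hac
  have hpow : AEMeasurable (fun q : Plane × Plane => ‖f (q.1 - q.2) - f q.1‖ₑ ^ p.toReal)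
      (volume.prod (bumpMeasure b)) := hm.enorm.pow_const _
  have hb : ∫⁻ x, ‖mollify b f x - f x‖ₑ ^ p.toReal ≤ ε ^ p.toReal := by
    calc ∫⁻ x, ‖mollify b f x - f x‖ₑ ^ p.toReal
        ≤ ∫⁻ x, ∫⁻ t, ‖f (x - t) - f x‖ₑ ^ p.toReal ∂bumpMeasure b := by
          refine lintegral_mono_ae ?_
          filter_upwards [hm.prodMk_left] with x hx
          -- Jensen's inequality for the probability measure `bumpMeasure b`
          have h1 := eLpNorm'_le_eLpNorm'_of_exponent_le one_pos hpt (bumpMeasure b) hx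
          rw [eLpNorm'_eq_lintegral_enorm, eLpNorm'_eq_lintegral_enorm] at h1
          simp only [ENNReal.rpow_one, div_one] at h1
          have h2 := (enorm_mollify_sub_le hloc b x).trans h1
          rwa [one_div, ENNReal.le_rpow_inv_iff hpt0] at h2
      _ = ∫⁻ t, (∫⁻ x, ‖f (x - t) - f x‖ₑ ^ p.toReal) ∂bumpMeasure b :=
          lintegral_lintegral_swap (f := fun x t => ‖f (x - t) - f x‖ₑ ^ p.toReal) hpow
      _ ≤ ∫⁻ t, ε ^ p.toReal ∂bumpMeasure b := by
          rw [lintegral_bumpMeasure b (fun t => ∫⁻ x, ‖f (x - t) - f x‖ₑ ^ p.toReal),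
            lintegral_bumpMeasure]
          refine lintegral_mono fun t => ?_
          by_cases ht : ‖t‖ < b.rOut
          · refine mul_le_mul_right ?_ _
            have := h t ht
            rwa [eLpNorm_eq_lintegral_rpow_enorm_toReal hp0 hp, one_div,
              ENNReal.rpow_inv_le_iff hpt0] at this
          · have : b.normed volume t = 0 := by
              rw [← Function.notMem_support, b.support_normed_eq]
              simpa using ht
            simp [this]
      _ = ε ^ p.toReal := by simp
  rw [one_div, ENNReal.rpow_inv_le_iff hpt0]
  exact hb

lemma mollify_contDiff {f : Plane → ℝ} (hf : LocallyIntegrable f) (b : ContDiffBump (0 : Plane)) :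
    ContDiff ℝ ((⊤ : ℕ∞) : WithTop ℕ∞) (mollify b f) := by
  rw [mollify_eq_convolution]
  exact b.hasCompactSupport_normed.contDiff_convolution_left _ b.contDiff_normed hf

lemma tsupport_mollify_subset {f : Plane → ℝ} (b : ContDiffBump (0 : Plane)) :
    tsupport (mollify b f) ⊆ Metric.cthickening b.rOut (tsupport f) := by
  refine closure_minimal ?_ Metric.isClosed_cthickening
  intro x hx
  rw [mollify_eq_convolution] at hx
  obtain ⟨t, ht, y, hy, rfl⟩ := support_convolution_subset _ hx
  rw [b.support_normed_eq] at ht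
  refine Metric.mem_cthickening_of_dist_le _ y _ _ (subset_tsupport _ hy) ?_
  simpa [dist_eq_norm] using (mem_ball_zero_iff.1 ht).le

/-- Mollification commutes with the weak gradient. -/
lemma HasWeakGradient.gradient_mollify {w : Plane → ℝ} {h : Plane → Plane}
    (hw : HasWeakGradient w h) (b : ContDiffBump (0 : Plane)) :
    gradient (mollify b w) = mollify b h := by
  ext x i
  set K := b.normed (volume : Measure Plane) with hK
  have hKc : ContDiff ℝ ((⊤ : ℕ∞) : WithTop ℕ∞) K := b.contDiff_normed
  have hK1 : ContDiff ℝ 1 K := hKc.of_le (by exact_mod_cast le_top)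
  set e : Plane := EuclideanSpace.single i 1 with he
  have h1 : fderiv ℝ (mollify b w) x e = ∫ t, fderiv ℝ K t e * w (x - t) := by
    rw [mollify_eq_convolution, (b.hasCompactSupport_normed.hasFDerivAt_convolution_left _
      hK1 hw.1 x).fderiv, convolution_def]
    have hint : Integrable fun t => (ContinuousLinearMap.precompL Plane
        (ContinuousLinearMap.lsmul ℝ ℝ : ℝ →L[ℝ] ℝ →L[ℝ] ℝ)) (fderiv ℝ K t) (w (x - t)) :=
      HasCompactSupport.convolutionExists_left _
        (b.hasCompactSupport_normed.fderiv ℝ) (hK1.continuous_fderiv one_ne_zero) hw.1 x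
    refine (ContinuousLinearMap.integral_apply hint e).trans
      (integral_congr_ae (ae_of_all _ fun t => ?_))
    simp only [ContinuousLinearMap.precompL_apply, ContinuousLinearMap.lsmul_apply, smul_eq_mul]
  have hφ : (fun y => K (x - y)) ∈ testFunctions :=
    ⟨hKc.comp (contDiff_const.sub contDiff_id),
      b.hasCompactSupport_normed.comp_homeomorph (Homeomorph.subLeft x)⟩
  have h2 := hw.3 _ hφ i
  have h3 : ∀ y, fderiv ℝ (fun y => K (x - y)) y e = - fderiv ℝ K (x - y) e := fun y => by
    have h0 : HasFDerivAt (fun y => K (x - y)) _ y :=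
      ((hK1.differentiable one_ne_zero (x - y)).hasFDerivAt).comp y
        ((hasFDerivAt_id y).const_sub x)
    rw [h0.fderiv]
    simp
  simp only [← he, h3, mul_neg, integral_neg, neg_inj] at h2
  have h4 : mollify b h x i = ∫ t, K t * h (x - t) i := by
    have := (EuclideanSpace.proj (𝕜 := ℝ) i).integral_comp_comm
      (integrable_normed_smul_comp_sub hw.2 b x)
    simpa [mollify] using this.symm
  rw [gradient_apply_coord, ← he, h1, h4]
  rw [← integral_sub_left_eq_self (fun t => fderiv ℝ K t e * w (x - t)) volume x,
    ← integral_sub_left_eq_self (fun t => K t * h (x - t) i) volume x]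
  simp only [sub_sub_cancel]
  simpa [mul_comm] using h2

/-- A compactly supported function of `W^{1,p}` is approximated by test functions supported near
its support. -/
lemma HasWeakGradient.exists_testFunction_approx {p : ℝ≥0∞} (hp1 : 1 ≤ p) (hp : p ≠ ∞)
    {w : Plane → ℝ} {h : Plane → Plane} (hw : HasWeakGradient w h) (hwp : MemLp w p)
    (hhp : MemLp h p) (hc : HasCompactSupport w) {ε : ℝ≥0∞} (hε : 0 < ε) {δ : ℝ} (hδ : 0 < δ) :
    ∃ φ ∈ testFunctions, tsupport φ ⊆ Metric.cthickening δ (tsupport w) ∧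
      eLpNorm (fun x => φ x - w x) p ≤ ε ∧ eLpNorm (fun x => gradient φ x - h x) p ≤ ε := by
  obtain ⟨δ₁, hδ₁, h₁⟩ := exists_eLpNorm_translate_sub_le hp1 hp hwp hε
  obtain ⟨δ₂, hδ₂, h₂⟩ := exists_eLpNorm_translate_sub_le hp1 hp hhp hε
  have hd : 0 < min δ (min δ₁ δ₂) := lt_min hδ (lt_min hδ₁ hδ₂)
  let b : ContDiffBump (0 : Plane) := ⟨min δ (min δ₁ δ₂) / 2, min δ (min δ₁ δ₂), by positivity,
    by linarith⟩
  have hb : b.rOut = min δ (min δ₁ δ₂) := rfl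
  refine ⟨mollify b w, ⟨mollify_contDiff hw.1 b, ?_⟩, ?_, ?_, ?_⟩
  · exact HasCompactSupport.of_support_subset_isCompact
      (hc.isCompact.cthickening (r := b.rOut))
      ((subset_tsupport _).trans (tsupport_mollify_subset b))
  · exact (tsupport_mollify_subset b).trans (Metric.cthickening_mono (min_le_left _ _) _)
  · exact eLpNorm_mollify_sub_le hp1 hp hwp b fun t ht => h₁ t
      (ht.trans_le ((min_le_right _ _).trans (min_le_left _ _)))
  · rw [hw.gradient_mollify b]
    exact eLpNorm_mollify_sub_le hp1 hp hhp b fun t ht => h₂ t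
      (ht.trans_le ((min_le_right _ _).trans (min_le_right _ _)))

end WeightedPlane

/-! ### Dominated smooth approximation and the chain rule -/

namespace WeightedPlane

lemma _root_.MeasureTheory.LocallyIntegrable.lintegral_enorm_ball_lt_top {E : Type*}
    [NormedAddCommGroup E] {f : Plane → E} (hf : LocallyIntegrable f) (R : ℝ) :
    ∫⁻ x in Metric.ball 0 R, ‖f x‖ₑ < ∞ :=
  ((hf.integrableOn_isCompact (isCompact_closedBall (0 : Plane) R)).mono_set
    Metric.ball_subset_closedBall).2

lemma locallyIntegrable_toReal_of_lintegral_ball {S : Plane → ℝ≥0∞} (hS : Measurable S)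
    (h : ∀ R : ℕ, ∫⁻ x in Metric.ball 0 (R : ℝ), S x < ∞) :
    LocallyIntegrable fun x => (S x).toReal := fun x => by
  obtain ⟨R, hR⟩ := exists_nat_gt ‖x‖
  exact ⟨Metric.ball 0 R, Metric.isOpen_ball.mem_nhds (by simpa using hR),
    integrable_toReal_of_lintegral_ne_top hS.aemeasurable (h R).ne⟩

lemma ae_lt_top_of_lintegral_ball {S : Plane → ℝ≥0∞} (hS : Measurable S)
    (h : ∀ R : ℕ, ∫⁻ x in Metric.ball 0 (R : ℝ), S x < ∞) : ∀ᵐ x, S x < ∞ := by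
  have key : ∀ R : ℕ, ∀ᵐ x, x ∈ Metric.ball (0 : Plane) (R : ℝ) → S x < ∞ := fun R => by
    rw [← ae_restrict_iff' Metric.isOpen_ball.measurableSet]
    exact ae_lt_top hS (h R).ne
  filter_upwards [ae_all_iff.2 key] with x hx
  obtain ⟨R, hR⟩ := exists_nat_gt ‖x‖
  exact hx R (by simpa using hR)

/-- A function of `W^{1,1}_loc` is approximated, together with its gradient, by test functions,
almost everywhere and with errors below a fixed locally integrable function `S`. As a consequence
the approximation also holds in `L¹` on almost every ray and on almost every circle. -/
lemma HasWeakGradient.exists_dominated_approx {u : Plane → ℝ} {g : Plane → Plane}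
    (hu : HasWeakGradient u g) (mu : Measurable u) (mg : Measurable g) :
    ∃ (φ : ℕ → Plane → ℝ) (S : Plane → ℝ≥0∞), (∀ n, φ n ∈ testFunctions) ∧ Measurable S ∧
      (∀ R : ℕ, ∫⁻ x in Metric.ball 0 (R : ℝ), S x < ∞) ∧
      (∀ n x, ‖φ n x - u x‖ₑ + ‖gradient (φ n) x - g x‖ₑ ≤ S x) ∧
      ∀ x, S x < ∞ →
        Tendsto (fun n => ‖φ n x - u x‖ₑ + ‖gradient (φ n) x - g x‖ₑ) atTop (𝓝 0) := by
  -- cut `u` off at radius about `n` and mollify at a scale with `L¹` error `2⁻ⁿ`; the errors are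
  -- then summable, and their sum is the required dominating function
  have step : ∀ n : ℕ, ∃ φ ∈ testFunctions, ∫⁻ x in Metric.ball 0 (n : ℝ),
      (‖φ x - u x‖ₑ + ‖gradient φ x - g x‖ₑ) ≤ 2⁻¹ ^ n := by
    intro n
    let η : ContDiffBump (0 : Plane) := ⟨n + 1, n + 2, by positivity, by linarith⟩
    have hη : ContDiff ℝ ((⊤ : ℕ∞) : WithTop ℕ∞) η := η.contDiff
    have hη1 : ContDiff ℝ 1 (η : Plane → ℝ) := η.contDiff
    have hw := hu.mul_left hη
    have hc : HasCompactSupport fun x => η x * u x := η.hasCompactSupport.mul_right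
    have hsupp : ∀ x, x ∉ Metric.closedBall (0 : Plane) (n + 2) →
        η x • g x + u x • gradient η x = 0 := fun x hx => by
      have hx' : x ∉ tsupport η := by rw [η.tsupport_eq]; exact hx
      rw [gradient_eq_zero_of_notMem_tsupport hx', image_eq_zero_of_notMem_tsupport hx']
      simp
    have hwi : MemLp (fun x => η x * u x) 1 := by
      rw [memLp_one_iff_integrable]
      exact (integrableOn_iff_integrable_of_support_subset (subset_tsupport _)).1
        (hw.1.integrableOn_isCompact hc.isCompact)
    have hgi : MemLp (fun x => η x • g x + u x • gradient η x) 1 := by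
      rw [memLp_one_iff_integrable]
      refine (integrableOn_iff_integrable_of_support_subset
        (Function.support_subset_iff'.2 hsupp)).1
        (hw.2.integrableOn_isCompact (isCompact_closedBall _ _))
    obtain ⟨φ, hφ, -, h1, h2⟩ := hw.exists_testFunction_approx le_rfl (by simp) hwi hgi hc
      (ε := 2⁻¹ ^ n / 2) (ENNReal.div_pos (pow_ne_zero _ (by simp)) (by simp)) one_pos
    refine ⟨φ, hφ, ?_⟩
    rw [eLpNorm_one_eq_lintegral_enorm] at h1 h2
    have hball : ∀ x ∈ Metric.ball (0 : Plane) (n : ℝ), η x = 1 ∧ gradient η x = 0 := by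
      intro x hx
      have hx' : x ∈ Metric.ball (0 : Plane) η.rIn :=
        Metric.ball_subset_ball (by simp [η]) hx
      have he : (η : Plane → ℝ) =ᶠ[𝓝 x] fun _ => (1 : ℝ) := η.eventuallyEq_one_of_mem_ball hx'
      refine ⟨he.eq_of_nhds, ?_⟩
      rw [gradient, he.fderiv_eq]
      simp
    have hm : Measurable fun x => ‖φ x - u x‖ₑ := (hφ.1.continuous.measurable.sub mu).enorm
    rw [lintegral_add_left hm]
    calc _ ≤ (∫⁻ x, ‖φ x - η x * u x‖ₑ) +
          ∫⁻ x, ‖gradient φ x - (η x • g x + u x • gradient η x)‖ₑ := by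
          refine add_le_add ?_ ?_
          · refine le_trans (le_of_eq (setLIntegral_congr_fun Metric.isOpen_ball.measurableSet
              fun x hx => ?_)) (setLIntegral_le_lintegral (Metric.ball 0 (n : ℝ)) _)
            simp only [(hball x hx).1, one_mul]
          · refine le_trans (le_of_eq (setLIntegral_congr_fun Metric.isOpen_ball.measurableSet
              fun x hx => ?_)) (setLIntegral_le_lintegral (Metric.ball 0 (n : ℝ)) _)
            simp only [(hball x hx).1, (hball x hx).2, one_smul, smul_zero, add_zero]
      _ ≤ 2⁻¹ ^ n / 2 + 2⁻¹ ^ n / 2 := add_le_add h1 h2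
      _ = 2⁻¹ ^ n := ENNReal.add_halves _
  choose φ hφ hφn using step
  set F : ℕ → Plane → ℝ≥0∞ := fun n x => ‖φ n x - u x‖ₑ + ‖gradient (φ n) x - g x‖ₑ with hF
  have hFm : ∀ n, Measurable (F n) := fun n =>
    ((hφ n).1.continuous.measurable.sub mu).enorm.add
      ((continuous_gradient (testFunctions.contDiff_one (hφ n))).measurable.sub mg).enorm
  refine ⟨φ, fun x => ∑' n, F n x, hφ, Measurable.tsum hFm, fun R => ?_,
    fun n x => ENNReal.le_tsum n, fun x hx => ENNReal.tendsto_atTop_zero_of_tsum_ne_top hx.ne⟩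
  rw [lintegral_tsum fun n => (hFm n).aemeasurable]
  have hfin : ∀ n, ∫⁻ x in Metric.ball 0 (R : ℝ), F n x < ∞ := fun n => by
    have h1 := (hφ n).1.continuous.locallyIntegrable (μ := (volume : Measure Plane))
    have h2 := (continuous_gradient (testFunctions.contDiff_one (hφ n))).locallyIntegrable
      (μ := (volume : Measure Plane))
    simp only [hF]
    have hm : Measurable fun x => ‖φ n x - u x‖ₑ :=
      ((hφ n).1.continuous.measurable.sub mu).enorm
    rw [lintegral_add_left hm]
    exact ENNReal.add_lt_top.2 ⟨(h1.sub hu.1).lintegral_enorm_ball_lt_top R,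
      (h2.sub hu.2).lintegral_enorm_ball_lt_top R⟩
  have hle : ∀ n, ∫⁻ x in Metric.ball 0 (R : ℝ), F n x ≤
      (if n ∈ Finset.range R then ∫⁻ x in Metric.ball 0 (R : ℝ), F n x else 0) + 2⁻¹ ^ n := by
    intro n
    split_ifs with h
    · exact le_self_add
    · rw [zero_add]
      refine (lintegral_mono_set (Metric.ball_subset_ball ?_)).trans (hφn n)
      exact_mod_cast not_lt.1 (by simpa using h)
  refine (ENNReal.tsum_le_tsum hle).trans_lt ?_
  rw [ENNReal.tsum_add]
  refine ENNReal.add_lt_top.2 ⟨?_, ?_⟩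
  · rw [tsum_eq_sum (s := Finset.range R) fun n hn => if_neg hn]
    refine ENNReal.sum_lt_top.2 fun n hn => ?_
    rw [if_pos hn]
    exact hfin n
  · rw [ENNReal.tsum_geometric]
    simp

lemma HasWeakGradient.tendsto_of_dominated {φ : ℕ → Plane → ℝ} {u : Plane → ℝ}
    {g : Plane → Plane} {x : Plane}
    (h : Tendsto (fun n => ‖φ n x - u x‖ₑ + ‖gradient (φ n) x - g x‖ₑ) atTop (𝓝 0)) :
    Tendsto (fun n => φ n x) atTop (𝓝 (u x)) ∧
      Tendsto (fun n => gradient (φ n) x) atTop (𝓝 (g x)) := by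
  constructor
  · rw [tendsto_iff_edist_tendsto_0]
    refine tendsto_of_tendsto_of_tendsto_of_le_of_le tendsto_const_nhds h
      (fun _ => zero_le) fun n => ?_
    simp only [edist_eq_enorm_sub]
    exact le_self_add
  · rw [tendsto_iff_edist_tendsto_0]
    refine tendsto_of_tendsto_of_tendsto_of_le_of_le tendsto_const_nhds h
      (fun _ => zero_le) fun n => ?_
    simp only [edist_eq_enorm_sub]
    exact le_add_self

lemma gradient_comp_left {T : ℝ → ℝ} (hT : ContDiff ℝ 1 T) {φ : Plane → ℝ} {x : Plane}
    (hφ : DifferentiableAt ℝ φ x) :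
    gradient (fun y => T (φ y)) x = deriv T (φ x) • gradient φ x := by
  have h := ((hT.differentiable one_ne_zero (φ x)).hasDerivAt).comp_hasFDerivAt x hφ.hasFDerivAt
  have h' : fderiv ℝ (fun y => T (φ y)) x = deriv T (φ x) • fderiv ℝ φ x := h.fderiv
  rw [gradient, h', gradient, map_smulₛₗ]
  simp

/-- Chain rule for the composition with a bounded `C¹` function with bounded derivative. -/
lemma HasWeakGradient.comp_left {T : ℝ → ℝ} (hT : ContDiff ℝ 1 T) {C C' : ℝ}
    (hC : ∀ t, |T t| ≤ C) (hC' : ∀ t, |deriv T t| ≤ C') {u : Plane → ℝ} {g : Plane → Plane}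
    (hu : HasWeakGradient u g) (mu : Measurable u) (mg : Measurable g) :
    HasWeakGradient (fun x => T (u x)) (fun x => deriv T (u x) • g x) := by
  have hTc := hT.continuous
  have hT'c : Continuous (deriv T) := hT.continuous_deriv le_rfl
  have hC0 : 0 ≤ C' := (abs_nonneg _).trans (hC' 0)
  obtain ⟨φ, S, hφ, hS, hSi, hle, hlim⟩ := hu.exists_dominated_approx mu mg
  refine ⟨?_, ?_, fun ψ hψ i => ?_⟩
  · refine (locallyIntegrable_const C).mono (hTc.measurable.comp mu).aestronglyMeasurable ?_
    exact ae_of_all _ fun x => by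
      simpa using (hC (u x)).trans (le_abs_self C)
  · refine (hu.2.smul C').mono ((hT'c.measurable.comp mu).smul mg).aestronglyMeasurable ?_
    refine ae_of_all _ fun x => ?_
    simp only [Pi.smul_apply, norm_smul, Real.norm_eq_abs]
    exact mul_le_mul_of_nonneg_right ((hC' _).trans (le_abs_self _)) (norm_nonneg _)
  · have hae := ae_lt_top_of_lintegral_ball hS hSi
    set e : Plane := EuclideanSpace.single i 1 with he
    have hn : ∀ n, ∫ x, T (φ n x) * fderiv ℝ ψ x e =
        - ∫ x, (deriv T (φ n x) • gradient (φ n) x) i * ψ x := fun n => by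
      have h1 := testFunctions.contDiff_one (hφ n)
      have h2 := (of_contDiff (hT.comp h1)).3 ψ hψ i
      have h3 : gradient (T ∘ φ n) = fun x => deriv T (φ n x) • gradient (φ n) x := by
        ext1 x
        exact gradient_comp_left hT (h1.differentiable one_ne_zero x)
      rw [h3] at h2
      exact h2
    have c1 := testFunctions.continuous_fderiv_apply hψ e
    have c2 := testFunctions.hasCompactSupport_fderiv_apply hψ e
    have l1 : Tendsto (fun n => ∫ x, T (φ n x) * fderiv ℝ ψ x e) atTop
        (𝓝 (∫ x, T (u x) * fderiv ℝ ψ x e)) := by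
      refine tendsto_integral_of_dominated_convergence (fun x => C * |fderiv ℝ ψ x e|)
        (fun n => ((hTc.comp (hφ n).1.continuous).mul c1).aestronglyMeasurable)
        (((c1.integrable_of_hasCompactSupport c2).abs).const_mul C) (fun n => ?_) ?_
      · refine ae_of_all _ fun x => ?_
        rw [norm_mul, Real.norm_eq_abs, Real.norm_eq_abs]
        gcongr
        exact hC _
      · filter_upwards [hae] with x hx
        exact ((hTc.tendsto _).comp (tendsto_of_dominated (hlim x hx)).1).mul_const _
    have l2 : Tendsto (fun n => ∫ x, (deriv T (φ n x) • gradient (φ n) x) i * ψ x) atTop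
        (𝓝 (∫ x, (deriv T (u x) • g x) i * ψ x)) := by
      have hSl := locallyIntegrable_toReal_of_lintegral_ball hS hSi
      have hgl : LocallyIntegrable fun x => ‖g x‖ := fun x => (hu.2 x).norm
      refine tendsto_integral_of_dominated_convergence
        (fun x => C' * ((‖g x‖ + (S x).toReal) * |ψ x|)) (fun n => ?_)
        (((hgl.add hSl).integrable_mul_of_hasCompactSupport hψ.1.continuous.abs
          (hψ.2.comp_left abs_zero)).const_mul C') (fun n => ?_) ?_
      · have c3 : Continuous fun x => (deriv T (φ n x) • gradient (φ n) x) i :=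
          (EuclideanSpace.proj (𝕜 := ℝ) i).continuous.comp
            ((hT'c.comp (hφ n).1.continuous).smul
              (continuous_gradient (testFunctions.contDiff_one (hφ n))))
        exact (c3.mul hψ.1.continuous).aestronglyMeasurable
      · filter_upwards [hae] with x hx
        rw [norm_mul, PiLp.smul_apply, norm_smul, Real.norm_eq_abs, Real.norm_eq_abs (ψ x),
          mul_assoc]
        gcongr
        · exact hC' _
        · refine (PiLp.norm_apply_le _ i).trans ?_
          have h1 : ‖gradient (φ n) x - g x‖ ≤ (S x).toReal := by
            rw [← toReal_enorm]
            exact ENNReal.toReal_mono hx.ne (le_add_self.trans (hle n x))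
          calc ‖gradient (φ n) x‖ = ‖g x + (gradient (φ n) x - g x)‖ := by congr 1; abel
            _ ≤ ‖g x‖ + (S x).toReal := (norm_add_le _ _).trans (by gcongr)
      · filter_upwards [hae] with x hx
        obtain ⟨t1, t2⟩ := tendsto_of_dominated (hlim x hx)
        have := ((hT'c.tendsto _).comp t1).smul t2
        exact (((EuclideanSpace.proj (𝕜 := ℝ) i).continuous.tendsto _).comp this).mul_const _
    have l3 := l2.neg
    simp only [← hn] at l3
    exact tendsto_nhds_unique l1 l3

end WeightedPlane

/-! ### Radially absolutely continuous versions -/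

namespace WeightedPlane

/-- Along almost every ray from the origin, `v` is the integral of the radial component of `g`. -/
def HasRadialDerivative (v : Plane → ℝ) (g : Plane → Plane) : Prop :=
  ∀ᵐ θ : ℝ, ∀ r₁ r₂ : ℝ, 0 < r₁ → r₁ ≤ r₂ →
    IntervalIntegrable (fun r => inner ℝ (g (polarPoint r θ)) (polarPoint 1 θ)) volume r₁ r₂ ∧
      v (polarPoint r₂ θ) - v (polarPoint r₁ θ) =
        ∫ r in r₁..r₂, inner ℝ (g (polarPoint r θ)) (polarPoint 1 θ)

/-- On almost every circle, the oscillation of `v` over the quarter with angles in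
`(α, α + π / 2)` is at most the integral of `‖g‖` over that quarter. -/
def HasQuarterOscillationBound (v : Plane → ℝ) (g : Plane → Plane) (α : ℝ) : Prop :=
  ∀ᵐ r ∂(volume.restrict (Ioi (0 : ℝ))), ∀ᵐ θ ∂arc, ∀ᵐ θ' ∂arc,
    ‖v (polarPoint r (θ + α)) - v (polarPoint r (θ' + α))‖ₑ ≤
      ENNReal.ofReal r * ∫⁻ s, ‖g (polarPoint r (s + α))‖ₑ ∂arc

lemma norm_polarPoint_one (θ : ℝ) : ‖polarPoint 1 θ‖ = 1 := by simp [norm_polarPoint]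

lemma hasDerivAt_polarPoint_left (r θ : ℝ) :
    HasDerivAt (fun r => polarPoint r θ) (polarPoint 1 θ) r := by
  have h : (fun r => polarPoint r θ) = fun r => r • polarPoint 1 θ := by
    ext1 r; exact polarPoint_eq_smul r θ
  rw [h]
  simpa using (hasDerivAt_id r).smul_const (polarPoint 1 θ)

lemma hasDerivAt_polarPoint_right (r θ : ℝ) :
    HasDerivAt (fun θ => polarPoint r θ) (r • polarPoint 1 (θ + Real.pi / 2)) θ := by
  have h : HasDerivAt (fun θ => ![r * Real.cos θ, r * Real.sin θ])
      ![r * -Real.sin θ, r * Real.cos θ] θ := by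
    rw [hasDerivAt_pi]
    intro i
    fin_cases i
    · exact (Real.hasDerivAt_cos θ).const_mul r
    · exact (Real.hasDerivAt_sin θ).const_mul r
  have h2 := (PiLp.hasFDerivAt_toLp (𝕜 := ℝ) 2 ![r * Real.cos θ,
    r * Real.sin θ]).comp_hasDerivAt θ h
  have h3 : r • polarPoint 1 (θ + Real.pi / 2) =
      WithLp.toLp 2 ![r * -Real.sin θ, r * Real.cos θ] := by
    ext i
    fin_cases i <;> simp [Real.cos_add_pi_div_two, Real.sin_add_pi_div_two]
  rw [h3]
  exact h2

lemma continuous_polarPoint_left (θ : ℝ) : Continuous fun r => polarPoint r θ :=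
  continuous_polarPoint.comp (continuous_id.prodMk continuous_const)

lemma continuous_polarPoint_right (r : ℝ) : Continuous fun θ => polarPoint r θ :=
  continuous_polarPoint.comp (continuous_const.prodMk continuous_id)

lemma sub_eq_integral_radial {φ : Plane → ℝ} (hφ : ContDiff ℝ 1 φ) (θ r₁ r₂ : ℝ) :
    φ (polarPoint r₂ θ) - φ (polarPoint r₁ θ) =
      ∫ r in r₁..r₂, inner ℝ (gradient φ (polarPoint r θ)) (polarPoint 1 θ) := by
  symm
  refine intervalIntegral.integral_eq_sub_of_hasDerivAt
    (f := fun r => φ (polarPoint r θ)) (fun r _ => ?_) ?_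
  · rw [inner_gradient]
    exact (hφ.differentiable one_ne_zero _).hasFDerivAt.comp_hasDerivAt r
      (hasDerivAt_polarPoint_left r θ)
  · exact (((continuous_gradient hφ).comp (continuous_polarPoint_left θ)).inner
      continuous_const).intervalIntegrable _ _

lemma sub_eq_integral_angular {φ : Plane → ℝ} (hφ : ContDiff ℝ 1 φ) (r θ₁ θ₂ : ℝ) :
    φ (polarPoint r θ₂) - φ (polarPoint r θ₁) =
      ∫ θ in θ₁..θ₂, inner ℝ (gradient φ (polarPoint r θ))
        (r • polarPoint 1 (θ + Real.pi / 2)) := by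
  symm
  refine intervalIntegral.integral_eq_sub_of_hasDerivAt
    (f := fun θ => φ (polarPoint r θ)) (fun θ _ => ?_) ?_
  · rw [inner_gradient]
    exact (hφ.differentiable one_ne_zero _).hasFDerivAt.comp_hasDerivAt θ
      (hasDerivAt_polarPoint_right r θ)
  · have h1 : Continuous fun θ => r • polarPoint 1 (θ + Real.pi / 2) :=
      ((continuous_polarPoint_right 1).comp (continuous_add_const _)).const_smul r
    exact (((continuous_gradient hφ).comp
      (continuous_polarPoint_right r)).inner h1).intervalIntegrable _ _

lemma hasRadialDerivative_of_contDiff {φ : Plane → ℝ} (hφ : ContDiff ℝ 1 φ) :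
    HasRadialDerivative φ (gradient φ) :=
  ae_of_all _ fun θ r₁ r₂ _ _ => ⟨(((continuous_gradient hφ).comp
    (continuous_polarPoint_left θ)).inner continuous_const).intervalIntegrable _ _,
    sub_eq_integral_radial hφ θ r₁ r₂⟩

lemma HasRadialDerivative.sub {v w : Plane → ℝ} {g h : Plane → Plane}
    (hv : HasRadialDerivative v g) (hw : HasRadialDerivative w h) :
    HasRadialDerivative (v - w) (g - h) := by
  filter_upwards [hv, hw] with θ h1 h2 r₁ r₂ h0 h12
  obtain ⟨i1, e1⟩ := h1 r₁ r₂ h0 h12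
  obtain ⟨i2, e2⟩ := h2 r₁ r₂ h0 h12
  simp only [Pi.sub_apply, inner_sub_left]
  refine ⟨i1.sub i2, ?_⟩
  rw [intervalIntegral.integral_sub i1 i2, ← e1, ← e2]
  ring

/-- The oscillation bound for continuously differentiable functions. -/
lemma enorm_sub_le_quarter {φ : Plane → ℝ} (hφ : ContDiff ℝ 1 φ) {r : ℝ} (hr : 0 < r) (α : ℝ)
    {θ θ' : ℝ} (hθ : θ ∈ Ioo 0 (Real.pi / 2)) (hθ' : θ' ∈ Ioo 0 (Real.pi / 2)) :
    ‖φ (polarPoint r (θ + α)) - φ (polarPoint r (θ' + α))‖ₑ ≤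
      ENNReal.ofReal r * ∫⁻ s, ‖gradient φ (polarPoint r (s + α))‖ₑ ∂arc := by
  rw [sub_eq_integral_angular hφ r (θ' + α) (θ + α),
    ← intervalIntegral.integral_comp_add_right]
  have hm : Measurable fun s => ‖gradient φ (polarPoint r (s + α))‖ₑ :=
    ((continuous_gradient hφ).comp ((continuous_polarPoint_right r).comp
      (continuous_id.add continuous_const))).measurable.enorm
  rw [← lintegral_const_mul _ hm, intervalIntegral.intervalIntegral_eq_integral_uIoc]
  have h1 : ∀ (c : ℝ) (y : ℝ), c = 1 ∨ c = -1 → ‖c • y‖ₑ = ‖y‖ₑ := by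
    rintro c y (rfl | rfl) <;> simp
  rw [h1 _ _ (by split_ifs <;> simp)]
  refine (enorm_integral_le_lintegral_enorm _).trans ?_
  refine le_trans (lintegral_mono_set ?_) (lintegral_mono fun s => ?_)
  · intro s hs
    exact ⟨(lt_min hθ'.1 hθ.1).trans hs.1, hs.2.trans_lt (max_lt hθ'.2 hθ.2)⟩
  · rw [← ofReal_norm, ← ofReal_norm, ← ENNReal.ofReal_mul hr.le]
    refine ENNReal.ofReal_le_ofReal ((norm_inner_le_norm _ _).trans (le_of_eq ?_))
    rw [norm_smul, norm_polarPoint_one, Real.norm_of_nonneg hr.le, mul_one, mul_comm]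

/-- A function of `W^{1,1}_loc` has a version that is absolutely continuous along rays, and whose
oscillation on quarter circles is controlled by the weak gradient. It is the pointwise limit of a
dominated smooth approximation. -/
lemma HasWeakGradient.exists_radial_version {u : Plane → ℝ} {g : Plane → Plane}
    (hu : HasWeakGradient u g) (mg : Measurable g) :
    ∃ v : Plane → ℝ, Measurable v ∧ v =ᵐ[volume] u ∧ HasRadialDerivative v g ∧
      ∀ α, HasQuarterOscillationBound v g α := by
  obtain ⟨u', mu', huu'⟩ : ∃ u', Measurable u' ∧ u =ᵐ[volume] u' :=
    ⟨_, hu.1.aestronglyMeasurable.stronglyMeasurable_mk.measurable,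
      hu.1.aestronglyMeasurable.ae_eq_mk⟩
  obtain ⟨φ, S, hφ, hS, hSi, hle, hlim⟩ :=
    (hu.congr_fun_ae huu').exists_dominated_approx mu' mg
  have hS0 := ae_lt_top_of_lintegral_ball hS hSi
  have hφ1 : ∀ n, ContDiff ℝ 1 (φ n) := fun n => testFunctions.contDiff_one (hφ n)
  have hgi : ∀ R : ℕ, ∫⁻ x in Metric.ball 0 (R : ℝ), ‖g x‖ₑ < ∞ := fun R =>
    hu.2.lintegral_enorm_ball_lt_top R
  have hv : ∀ x c, Tendsto (fun n => φ n x) atTop (𝓝 c) →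
      limsup (fun n => φ n x) atTop = c := fun x c h => h.limsup_eq
  -- the upper limit is measurable in `x`, and equals the limit wherever the latter exists
  refine ⟨fun x => limsup (fun n => φ n x) atTop,
    Measurable.limsup fun n => (hφ n).1.continuous.measurable, ?_, ?_, fun α => ?_⟩
  · filter_upwards [hS0, huu'] with x hx hx'
    rw [hx']
    exact hv x _ (tendsto_of_dominated (hlim x hx)).1
  · filter_upwards [ae_ray_of_ae hS0, ae_ray_lintegral_lt_top hS hSi,
      ae_ray_lintegral_lt_top mg.enorm hgi] with θ h1 h2 h3
    have hii : ∀ r₁ r₂ : ℝ, 0 < r₁ → r₁ ≤ r₂ → IntervalIntegrable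
        (fun r => inner ℝ (g (polarPoint r θ)) (polarPoint 1 θ)) volume r₁ r₂ ∧
        Tendsto (fun n => φ n (polarPoint r₂ θ) - φ n (polarPoint r₁ θ)) atTop
          (𝓝 (∫ r in r₁..r₂, inner ℝ (g (polarPoint r θ)) (polarPoint 1 θ))) := by
      intro r₁ r₂ h0 h12
      have mgr := measurable_comp_polarPoint_left mg θ
      have mSr := measurable_comp_polarPoint_left hS θ
      have hg1 : IntegrableOn (fun r => ‖g (polarPoint r θ)‖) (Ioc r₁ r₂) := by
        refine ⟨mgr.norm.aestronglyMeasurable, ?_⟩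
        simp only [hasFiniteIntegral_iff_enorm, enorm_norm]
        exact (lintegral_mono_set Ioc_subset_Icc_self).trans_lt (h3 r₁ r₂ h0)
      have hS1 : IntegrableOn (fun r => (S (polarPoint r θ)).toReal) (Ioc r₁ r₂) :=
        integrable_toReal_of_lintegral_ne_top mSr.aemeasurable
          ((lintegral_mono_set Ioc_subset_Icc_self).trans_lt (h2 r₁ r₂ h0)).ne
      have hfin : ∀ᵐ r ∂(volume.restrict (Ioc r₁ r₂)), S (polarPoint r θ) < ∞ :=
        ae_mono (Measure.restrict_mono (fun r hr => h0.trans hr.1) le_rfl) h1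
      have hin : ∀ y : Plane, ‖inner ℝ y (polarPoint 1 θ)‖ ≤ ‖y‖ := fun y => by
        simpa [norm_polarPoint_one] using norm_inner_le_norm (𝕜 := ℝ) y (polarPoint 1 θ)
      have hmi : Measurable fun r => inner ℝ (g (polarPoint r θ)) (polarPoint 1 θ) :=
        mgr.inner measurable_const
      constructor
      · rw [intervalIntegrable_iff_integrableOn_Ioc_of_le h12]
        exact hg1.mono' hmi.aestronglyMeasurable (ae_of_all _ fun r => hin _)
      · simp only [sub_eq_integral_radial (hφ1 _), intervalIntegral.integral_of_le h12]
        refine tendsto_integral_of_dominated_convergence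
          (fun r => ‖g (polarPoint r θ)‖ + (S (polarPoint r θ)).toReal) (fun n => ?_)
          (hg1.add hS1) (fun n => ?_) ?_
        · exact (((continuous_gradient (hφ1 n)).comp (continuous_polarPoint_left θ)).inner
            continuous_const).aestronglyMeasurable
        · filter_upwards [hfin] with r hr
          refine (hin _).trans ?_
          have h4 : ‖gradient (φ n) (polarPoint r θ) - g (polarPoint r θ)‖ ≤
              (S (polarPoint r θ)).toReal := by
            rw [← toReal_enorm]
            exact ENNReal.toReal_mono hr.ne (le_add_self.trans (hle n _))
          calc ‖gradient (φ n) (polarPoint r θ)‖ = ‖g (polarPoint r θ) +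
                (gradient (φ n) (polarPoint r θ) - g (polarPoint r θ))‖ := by congr 1; abel
            _ ≤ _ := (norm_add_le _ _).trans (by gcongr)
        · filter_upwards [hfin] with r hr
          exact (tendsto_of_dominated (hlim _ hr)).2.inner tendsto_const_nhds
    obtain ⟨r₀, hr₀, hr₀pos⟩ : ∃ r, S (polarPoint r θ) < ∞ ∧ 0 < r := by
      have : NeBot (ae (volume.restrict (Ioi (0 : ℝ)))) := by
        rw [ae_neBot, Ne, Measure.restrict_eq_zero]
        simp
      exact (h1.and (ae_restrict_mem measurableSet_Ioi)).exists
    have t0 := (tendsto_of_dominated (hlim _ hr₀)).1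
    -- convergence at one radius and of the radial derivatives gives convergence at every radius
    have hconv : ∀ r, 0 < r → ∃ c, Tendsto (fun n => φ n (polarPoint r θ)) atTop (𝓝 c) := by
      intro r hr
      rcases le_total r₀ r with h | h
      · exact ⟨_, (((hii r₀ r hr₀pos h).2).add t0).congr fun n => by ring⟩
      · exact ⟨_, (t0.sub ((hii r r₀ hr h).2)).congr fun n => by ring⟩
    intro r₁ r₂ h0 h12
    refine ⟨(hii r₁ r₂ h0 h12).1, ?_⟩
    obtain ⟨c₁, hc₁⟩ := hconv r₁ h0
    obtain ⟨c₂, hc₂⟩ := hconv r₂ (h0.trans_le h12)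
    simp only [hv _ _ hc₁, hv _ _ hc₂]
    exact tendsto_nhds_unique (hc₂.sub hc₁) (hii r₁ r₂ h0 h12).2
  · filter_upwards [ae_circle_of_ae hS0, ae_circle_lintegral_lt_top hS hSi α,
      ae_restrict_mem measurableSet_Ioi] with r h1 h2 hr
    have hr' : 0 < r := hr
    have hfin : ∀ᵐ θ ∂arc, S (polarPoint r (θ + α)) < ∞ := ae_arc_add h1 α
    have hmem : ∀ᵐ θ ∂arc, θ ∈ Ioo 0 (Real.pi / 2) := ae_restrict_mem measurableSet_Ioo
    have mgr : Measurable fun s => g (polarPoint r (s + α)) :=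
      (measurable_comp_polarPoint_add mg α).comp (measurable_const.prodMk measurable_id)
    have mφ : ∀ n, Measurable fun s => gradient (φ n) (polarPoint r (s + α)) := fun n =>
      (measurable_comp_polarPoint_add (continuous_gradient (hφ1 n)).measurable α).comp
        (measurable_const.prodMk measurable_id)
    have hD : Tendsto (fun n => ∫⁻ s, ‖gradient (φ n) (polarPoint r (s + α)) -
        g (polarPoint r (s + α))‖ₑ ∂arc) atTop (𝓝 0) := by
      have : (0 : ℝ≥0∞) = ∫⁻ s, 0 ∂arc := by simp
      rw [this]
      refine tendsto_lintegral_of_dominated_convergence (fun s => S (polarPoint r (s + α)))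
        (fun n => ((mφ n).sub mgr).enorm)
        (fun n => ae_of_all _ fun s => le_add_self.trans (hle n _)) h2.ne ?_
      filter_upwards [hfin] with s hs
      exact tendsto_of_tendsto_of_tendsto_of_le_of_le tendsto_const_nhds (hlim _ hs)
        (fun _ => zero_le) fun n => le_add_self
    filter_upwards [hfin, hmem] with θ hθ hθm
    filter_upwards [hfin, hmem] with θ' hθ' hθm'
    have t1 := (tendsto_of_dominated (hlim _ hθ)).1
    have t2 := (tendsto_of_dominated (hlim _ hθ')).1
    simp only [hv _ _ t1, hv _ _ t2]
    have t3 := (continuous_enorm.tendsto _).comp (t1.sub t2)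
    have t4 : Tendsto (fun n => ENNReal.ofReal r * (∫⁻ s, ‖g (polarPoint r (s + α))‖ₑ ∂arc +
        ∫⁻ s, ‖gradient (φ n) (polarPoint r (s + α)) - g (polarPoint r (s + α))‖ₑ ∂arc)) atTop
        (𝓝 (ENNReal.ofReal r * (∫⁻ s, ‖g (polarPoint r (s + α))‖ₑ ∂arc + 0))) :=
      ENNReal.Tendsto.const_mul (hD.const_add _) (Or.inr ENNReal.ofReal_ne_top)
    rw [add_zero] at t4
    refine le_of_tendsto_of_tendsto' t3 t4 fun n => ?_
    refine (enorm_sub_le_quarter (hφ1 n) hr' α hθm hθm').trans (mul_le_mul_right ?_ _)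
    rw [← lintegral_add_left mgr.enorm]
    refine lintegral_mono fun s => ?_
    calc ‖gradient (φ n) (polarPoint r (s + α))‖ₑ = ‖g (polarPoint r (s + α)) +
          (gradient (φ n) (polarPoint r (s + α)) - g (polarPoint r (s + α)))‖ₑ := by
            congr 1; abel
      _ ≤ _ := enorm_add_le _ _

lemma HasRadialDerivative.isRadialVersion {u v : Plane → ℝ} {g : Plane → Plane}
    (h : HasRadialDerivative v g) (hvu : v =ᵐ[volume] u) : IsRadialVersion u v := by
  refine ⟨hvu, ?_⟩
  filter_upwards [h] with θ hθ r₁ r₂ h0 h12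
  have hac := (hθ r₁ r₂ h0 h12).1.absolutelyContinuousOnInterval_intervalIntegral
    (c := r₁) left_mem_uIcc
  refine Tendsto.congr' ?_ hac
  filter_upwards [mem_inf_of_right (mem_principal_self _)] with E hE
  refine Finset.sum_congr rfl fun i hi => ?_
  have key : ∀ r ∈ uIcc r₁ r₂, ∫ s in r₁..r, inner ℝ (g (polarPoint s θ)) (polarPoint 1 θ) =
      v (polarPoint r θ) - v (polarPoint r₁ θ) := fun r hr => by
    rw [uIcc_of_le h12] at hr
    exact ((hθ r₁ r h0 hr.1).2).symm
  rw [key _ (hE.1 i hi).1, key _ (hE.1 i hi).2, dist_sub_right]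

/-- Two radially absolutely continuous versions agree on almost every ray. -/
lemma IsRadialVersion.ae_eq_ray {u v v' : Plane → ℝ} (h : IsRadialVersion u v)
    (h' : IsRadialVersion u v') :
    ∀ᵐ θ : ℝ, ∀ r : ℝ, 0 < r → v (polarPoint r θ) = v' (polarPoint r θ) := by
  have hc : ∀ f : ℝ → ℝ, (∀ r₁ r₂ : ℝ, 0 < r₁ → r₁ ≤ r₂ →
      AbsolutelyContinuousOnInterval f r₁ r₂) → ContinuousOn f (Ioi 0) := by
    intro f hf r hr
    have hr' : 0 < r := hr
    have h1 := (hf (r / 2) (r + 1) (by positivity) (by linarith)).continuousOn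
    rw [uIcc_of_le (by linarith)] at h1
    exact (h1.continuousAt (Icc_mem_nhds (by linarith) (by linarith))).continuousWithinAt
  filter_upwards [ae_ray_of_ae (h.ae_eq.trans h'.ae_eq.symm), h.2, h'.2] with θ h1 h2 h3 r hr
  exact Measure.eqOn_open_of_ae_eq h1 isOpen_Ioi (hc _ h2) (hc _ h3) hr

end WeightedPlane

/-! ### Quarter means near the origin -/

namespace WeightedPlane

lemma sq_lintegral_mul_le {X : Type*} [MeasurableSpace X] (μ : Measure X) {f h : X → ℝ≥0∞}
    (hf : AEMeasurable f μ) (hh : AEMeasurable h μ) :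
    (∫⁻ x, f x * h x ∂μ) ^ 2 ≤ (∫⁻ x, f x ^ 2 ∂μ) * ∫⁻ x, h x ^ 2 ∂μ := by
  have h1 := ENNReal.lintegral_mul_le_Lp_mul_Lq μ Real.HolderConjugate.two_two hf hh
  have h2 := pow_le_pow_left' h1 2
  have h3 : ∀ x : ℝ≥0∞, (x ^ ((1 : ℝ) / 2)) ^ 2 = x := fun x => by
    rw [← ENNReal.rpow_natCast, ← ENNReal.rpow_mul]; norm_num
  rw [mul_pow, h3, h3] at h2
  simpa using h2

lemma lintegral_sq_arc_le {f : ℝ → ℝ≥0∞} (hf : AEMeasurable f arc) :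
    (∫⁻ x, f x ∂arc) ^ 2 ≤ ENNReal.ofReal (Real.pi / 2) * ∫⁻ x, f x ^ 2 ∂arc := by
  have h := sq_lintegral_mul_le arc (aemeasurable_const (b := (1 : ℝ≥0∞))) hf
  simpa [arc_univ] using h

lemma ofReal_pi_div_two_le : ENNReal.ofReal (Real.pi / 2) ≤ 2 := by
  rw [← ENNReal.ofReal_ofNat]
  exact ENNReal.ofReal_le_ofReal (by linarith [Real.pi_le_four])

lemma ofReal_two_div_pi_mul : ENNReal.ofReal (2 / Real.pi) * ENNReal.ofReal (Real.pi / 2) = 1 := by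
  rw [← ENNReal.ofReal_mul (by positivity), ← ENNReal.ofReal_one]
  congr 1
  field_simp

lemma ofReal_two_div_pi_le_one : ENNReal.ofReal (2 / Real.pi) ≤ 1 := by
  rw [← ENNReal.ofReal_one]
  refine ENNReal.ofReal_le_ofReal ?_
  rw [div_le_one Real.pi_pos]
  exact Real.two_le_pi

lemma tendsto_lintegral_Ioc_zero {f : ℝ → ℝ≥0∞} (hf : ∫⁻ r in Ioc (0 : ℝ) 1, f r < ∞) :
    Tendsto (fun ε => ∫⁻ r in Ioc (0 : ℝ) ε, f r) (𝓝[>] 0) (𝓝 0) := by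
  have hl : Tendsto (fun ε : ℝ => (volume.restrict (Ioc (0 : ℝ) 1)) (Ioc 0 ε)) (𝓝[>] 0) (𝓝 0) := by
    have h1 : Tendsto (fun ε : ℝ => ENNReal.ofReal ε) (𝓝[>] 0) (𝓝 0) := by
      have := (ENNReal.continuous_ofReal.tendsto 0).mono_left
        (nhdsWithin_le_nhds (s := Ioi (0 : ℝ)))
      simpa using this
    refine tendsto_of_tendsto_of_tendsto_of_le_of_le tendsto_const_nhds h1
      (fun _ => zero_le) fun ε => ?_
    refine (Measure.restrict_apply_le _ _).trans ?_
    simp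
  have h2 := tendsto_setLIntegral_zero hf.ne hl
  refine h2.congr' ?_
  filter_upwards [Ioo_mem_nhdsGT (one_pos : (0 : ℝ) < 1)] with ε hε
  rw [Measure.restrict_restrict measurableSet_Ioc, inter_eq_left.2 (Ioc_subset_Ioc_right hε.2.le)]

/-- The integral of `‖g‖` over the quarter circle of radius `r` with angles in `(α, α + π / 2)`,
with respect to the angle. -/
noncomputable def quarterNorm (g : Plane → Plane) (α r : ℝ) : ℝ≥0∞ :=
  ∫⁻ s, ‖g (polarPoint r (s + α))‖ₑ ∂arc

lemma measurable_quarterNorm {g : Plane → Plane} (mg : Measurable g) (α : ℝ) :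
    Measurable (quarterNorm g α) :=
  (measurable_comp_polarPoint_add mg.enorm α).lintegral_prod_right'

lemma measurable_quarter {β : Type*} [MeasurableSpace β] {f : Plane → β} (hf : Measurable f)
    (α r : ℝ) : Measurable fun θ => f (polarPoint r (θ + α)) :=
  (measurable_comp_polarPoint_add hf α).comp (measurable_const.prodMk measurable_id)

lemma lintegral_quarter_sub_le {v : Plane → ℝ} {g : Plane → Plane} (mg : Measurable g)
    (h : HasRadialDerivative v g) (α : ℝ) {r₁ r₂ : ℝ} (h0 : 0 < r₁) (h12 : r₁ ≤ r₂) :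
    ∫⁻ θ, ‖v (polarPoint r₂ (θ + α)) - v (polarPoint r₁ (θ + α))‖ₑ ∂arc ≤
      ∫⁻ r in Ioc r₁ r₂, quarterNorm g α r := by
  calc _ ≤ ∫⁻ θ, (∫⁻ r in Ioc r₁ r₂, ‖g (polarPoint r (θ + α))‖ₑ) ∂arc := by
        refine lintegral_mono_ae ?_
        filter_upwards [ae_arc_add h α] with θ hθ
        rw [(hθ r₁ r₂ h0 h12).2, intervalIntegral.integral_of_le h12]
        refine (enorm_integral_le_lintegral_enorm _).trans (lintegral_mono fun r => ?_)
        rw [← ofReal_norm, ← ofReal_norm]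
        refine ENNReal.ofReal_le_ofReal ((norm_inner_le_norm _ _).trans (le_of_eq ?_))
        rw [norm_polarPoint_one, mul_one]
    _ = ∫⁻ r in Ioc r₁ r₂, quarterNorm g α r :=
        lintegral_lintegral_swap (f := fun θ r => ‖g (polarPoint r (θ + α))‖ₑ)
          ((measurable_comp_polarPoint_add mg.enorm α).comp measurable_swap).aemeasurable

lemma lintegral_quarterNorm_lt_top {g : Plane → Plane} (mg : Measurable g)
    (hg : ∀ R : ℕ, ∫⁻ x in Metric.ball 0 (R : ℝ), ‖g x‖ₑ < ∞) (α : ℝ) {r₁ r₂ : ℝ} (h0 : 0 < r₁) :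
    ∫⁻ r in Ioc r₁ r₂, quarterNorm g α r < ∞ := by
  obtain ⟨R, hR⟩ := exists_nat_gt r₂
  have h1 := hg R
  have hmb : MeasurableSet (Metric.ball (0 : Plane) (R : ℝ)) := Metric.isOpen_ball.measurableSet
  rw [← lintegral_indicator hmb] at h1
  have h2 := (lintegral_sector_le (mg.enorm.indicator hmb) α).trans_lt h1
  have h3 : ENNReal.ofReal r₁ * ∫⁻ r in Ioc r₁ r₂, quarterNorm g α r < ∞ := by
    rw [← lintegral_const_mul _ (measurable_quarterNorm mg α)]
    refine lt_of_le_of_lt ?_ h2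
    refine le_trans ?_ (lintegral_mono_set (s := Ioc r₁ r₂) fun r hr => h0.trans hr.1)
    refine setLIntegral_mono' measurableSet_Ioc fun r hr => ?_
    have hr0 : 0 < r := h0.trans hr.1
    have : ∀ θ, polarPoint r θ ∈ Metric.ball (0 : Plane) R := fun θ => by
      rw [mem_ball_zero_iff, norm_polarPoint, abs_of_pos hr0]; exact hr.2.trans_lt hR
    simp only [indicator_of_mem (this _)]
    exact mul_le_mul_left (ENNReal.ofReal_le_ofReal hr.1.le) _
  by_contra hc
  rw [not_lt, top_le_iff] at hc
  rw [hc, ENNReal.mul_top (by simpa using h0)] at h3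
  exact lt_irrefl _ h3

lemma ae_Ioi_exists {P : ℝ → Prop} (h : ∀ᵐ r ∂(volume.restrict (Ioi (0 : ℝ))), P r) :
    ∃ r, 0 < r ∧ P r := by
  have : NeBot (ae (volume.restrict (Ioi (0 : ℝ)))) := by
    rw [ae_neBot, Ne, Measure.restrict_eq_zero]
    simp
  obtain ⟨r, h1, h2⟩ := ((ae_restrict_mem measurableSet_Ioi).and h).exists
  exact ⟨r, h1, h2⟩

/-- A radially absolutely continuous function is integrable on *every* quarter circle. -/
lemma integrable_quarter {v : Plane → ℝ} {g : Plane → Plane} (mv : Measurable v)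
    (mg : Measurable g) (hv : ∀ R : ℕ, ∫⁻ x in Metric.ball 0 (R : ℝ), ‖v x‖ₑ < ∞)
    (hg : ∀ R : ℕ, ∫⁻ x in Metric.ball 0 (R : ℝ), ‖g x‖ₑ < ∞) (h : HasRadialDerivative v g)
    (α : ℝ) {r : ℝ} (hr : 0 < r) : Integrable (fun θ => v (polarPoint r (θ + α))) arc := by
  obtain ⟨r₀, hr₀, h₀⟩ := ae_Ioi_exists (ae_circle_lintegral_lt_top mv.enorm hv α)
  have key : ∫⁻ θ, ‖v (polarPoint r (θ + α)) - v (polarPoint r₀ (θ + α))‖ₑ ∂arc < ∞ := by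
    rcases le_total r₀ r with h1 | h1
    · exact (lintegral_quarter_sub_le mg h α hr₀ h1).trans_lt
        (lintegral_quarterNorm_lt_top mg hg α hr₀)
    · simp only [enorm_sub_rev (v (polarPoint r _))]
      exact (lintegral_quarter_sub_le mg h α hr h1).trans_lt
        (lintegral_quarterNorm_lt_top mg hg α hr)
  have i1 : Integrable (fun θ => v (polarPoint r₀ (θ + α))) arc :=
    ⟨(measurable_quarter mv α r₀).aestronglyMeasurable, h₀⟩
  have i2 : Integrable (fun θ => v (polarPoint r (θ + α)) - v (polarPoint r₀ (θ + α))) arc :=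
    ⟨((measurable_quarter mv α r).sub (measurable_quarter mv α r₀)).aestronglyMeasurable, key⟩
  refine (i1.add i2).congr (ae_of_all _ fun θ => ?_)
  simp

lemma quarterMean_eq (v : Plane → ℝ) (α r : ℝ) :
    quarterMean v α r = 2 / Real.pi * ∫ θ, v (polarPoint r (θ + α)) ∂arc := by
  rw [quarterMean, integral_quarter]

lemma enorm_quarterMean_sub_le {v : Plane → ℝ} {g : Plane → Plane} (mv : Measurable v)
    (mg : Measurable g) (hv : ∀ R : ℕ, ∫⁻ x in Metric.ball 0 (R : ℝ), ‖v x‖ₑ < ∞)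
    (hg : ∀ R : ℕ, ∫⁻ x in Metric.ball 0 (R : ℝ), ‖g x‖ₑ < ∞) (h : HasRadialDerivative v g)
    (α : ℝ) {r₁ r₂ : ℝ} (h0 : 0 < r₁) (h12 : r₁ ≤ r₂) :
    ‖quarterMean v α r₂ - quarterMean v α r₁‖ₑ ≤ ∫⁻ r in Ioc r₁ r₂, quarterNorm g α r := by
  rw [quarterMean_eq, quarterMean_eq, ← mul_sub, ← integral_sub
    (integrable_quarter mv mg hv hg h α (h0.trans_le h12))
    (integrable_quarter mv mg hv hg h α h0), enorm_mul, Real.enorm_eq_ofReal (by positivity)]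
  refine (mul_le_mul' ofReal_two_div_pi_le_one ((enorm_integral_le_lintegral_enorm _).trans
    (lintegral_quarter_sub_le mg h α h0 h12))).trans ?_
  rw [one_mul]

/-- If the radial derivative is integrable near the origin, then the quarter means converge. -/
lemma exists_tendsto_quarterMean {v : Plane → ℝ} {g : Plane → Plane} (mv : Measurable v)
    (mg : Measurable g) (hv : ∀ R : ℕ, ∫⁻ x in Metric.ball 0 (R : ℝ), ‖v x‖ₑ < ∞)
    (hg : ∀ R : ℕ, ∫⁻ x in Metric.ball 0 (R : ℝ), ‖g x‖ₑ < ∞) (h : HasRadialDerivative v g)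
    (α : ℝ) (hG : ∫⁻ r in Ioc (0 : ℝ) 1, quarterNorm g α r < ∞) :
    ∃ L, Tendsto (quarterMean v α) (𝓝[>] 0) (𝓝 L) ∧
      ∀ r, 0 < r → ‖quarterMean v α r - L‖ₑ ≤ ∫⁻ s in Ioc (0 : ℝ) r, quarterNorm g α s := by
  have hle : ∀ r₁ r₂ : ℝ, 0 < r₁ → r₁ ≤ r₂ → ‖quarterMean v α r₂ - quarterMean v α r₁‖ₑ ≤
      ∫⁻ s in Ioc (0 : ℝ) r₂, quarterNorm g α s := fun r₁ r₂ h0 h12 =>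
    (enorm_quarterMean_sub_le mv mg hv hg h α h0 h12).trans
      (lintegral_mono_set (Ioc_subset_Ioc_left h0.le))
  have hC : Cauchy (map (quarterMean v α) (𝓝[>] 0)) := by
    rw [EMetric.cauchy_iff]
    refine ⟨(inferInstance : NeBot (map (quarterMean v α) (𝓝[>] 0))).ne, fun ε hε => ?_⟩
    have h1 := (tendsto_lintegral_Ioc_zero hG).eventually (gt_mem_nhds hε)
    obtain ⟨δ, hδ, hδ0⟩ := (h1.and self_mem_nhdsWithin).exists
    have hδ0' : 0 < δ := hδ0
    refine ⟨quarterMean v α '' Ioc 0 δ, image_mem_map (Ioc_mem_nhdsGT hδ0'), ?_⟩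
    have aux : ∀ r₁ r₂ : ℝ, 0 < r₁ → r₁ ≤ r₂ → r₂ ≤ δ →
        edist (quarterMean v α r₂) (quarterMean v α r₁) < ε := fun r₁ r₂ h0 h12 h2 => by
      rw [edist_eq_enorm_sub]
      exact ((hle r₁ r₂ h0 h12).trans (lintegral_mono_set (Ioc_subset_Ioc_right h2))).trans_lt hδ
    rintro _ ⟨r₁, hr₁, rfl⟩ _ ⟨r₂, hr₂, rfl⟩
    rcases le_total r₁ r₂ with h12 | h12
    · rw [edist_comm]; exact aux r₁ r₂ hr₁.1 h12 hr₂.2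
    · exact aux r₂ r₁ hr₂.1 h12 hr₁.2
  obtain ⟨L, hL⟩ := CompleteSpace.complete hC
  have hL' : Tendsto (quarterMean v α) (𝓝[>] 0) (𝓝 L) := hL
  refine ⟨L, hL', fun r hr => ?_⟩
  have h2 : Tendsto (fun s => ‖quarterMean v α r - quarterMean v α s‖ₑ) (𝓝[>] 0)
      (𝓝 ‖quarterMean v α r - L‖ₑ) :=
    (continuous_enorm.tendsto _).comp (tendsto_const_nhds.sub hL')
  refine le_of_tendsto h2 ?_
  filter_upwards [Ioc_mem_nhdsGT hr] with s hs
  exact hle s r hs.1 hs.2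

/-! ### Weighted estimates near the origin -/

section Weight

variable {a : ℝ → ℝ≥0∞}

lemma ne_zero_ne_top_of_bounds (h_deg : ∀ ε : ℝ, 0 < ε → ∃ c : ℝ≥0, 0 < c ∧
      ∀ r ∈ Ioc (0 : ℝ) 1, ε < r → (c : ℝ≥0∞) ≤ a r ∧ (c : ℝ≥0∞) ≤ (a r)⁻¹)
    {r : ℝ} (hr : r ∈ Ioc (0 : ℝ) 1) : a r ≠ 0 ∧ a r ≠ ∞ := by
  obtain ⟨c, hc, h⟩ := h_deg (r / 2) (by linarith [hr.1])
  obtain ⟨h1, h2⟩ := h r hr (by linarith [hr.1])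
  have hc' : (0 : ℝ≥0∞) < c := by exact_mod_cast hc
  exact ⟨(hc'.trans_le h1).ne', fun h3 => by simp [h3] at h2; exact hc.ne' h2⟩

/-- The part of the energy of `f` carried by the sector with angles in `(α, α + π / 2)`. -/
lemma lintegral_sector_weight_le {E : Type*} [NormedAddCommGroup E] [MeasurableSpace E]
    [OpensMeasurableSpace E] {f : Plane → E} (mf : Measurable f) {ρ : Plane → ℝ≥0∞}
    (hρ : Measurable ρ) {α : ℝ} {b : ℝ → ℝ≥0∞}
    (hα : ∀ r ∈ Ioo (0 : ℝ) 1, ∀ θ ∈ Ioo 0 (Real.pi / 2), ρ (polarPoint r (θ + α)) = b r) :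
    ∫⁻ r in Ioc (0 : ℝ) 1, (∫⁻ θ, ‖f (polarPoint r (θ + α))‖ₑ ^ 2 ∂arc) *
      (b r * ENNReal.ofReal r) ≤ ∫⁻ x, ‖f x‖ₑ ^ 2 * ρ x := by
  refine le_trans ?_ (lintegral_sector_le ((mf.enorm.pow_const 2).mul hρ) α)
  rw [← restrict_Ioo_eq_restrict_Ioc]
  refine le_trans (setLIntegral_mono' measurableSet_Ioo fun r hr => le_of_eq ?_)
    (lintegral_mono_set fun r hr => hr.1)
  have : ∫⁻ θ, ‖f (polarPoint r (θ + α))‖ₑ ^ 2 * ρ (polarPoint r (θ + α)) ∂arc =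
      ∫⁻ θ, ‖f (polarPoint r (θ + α))‖ₑ ^ 2 * b r ∂arc := by
    refine setLIntegral_congr_fun measurableSet_Ioo fun θ hθ => ?_
    simp only [hα r hr θ hθ]
  rw [Pi.mul_def, this, lintegral_mul_const _ ((measurable_quarter mf α r).enorm.pow_const 2)]
  ring

/-- The square of `quarterNorm`, integrated over `(0, ε]` with the weight `r / a(r)`. -/
noncomputable def sectorEnergy (a : ℝ → ℝ≥0∞) (g : Plane → Plane) (α ε : ℝ) : ℝ≥0∞ :=
  ∫⁻ r in Ioc (0 : ℝ) ε, quarterNorm g α r ^ 2 * ((a r)⁻¹ * ENNReal.ofReal r)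

lemma sectorEnergy_mono (g : Plane → Plane) (α : ℝ) {ε δ : ℝ} (h : ε ≤ δ) :
    sectorEnergy a g α ε ≤ sectorEnergy a g α δ :=
  lintegral_mono_set (Ioc_subset_Ioc_right h)

lemma sectorEnergy_one_le {g : Plane → Plane} (mg : Measurable g) {ρ : Plane → ℝ≥0∞}
    (hρ : Measurable ρ) {α : ℝ}
    (hα : ∀ r ∈ Ioo (0 : ℝ) 1, ∀ θ ∈ Ioo 0 (Real.pi / 2),
      ρ (polarPoint r (θ + α)) = (a r)⁻¹) :
    sectorEnergy a g α 1 ≤ 2 * ∫⁻ x, ‖g x‖ₑ ^ 2 * ρ x := by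
  refine le_trans ?_ (mul_le_mul_right (lintegral_sector_weight_le mg hρ hα) 2)
  rw [← lintegral_const_mul' _ _ (by simp)]
  refine lintegral_mono fun r => ?_
  rw [← mul_assoc 2]
  refine mul_le_mul_left ?_ _
  exact (lintegral_sq_arc_le (measurable_quarter mg α r).enorm.aemeasurable).trans
    (mul_le_mul_left ofReal_pi_div_two_le _)

/-- Cauchy–Schwarz: the weight `r / a(r)` controls the radial derivative in `L¹`, because `a(r) / r`
is integrable. -/
lemma sq_lintegral_quarterNorm_le (ha : Measurable a)
    (ha0 : ∀ r ∈ Ioc (0 : ℝ) 1, a r ≠ 0 ∧ a r ≠ ∞) {g : Plane → Plane} (mg : Measurable g)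
    (α : ℝ) {r : ℝ} (hr : r ≤ 1) :
    (∫⁻ s in Ioc (0 : ℝ) r, quarterNorm g α s) ^ 2 ≤
      sectorEnergy a g α r * ∫⁻ s in Ioc (0 : ℝ) r, a s / ENNReal.ofReal s := by
  have m1 : Measurable fun s => ((a s)⁻¹ * ENNReal.ofReal s) ^ ((1 : ℝ) / 2) :=
    (ha.inv.mul ENNReal.measurable_ofReal).pow_const _
  have m2 : Measurable fun s => (a s / ENNReal.ofReal s) ^ ((1 : ℝ) / 2) :=
    (ha.div ENNReal.measurable_ofReal).pow_const _
  have h3 : ∀ x : ℝ≥0∞, (x ^ ((1 : ℝ) / 2)) ^ 2 = x := fun x => by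
    rw [← ENNReal.rpow_natCast, ← ENNReal.rpow_mul]; norm_num
  have key := sq_lintegral_mul_le (volume.restrict (Ioc (0 : ℝ) r))
    ((measurable_quarterNorm mg α).mul m1).aemeasurable m2.aemeasurable
  simp only [Pi.mul_apply, mul_pow, h3] at key
  refine le_trans (pow_le_pow_left' (le_of_eq ?_) 2) key
  refine setLIntegral_congr_fun measurableSet_Ioc fun s hs => ?_
  obtain ⟨h4, h5⟩ := ha0 s ⟨hs.1, hs.2.trans hr⟩
  have hs0 : ENNReal.ofReal s ≠ 0 := by simpa using hs.1
  have hst : ENNReal.ofReal s ≠ ∞ := ENNReal.ofReal_ne_top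
  have : (a s)⁻¹ * ENNReal.ofReal s * (a s / ENNReal.ofReal s) = 1 := by
    rw [mul_assoc, ENNReal.mul_div_cancel hs0 hst, ENNReal.inv_mul_cancel h4 h5]
  rw [mul_assoc, ← ENNReal.mul_rpow_of_nonneg _ _ (by norm_num), this, ENNReal.one_rpow, mul_one]

lemma enorm_quarterMean_sq_le {v : Plane → ℝ} (mv : Measurable v) (α r : ℝ) :
    ‖quarterMean v α r‖ₑ ^ 2 ≤ ∫⁻ θ, ‖v (polarPoint r (θ + α))‖ₑ ^ 2 ∂arc := by
  have h1 : ‖quarterMean v α r‖ₑ ≤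
      ENNReal.ofReal (2 / Real.pi) * ∫⁻ θ, ‖v (polarPoint r (θ + α))‖ₑ ∂arc := by
    rw [quarterMean_eq, enorm_mul, Real.enorm_eq_ofReal (by positivity)]
    exact mul_le_mul_right (enorm_integral_le_lintegral_enorm _) _
  have h2 := lintegral_sq_arc_le (measurable_quarter mv α r).enorm.aemeasurable
  calc ‖quarterMean v α r‖ₑ ^ 2
      ≤ ENNReal.ofReal (2 / Real.pi) ^ 2 * (ENNReal.ofReal (Real.pi / 2) *
          ∫⁻ θ, ‖v (polarPoint r (θ + α))‖ₑ ^ 2 ∂arc) := by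
        refine (pow_le_pow_left' h1 2).trans ?_
        rw [mul_pow]
        exact mul_le_mul_right h2 _
    _ = ENNReal.ofReal (2 / Real.pi) * (ENNReal.ofReal (2 / Real.pi) *
          ENNReal.ofReal (Real.pi / 2)) * ∫⁻ θ, ‖v (polarPoint r (θ + α))‖ₑ ^ 2 ∂arc := by ring
    _ ≤ _ := by
        rw [ofReal_two_div_pi_mul, mul_one]
        exact (mul_le_mul_left ofReal_two_div_pi_le_one _).trans (one_mul _).le

/-- The limit of the quarter means is a continuous functional for the energy norm: the mean over
the annulus `1 / 2 < r ≤ 1` is controlled by `∫ v² ρ`, and the variation of the means up to the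
origin by `∫ ‖g‖² ρ`. -/
lemma sq_enorm_limit_mul_le (ha : Measurable a)
    (ha0 : ∀ r ∈ Ioc (0 : ℝ) 1, a r ≠ 0 ∧ a r ≠ ∞) {v : Plane → ℝ} {g : Plane → Plane}
    (mv : Measurable v) (mg : Measurable g) {ρ : Plane → ℝ≥0∞} (hρ : Measurable ρ) {α : ℝ}
    (hα : ∀ r ∈ Ioo (0 : ℝ) 1, ∀ θ ∈ Ioo 0 (Real.pi / 2), ρ (polarPoint r (θ + α)) = (a r)⁻¹)
    {L : ℝ} (hL : ∀ r, 0 < r →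
      ‖quarterMean v α r - L‖ₑ ≤ ∫⁻ s in Ioc (0 : ℝ) r, quarterNorm g α s) :
    ‖L‖ₑ ^ 2 * (∫⁻ r in Ioc (1 / 2 : ℝ) 1, (a r)⁻¹ * ENNReal.ofReal r) ≤
      2 * (∫⁻ x, ‖v x‖ₑ ^ 2 * ρ x) + 2 * (2 * (∫⁻ x, ‖g x‖ₑ ^ 2 * ρ x) *
        ∫⁻ s in Ioc (0 : ℝ) 1, a s / ENNReal.ofReal s) *
          (∫⁻ r in Ioc (1 / 2 : ℝ) 1, (a r)⁻¹ * ENNReal.ofReal r) := by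
  set I := ∫⁻ s in Ioc (0 : ℝ) 1, quarterNorm g α s with hI
  have hI2 : I ^ 2 ≤ 2 * (∫⁻ x, ‖g x‖ₑ ^ 2 * ρ x) *
      ∫⁻ s in Ioc (0 : ℝ) 1, a s / ENNReal.ofReal s :=
    (sq_lintegral_quarterNorm_le ha ha0 mg α le_rfl).trans
      (mul_le_mul_left (sectorEnergy_one_le mg hρ hα) _)
  have mw : Measurable fun r => (a r)⁻¹ * ENNReal.ofReal r := ha.inv.mul ENNReal.measurable_ofReal
  have mV : Measurable fun r => ∫⁻ θ, ‖v (polarPoint r (θ + α))‖ₑ ^ 2 ∂arc :=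
    (measurable_comp_polarPoint_add (mv.enorm.pow_const 2) α).lintegral_prod_right'
  have hpt : ∀ r ∈ Ioc (1 / 2 : ℝ) 1, ‖L‖ₑ ^ 2 ≤
      2 * (∫⁻ θ, ‖v (polarPoint r (θ + α))‖ₑ ^ 2 ∂arc) + 2 * I ^ 2 := fun r hr => by
    have hr0 : 0 < r := by linarith [hr.1]
    have h1 := enorm_sub_sq_le (quarterMean v α r) (quarterMean v α r - L)
    rw [sub_sub_cancel] at h1
    refine h1.trans (add_le_add (mul_le_mul_right (enorm_quarterMean_sq_le mv α r) _)
      (mul_le_mul_right (pow_le_pow_left' ((hL r hr0).trans ?_) 2) _))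
    exact lintegral_mono_set (Ioc_subset_Ioc_right hr.2)
  rw [← lintegral_const_mul _ mw]
  calc ∫⁻ r in Ioc (1 / 2 : ℝ) 1, ‖L‖ₑ ^ 2 * ((a r)⁻¹ * ENNReal.ofReal r)
      ≤ ∫⁻ r in Ioc (1 / 2 : ℝ) 1, (2 * ((∫⁻ θ, ‖v (polarPoint r (θ + α))‖ₑ ^ 2 ∂arc) *
          ((a r)⁻¹ * ENNReal.ofReal r)) + 2 * I ^ 2 * ((a r)⁻¹ * ENNReal.ofReal r)) := by
        refine setLIntegral_mono' measurableSet_Ioc fun r hr => ?_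
        refine (mul_le_mul_left (hpt r hr) _).trans (le_of_eq ?_)
        ring
    _ = 2 * (∫⁻ r in Ioc (1 / 2 : ℝ) 1, (∫⁻ θ, ‖v (polarPoint r (θ + α))‖ₑ ^ 2 ∂arc) *
          ((a r)⁻¹ * ENNReal.ofReal r)) +
        2 * I ^ 2 * ∫⁻ r in Ioc (1 / 2 : ℝ) 1, (a r)⁻¹ * ENNReal.ofReal r := by
        have m1 : Measurable fun r => (∫⁻ θ, ‖v (polarPoint r (θ + α))‖ₑ ^ 2 ∂arc) *
            ((a r)⁻¹ * ENNReal.ofReal r) := mV.mul mw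
        rw [lintegral_add_left (m1.const_mul 2), lintegral_const_mul _ m1,
          lintegral_const_mul _ mw]
    _ ≤ _ := by
        refine add_le_add (mul_le_mul_right ?_ _) (mul_le_mul_left (mul_le_mul_right hI2 _) _)
        exact (lintegral_mono_set (Ioc_subset_Ioc_left (by norm_num))).trans
          (lintegral_sector_weight_le mv hρ hα)

/-- If the quarter means tend to `0`, then the weighted `L²` norm of `v` over a sector of radius `ε`
is bounded by the energy of that sector, times a factor which is `O(ε²)` under the third hypothesis
on `a`: the deviation from the mean is controlled by the
oscillation on circles, and the mean by the radial derivative. -/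
lemma lintegral_sector_sq_le (ha : Measurable a)
    (ha0 : ∀ r ∈ Ioc (0 : ℝ) 1, a r ≠ 0 ∧ a r ≠ ∞) {v : Plane → ℝ} {g : Plane → Plane}
    (mg : Measurable g) {α : ℝ}
    (hint : ∀ r, 0 < r → Integrable (fun θ => v (polarPoint r (θ + α))) arc)
    (hosc : HasQuarterOscillationBound v g α)
    (hL : ∀ r, 0 < r → ‖quarterMean v α r‖ₑ ≤ ∫⁻ s in Ioc (0 : ℝ) r, quarterNorm g α s)
    {ε : ℝ} (hε : ε ≤ 1) :
    ∫⁻ r in Ioc (0 : ℝ) ε, (∫⁻ θ, ‖v (polarPoint r (θ + α))‖ₑ ^ 2 ∂arc) *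
        ((a r)⁻¹ * ENNReal.ofReal r) ≤
      4 * sectorEnergy a g α ε * ((∫⁻ r in Ioc (0 : ℝ) ε, (a r)⁻¹ * ENNReal.ofReal r *
        (∫⁻ s in Ioc (0 : ℝ) r, a s / ENNReal.ofReal s)) + ENNReal.ofReal (ε ^ 2)) := by
  set A : ℝ → ℝ≥0∞ := fun r => ∫⁻ s in Ioc (0 : ℝ) r, a s / ENNReal.ofReal s with hA
  set D := sectorEnergy a g α ε with hD
  have mA : Measurable A := Monotone.measurable fun r₁ r₂ h =>
    lintegral_mono_set (Ioc_subset_Ioc_right h)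
  have mw : Measurable fun r => (a r)⁻¹ * ENNReal.ofReal r := ha.inv.mul ENNReal.measurable_ofReal
  have mG := measurable_quarterNorm mg α
  have hpt : ∀ᵐ r ∂(volume.restrict (Ioc 0 ε)), ∫⁻ θ, ‖v (polarPoint r (θ + α))‖ₑ ^ 2 ∂arc ≤
      4 * (D * A r + ENNReal.ofReal (ε ^ 2) * quarterNorm g α r ^ 2) := by
    filter_upwards [ae_mono (Measure.restrict_mono (fun r (hr : r ∈ Ioc 0 ε) => hr.1) le_rfl) hosc,
      ae_restrict_mem measurableSet_Ioc] with r hr hrm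
    have hdev : ∀ᵐ θ ∂arc, ‖v (polarPoint r (θ + α)) - quarterMean v α r‖ₑ ≤
        ENNReal.ofReal r * quarterNorm g α r := by
      filter_upwards [hr] with θ hθ
      have e1 : v (polarPoint r (θ + α)) - quarterMean v α r =
          2 / Real.pi * ∫ θ', (v (polarPoint r (θ + α)) - v (polarPoint r (θ' + α))) ∂arc := by
        have hr1 : arc.real univ = Real.pi / 2 := by
          rw [Measure.real, arc_univ, ENNReal.toReal_ofReal (by positivity)]
        rw [integral_sub (integrable_const _) (hint r hrm.1), integral_const, quarterMean_eq, hr1,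
          smul_eq_mul]
        field_simp
      rw [e1, enorm_mul, Real.enorm_eq_ofReal (by positivity)]
      calc _ ≤ ENNReal.ofReal (2 / Real.pi) *
            ∫⁻ θ', ENNReal.ofReal r * quarterNorm g α r ∂arc :=
            mul_le_mul_right ((enorm_integral_le_lintegral_enorm _).trans
              (lintegral_mono_ae hθ)) _
        _ = ENNReal.ofReal (2 / Real.pi) * ENNReal.ofReal (Real.pi / 2) *
            (ENNReal.ofReal r * quarterNorm g α r) := by
            rw [lintegral_const, arc_univ]; ring
        _ = _ := by rw [ofReal_two_div_pi_mul, one_mul]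
    have hmean : ‖quarterMean v α r‖ₑ ^ 2 ≤ D * A r :=
      (pow_le_pow_left' (hL r hrm.1) 2).trans
        ((sq_lintegral_quarterNorm_le ha ha0 mg α (hrm.2.trans hε)).trans
          (mul_le_mul_left (sectorEnergy_mono g α hrm.2) _))
    calc ∫⁻ θ, ‖v (polarPoint r (θ + α))‖ₑ ^ 2 ∂arc
        ≤ ∫⁻ θ, 2 * (D * A r + ENNReal.ofReal (ε ^ 2) * quarterNorm g α r ^ 2) ∂arc := by
          refine lintegral_mono_ae ?_
          filter_upwards [hdev] with θ hθ
          have h1 := enorm_add_sq_le (quarterMean v α r)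
            (v (polarPoint r (θ + α)) - quarterMean v α r)
          rw [add_sub_cancel] at h1
          rw [mul_add]
          refine h1.trans (add_le_add (mul_le_mul_right hmean _) (mul_le_mul_right ?_ _))
          refine (pow_le_pow_left' hθ 2).trans ?_
          rw [mul_pow, ← ENNReal.ofReal_pow hrm.1.le]
          refine mul_le_mul_left (ENNReal.ofReal_le_ofReal ?_) _
          exact pow_le_pow_left₀ hrm.1.le hrm.2 2
      _ = 2 * (D * A r + ENNReal.ofReal (ε ^ 2) * quarterNorm g α r ^ 2) *
            ENNReal.ofReal (Real.pi / 2) := by rw [lintegral_const, arc_univ]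
      _ ≤ 2 * (D * A r + ENNReal.ofReal (ε ^ 2) * quarterNorm g α r ^ 2) * 2 :=
          mul_le_mul_right ofReal_pi_div_two_le _
      _ = _ := by ring
  calc _ ≤ ∫⁻ r in Ioc (0 : ℝ) ε, (4 * D * ((a r)⁻¹ * ENNReal.ofReal r * A r) +
          4 * ENNReal.ofReal (ε ^ 2) * (quarterNorm g α r ^ 2 *
            ((a r)⁻¹ * ENNReal.ofReal r))) := by
        refine lintegral_mono_ae ?_
        filter_upwards [hpt] with r hr
        refine (mul_le_mul_left hr _).trans (le_of_eq ?_)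
        ring
    _ = 4 * D * (∫⁻ r in Ioc (0 : ℝ) ε, (a r)⁻¹ * ENNReal.ofReal r * A r) +
          4 * ENNReal.ofReal (ε ^ 2) * D := by
        have m1 : Measurable fun r => (a r)⁻¹ * ENNReal.ofReal r * A r := mw.mul mA
        have m2 : Measurable fun r => quarterNorm g α r ^ 2 * ((a r)⁻¹ * ENNReal.ofReal r) :=
          (mG.pow_const 2).mul mw
        rw [lintegral_add_left (m1.const_mul _), lintegral_const_mul _ m1,
          lintegral_const_mul _ m2]
        rfl
    _ = _ := by ring

end Weight

end WeightedPlane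

/-! ### The weight -/

namespace WeightedPlane

variable {a : ℝ → ℝ≥0∞}

lemma measurable_weight (ha : Measurable a) : Measurable (weight a) := by
  classical
  have h0 : Measurable fun x : Plane => x 0 :=
    (EuclideanSpace.proj (𝕜 := ℝ) 0).continuous.measurable
  have h1 : Measurable fun x : Plane => x 1 :=
    (EuclideanSpace.proj (𝕜 := ℝ) 1).continuous.measurable
  have m1 : MeasurableSet Q₁ := (measurableSet_lt measurable_const h0).inter
    (measurableSet_lt measurable_const h1)
  have m2 : MeasurableSet Q₂ := (measurableSet_lt h0 measurable_const).inter
    (measurableSet_lt measurable_const h1)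
  have m3 : MeasurableSet Q₃ := (measurableSet_lt h0 measurable_const).inter
    (measurableSet_lt h1 measurable_const)
  have m4 : MeasurableSet Q₄ := (measurableSet_lt measurable_const h0).inter
    (measurableSet_lt h1 measurable_const)
  have hb : MeasurableSet (Metric.ball (0 : Plane) 1) := Metric.isOpen_ball.measurableSet
  unfold weight
  exact Measurable.ite ((m1.union m3).inter hb) (ha.comp measurable_norm).inv
    (Measurable.ite ((m2.union m4).inter hb) (ha.comp measurable_norm) measurable_const)

/-- Away from the origin the weight is bounded above and below. -/
lemma exists_weight_bounds (h_deg : ∀ ε : ℝ, 0 < ε → ∃ c : ℝ≥0, 0 < c ∧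
      ∀ r ∈ Ioc (0 : ℝ) 1, ε < r → (c : ℝ≥0∞) ≤ a r ∧ (c : ℝ≥0∞) ≤ (a r)⁻¹)
    {δ : ℝ} (hδ : 0 < δ) : ∃ c : ℝ≥0, 0 < c ∧ ∀ x : Plane, δ < ‖x‖ →
      (c : ℝ≥0∞) ≤ weight a x ∧ weight a x ≤ (c : ℝ≥0∞)⁻¹ := by
  obtain ⟨c, hc, h⟩ := h_deg δ hδ
  refine ⟨min c 1, lt_min hc one_pos, fun x hx => ?_⟩
  have h1 : ((min c 1 : ℝ≥0) : ℝ≥0∞) ≤ c := by exact_mod_cast min_le_left c 1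
  have h2 : ((min c 1 : ℝ≥0) : ℝ≥0∞) ≤ 1 := by exact_mod_cast min_le_right c 1
  have key : ‖x‖ < 1 → (c : ℝ≥0∞) ≤ a ‖x‖ ∧ (c : ℝ≥0∞) ≤ (a ‖x‖)⁻¹ := fun hx1 =>
    h ‖x‖ ⟨hδ.trans hx, hx1.le⟩ hx
  unfold weight
  split_ifs with h3 h4
  · obtain ⟨k1, k2⟩ := key (by simpa using h3.2)
    exact ⟨h1.trans k2, ENNReal.inv_le_inv.2 (h1.trans k1)⟩
  · obtain ⟨k1, k2⟩ := key (by simpa using h4.2)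
    exact ⟨h1.trans k1, ENNReal.le_inv_iff_le_inv.1 (h1.trans k2)⟩
  · exact ⟨h2, by rw [ENNReal.one_le_inv]; exact h2⟩

lemma polarPoint_mem_ball {r : ℝ} (hr : r ∈ Ioo (0 : ℝ) 1) (θ : ℝ) :
    polarPoint r θ ∈ Metric.ball (0 : Plane) 1 := by
  rw [mem_ball_zero_iff, norm_polarPoint, abs_of_pos hr.1]; exact hr.2

lemma weight_polarPoint_zero {r : ℝ} (hr : r ∈ Ioo (0 : ℝ) 1) {θ : ℝ}
    (hθ : θ ∈ Ioo 0 (Real.pi / 2)) : weight a (polarPoint r (θ + 0)) = (a r)⁻¹ := by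
  have hs : 0 < Real.sin θ := Real.sin_pos_of_pos_of_lt_pi hθ.1 (by linarith [hθ.2, Real.pi_pos])
  have hc : 0 < Real.cos θ := Real.cos_pos_of_mem_Ioo ⟨by linarith [hθ.1, Real.pi_pos], hθ.2⟩
  have h1 : polarPoint r (θ + 0) ∈ (Q₁ ∪ Q₃) ∩ Metric.ball 0 1 :=
    ⟨Or.inl (by rw [add_zero]; exact ⟨mul_pos hr.1 hc, mul_pos hr.1 hs⟩), polarPoint_mem_ball hr _⟩
  rw [weight, if_pos h1, norm_polarPoint, abs_of_pos hr.1]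

lemma weight_polarPoint_pi {r : ℝ} (hr : r ∈ Ioo (0 : ℝ) 1) {θ : ℝ}
    (hθ : θ ∈ Ioo 0 (Real.pi / 2)) : weight a (polarPoint r (θ + Real.pi)) = (a r)⁻¹ := by
  have hs : 0 < Real.sin θ := Real.sin_pos_of_pos_of_lt_pi hθ.1 (by linarith [hθ.2, Real.pi_pos])
  have hc : 0 < Real.cos θ := Real.cos_pos_of_mem_Ioo ⟨by linarith [hθ.1, Real.pi_pos], hθ.2⟩
  have h1 : polarPoint r (θ + Real.pi) ∈ (Q₁ ∪ Q₃) ∩ Metric.ball 0 1 := by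
    refine ⟨Or.inr ⟨?_, ?_⟩, polarPoint_mem_ball hr _⟩
    · rw [polarPoint_zero_coord, Real.cos_add_pi]
      nlinarith [mul_pos hr.1 hc]
    · rw [polarPoint_one_coord, Real.sin_add_pi]
      nlinarith [mul_pos hr.1 hs]
  rw [weight, if_pos h1, norm_polarPoint, abs_of_pos hr.1]

lemma weight_of_mem_Q₂_or_Q₄ {x : Plane} (hx : x ∈ Q₂ ∪ Q₄) (hx1 : x ∈ Metric.ball (0 : Plane) 1) :
    weight a x = a ‖x‖ := by
  have h1 : x ∉ (Q₁ ∪ Q₃) ∩ Metric.ball 0 1 := by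
    rintro ⟨h | h, -⟩ <;> rcases hx with h' | h'
    · exact lt_asymm h.1 h'.1
    · exact lt_asymm h.2 h'.2
    · exact lt_asymm h.2 h'.2
    · exact lt_asymm h.1 h'.1
  rw [weight, if_neg h1, if_pos ⟨hx, hx1⟩]

lemma weight_polarPoint_pi_div_two {r : ℝ} (hr : r ∈ Ioo (0 : ℝ) 1) {θ : ℝ}
    (hθ : θ ∈ Ioo 0 (Real.pi / 2)) : weight a (polarPoint r (θ + Real.pi / 2)) = a r := by
  have hs : 0 < Real.sin θ := Real.sin_pos_of_pos_of_lt_pi hθ.1 (by linarith [hθ.2, Real.pi_pos])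
  have hc : 0 < Real.cos θ := Real.cos_pos_of_mem_Ioo ⟨by linarith [hθ.1, Real.pi_pos], hθ.2⟩
  rw [weight_of_mem_Q₂_or_Q₄ (Or.inl ⟨?_, ?_⟩) (polarPoint_mem_ball hr _), norm_polarPoint,
    abs_of_pos hr.1]
  · rw [polarPoint_zero_coord, Real.cos_add_pi_div_two]
    nlinarith [mul_pos hr.1 hs]
  · rw [polarPoint_one_coord, Real.sin_add_pi_div_two]
    exact mul_pos hr.1 hc

lemma weight_polarPoint_three_pi_div_two {r : ℝ} (hr : r ∈ Ioo (0 : ℝ) 1) {θ : ℝ}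
    (hθ : θ ∈ Ioo 0 (Real.pi / 2)) :
    weight a (polarPoint r (θ + (Real.pi + Real.pi / 2))) = a r := by
  have hs : 0 < Real.sin θ := Real.sin_pos_of_pos_of_lt_pi hθ.1 (by linarith [hθ.2, Real.pi_pos])
  have hc : 0 < Real.cos θ := Real.cos_pos_of_mem_Ioo ⟨by linarith [hθ.1, Real.pi_pos], hθ.2⟩
  rw [← add_assoc, weight_of_mem_Q₂_or_Q₄ (Or.inr ⟨?_, ?_⟩) (polarPoint_mem_ball hr _),
    norm_polarPoint, abs_of_pos hr.1]
  · rw [polarPoint_zero_coord, Real.cos_add_pi_div_two, Real.sin_add_pi, neg_neg]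
    exact mul_pos hr.1 hs
  · rw [polarPoint_one_coord, Real.sin_add_pi_div_two, Real.cos_add_pi]
    nlinarith [mul_pos hr.1 hc]

lemma lintegral_Ioc_eq_arc (f : ℝ → ℝ≥0∞) (α : ℝ) :
    ∫⁻ θ in Ioc α (α + Real.pi / 2), f θ = ∫⁻ θ, f (θ + α) ∂arc := by
  rw [arc, restrict_Ioo_eq_restrict_Ioc,
    ← (measurePreserving_add_right volume α).setLIntegral_comp_preimage_emb
      (measurableEmbedding_addRight α) f (Ioc α (α + Real.pi / 2))]
  congr 2
  ext θ
  simp [add_comm]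

/-- An integral over a disc is bounded by the sum of the integrals over its four quadrants. -/
lemma lintegral_ball_le_sectors {F : Plane → ℝ≥0∞} (mF : Measurable F) (ε : ℝ) :
    ∫⁻ x in Metric.ball 0 ε, F x ≤
      ((∫⁻ r in Ioo (0 : ℝ) ε, ENNReal.ofReal r * ∫⁻ θ, F (polarPoint r (θ + 0)) ∂arc) +
      ∫⁻ r in Ioo (0 : ℝ) ε, ENNReal.ofReal r * ∫⁻ θ, F (polarPoint r (θ + Real.pi)) ∂arc) +
      ((∫⁻ r in Ioo (0 : ℝ) ε, ENNReal.ofReal r *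
        ∫⁻ θ, F (polarPoint r (θ + Real.pi / 2)) ∂arc) +
      ∫⁻ r in Ioo (0 : ℝ) ε, ENNReal.ofReal r *
        ∫⁻ θ, F (polarPoint r (θ + (Real.pi + Real.pi / 2))) ∂arc) := by
  have mball : MeasurableSet (Metric.ball (0 : Plane) ε) := Metric.isOpen_ball.measurableSet
  have m : ∀ α, Measurable fun r => ENNReal.ofReal r * ∫⁻ θ, F (polarPoint r (θ + α)) ∂arc :=
    fun α => ENNReal.measurable_ofReal.mul
      (measurable_comp_polarPoint_add mF α).lintegral_prod_right'
  have m2 : Measurable fun r => ENNReal.ofReal r * ∫⁻ θ, F (polarPoint r (θ + 0)) ∂arc +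
      ENNReal.ofReal r * ∫⁻ θ, F (polarPoint r (θ + Real.pi)) ∂arc := (m 0).add (m Real.pi)
  rw [← lintegral_indicator mball, lintegral_polar (mF.indicator mball) 0,
    ← lintegral_add_left (m _), ← lintegral_add_left (m _),
    ← lintegral_add_left m2, ← lintegral_indicator measurableSet_Ioi,
    ← lintegral_indicator measurableSet_Ioo]
  refine lintegral_mono fun r => ?_
  by_cases h0 : r ∈ Ioi (0 : ℝ)
  swap
  · rw [indicator_of_notMem h0]; exact zero_le
  have h0' : 0 < r := h0
  rw [indicator_of_mem h0]
  by_cases h1 : r < ε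
  · have : ∀ θ, polarPoint r θ ∈ Metric.ball (0 : Plane) ε := fun θ => by
      rw [mem_ball_zero_iff, norm_polarPoint, abs_of_pos h0']; exact h1
    simp only [indicator_of_mem (this _)]
    rw [indicator_of_mem (show r ∈ Ioo 0 ε from ⟨h0', h1⟩)]
    simp only [← mul_add]
    refine mul_le_mul_right ?_ _
    simp only [← lintegral_Ioc_eq_arc (fun θ => F (polarPoint r θ))]
    have hU : Ioc (0 : ℝ) (0 + 2 * Real.pi) ⊆ (Ioc 0 (0 + Real.pi / 2) ∪
        Ioc Real.pi (Real.pi + Real.pi / 2)) ∪ (Ioc (Real.pi / 2) (Real.pi / 2 + Real.pi / 2) ∪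
        Ioc (Real.pi + Real.pi / 2) (Real.pi + Real.pi / 2 + Real.pi / 2)) := by
      intro θ hθ
      simp only [mem_union, mem_Ioc] at hθ ⊢
      rcases le_or_gt θ (Real.pi / 2) with h2 | h2
      · left; left; constructor <;> linarith
      rcases le_or_gt θ Real.pi with h3 | h3
      · right; left; constructor <;> linarith
      rcases le_or_gt θ (Real.pi + Real.pi / 2) with h4 | h4
      · left; right; constructor <;> linarith
      · right; right; constructor <;> linarith
    exact (lintegral_mono_set hU).trans ((lintegral_union_le _ _ _).trans
      (add_le_add (lintegral_union_le _ _ _) (lintegral_union_le _ _ _)))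
  · have : ∀ θ, polarPoint r θ ∉ Metric.ball (0 : Plane) ε := fun θ => by
      rw [mem_ball_zero_iff, norm_polarPoint, abs_of_pos h0']; exact h1
    simp only [indicator_of_notMem (this _)]
    simp

/-- A quadrant on which the weight equals `b(r)`. -/
lemma lintegral_sector_weight_eq {f : Plane → ℝ≥0∞} (mf : Measurable f) {ρ : Plane → ℝ≥0∞}
    {α : ℝ} {b : ℝ → ℝ≥0∞} {ε : ℝ} (hε : ε ≤ 1)
    (hα : ∀ r ∈ Ioo (0 : ℝ) 1, ∀ θ ∈ Ioo 0 (Real.pi / 2), ρ (polarPoint r (θ + α)) = b r) :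
    ∫⁻ r in Ioo (0 : ℝ) ε, ENNReal.ofReal r *
        ∫⁻ θ, f (polarPoint r (θ + α)) * ρ (polarPoint r (θ + α)) ∂arc =
      ∫⁻ r in Ioc (0 : ℝ) ε, (∫⁻ θ, f (polarPoint r (θ + α)) ∂arc) *
        (b r * ENNReal.ofReal r) := by
  rw [← restrict_Ioo_eq_restrict_Ioc]
  refine setLIntegral_congr_fun measurableSet_Ioo fun r hr => ?_
  have : ∫⁻ θ, f (polarPoint r (θ + α)) * ρ (polarPoint r (θ + α)) ∂arc =
      ∫⁻ θ, f (polarPoint r (θ + α)) * b r ∂arc := by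
    refine setLIntegral_congr_fun measurableSet_Ioo fun θ hθ => ?_
    simp only [hα r ⟨hr.1, hr.2.trans_le hε⟩ θ hθ]
  simp only [this]
  rw [lintegral_mul_const _ (measurable_quarter mf α r)]
  ring

/-- On the quadrants where the weight is `a(r)`, a bounded function has small weighted `L²` norm
near the origin, because `a(r) / r` is integrable. -/
lemma lintegral_bounded_sector_le {f : Plane → ℝ≥0∞} {M : ℝ≥0∞} (hf : ∀ x, f x ≤ M) (α : ℝ)
    (ha : Measurable a) {ε : ℝ} :
    ∫⁻ r in Ioc (0 : ℝ) ε, (∫⁻ θ, f (polarPoint r (θ + α)) ∂arc) * (a r * ENNReal.ofReal r) ≤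
      ENNReal.ofReal (ε ^ 2) * (2 * M * ∫⁻ r in Ioc (0 : ℝ) ε, a r / ENNReal.ofReal r) := by
  have hm : Measurable fun r => a r / ENNReal.ofReal r := ha.div ENNReal.measurable_ofReal
  rw [← mul_assoc, ← lintegral_const_mul _ hm]
  refine setLIntegral_mono' measurableSet_Ioc fun r hr => ?_
  have h1 : ∫⁻ θ, f (polarPoint r (θ + α)) ∂arc ≤ 2 * M := by
    refine (lintegral_mono fun θ => hf _).trans ?_
    rw [lintegral_const, arc_univ, mul_comm]
    exact mul_le_mul_left ofReal_pi_div_two_le _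
  have hr0 : ENNReal.ofReal r ≠ 0 := by simpa using hr.1
  have h2 : a r * ENNReal.ofReal r ≤ ENNReal.ofReal (ε ^ 2) * (a r / ENNReal.ofReal r) := by
    have h3 : a r * ENNReal.ofReal r =
        ENNReal.ofReal (r ^ 2) * (a r / ENNReal.ofReal r) := by
      rw [ENNReal.ofReal_pow hr.1.le, sq, mul_assoc,
        ENNReal.mul_div_cancel hr0 ENNReal.ofReal_ne_top, mul_comm]
    rw [h3]
    exact mul_le_mul_left (ENNReal.ofReal_le_ofReal (pow_le_pow_left₀ hr.1.le hr.2 2)) _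
  calc _ ≤ 2 * M * (ENNReal.ofReal (ε ^ 2) * (a r / ENNReal.ofReal r)) := mul_le_mul' h1 h2
    _ = _ := by ring

lemma mul_pow_two_inv_cancel {ε : ℝ} (hε : 0 < ε) :
    (ENNReal.ofReal (ε ^ 2))⁻¹ * ENNReal.ofReal (ε ^ 2) = 1 :=
  ENNReal.inv_mul_cancel (by simpa using hε.ne') ENNReal.ofReal_ne_top

/-- A bounded function `w` that is dominated by a function `v` whose quarter means tend to `0`
has weighted `L²` norm `o(ε)` on discs of radius `ε`. This is what is needed to cut `w` off near the
origin. -/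
lemma tendsto_lintegral_ball_zero (ha : Measurable a)
    (ha0 : ∀ r ∈ Ioc (0 : ℝ) 1, a r ≠ 0 ∧ a r ≠ ∞)
    (h_int : ∫⁻ r in Ioc (0 : ℝ) 1, a r / ENNReal.ofReal r < ∞)
    (h_rank : ∃ K : ℝ≥0, 0 < K ∧ ∀ ε ∈ Ioo (0 : ℝ) 1,
      (ENNReal.ofReal (ε ^ 2))⁻¹ *
        (∫⁻ r in Ioc (0 : ℝ) ε, (a r)⁻¹ * ENNReal.ofReal r *
          (∫⁻ s in Ioc (0 : ℝ) r, a s / ENNReal.ofReal s)) < K)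
    {v w : Plane → ℝ} {g : Plane → Plane} (mg : Measurable g) (mw : Measurable w)
    (hE : ∫⁻ x, ‖g x‖ₑ ^ 2 * weight a x < ∞)
    (hint : ∀ α r, 0 < r → Integrable (fun θ => v (polarPoint r (θ + α))) arc)
    (hosc : ∀ α, HasQuarterOscillationBound v g α)
    (hL₀ : ∀ r, 0 < r → ‖quarterMean v 0 r‖ₑ ≤ ∫⁻ s in Ioc (0 : ℝ) r, quarterNorm g 0 s)
    (hL₁ : ∀ r, 0 < r → ‖quarterMean v Real.pi r‖ₑ ≤
      ∫⁻ s in Ioc (0 : ℝ) r, quarterNorm g Real.pi s)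
    (hwv : ∀ x, ‖w x‖ₑ ≤ ‖v x‖ₑ) {N : ℝ≥0∞} (hN : N ≠ ∞) (hwN : ∀ x, ‖w x‖ₑ ≤ N) :
    Tendsto (fun ε => (ENNReal.ofReal (ε ^ 2))⁻¹ *
      ∫⁻ x in Metric.ball 0 ε, ‖w x‖ₑ ^ 2 * weight a x) (𝓝[>] 0) (𝓝 0) := by
  obtain ⟨K, -, hK⟩ := h_rank
  have mρ := measurable_weight ha
  set A : ℝ → ℝ≥0∞ := fun r => ∫⁻ s in Ioc (0 : ℝ) r, a s / ENNReal.ofReal s with hA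
  have tA : Tendsto A (𝓝[>] 0) (𝓝 0) := tendsto_lintegral_Ioc_zero h_int
  have tD : ∀ α, (∀ r ∈ Ioo (0 : ℝ) 1, ∀ θ ∈ Ioo 0 (Real.pi / 2),
      weight a (polarPoint r (θ + α)) = (a r)⁻¹) →
      Tendsto (sectorEnergy a g α) (𝓝[>] 0) (𝓝 0) := fun α hα =>
    tendsto_lintegral_Ioc_zero ((sectorEnergy_one_le mg mρ hα).trans_lt
      (ENNReal.mul_lt_top (by simp) hE))
  have tD₀ := tD 0 fun r hr θ hθ => weight_polarPoint_zero hr hθ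
  have tD₁ := tD Real.pi fun r hr θ hθ => weight_polarPoint_pi hr hθ
  set B : ℝ → ℝ≥0∞ := fun ε => (4 * sectorEnergy a g 0 ε * (K + 1) +
    4 * sectorEnergy a g Real.pi ε * (K + 1)) + (2 * N ^ 2 * A ε + 2 * N ^ 2 * A ε) with hB
  have tB : Tendsto B (𝓝[>] 0) (𝓝 0) := by
    have c1 : ∀ D : ℝ → ℝ≥0∞, Tendsto D (𝓝[>] 0) (𝓝 0) →
        Tendsto (fun ε => 4 * D ε * (K + 1)) (𝓝[>] 0) (𝓝 0) := fun D hD => by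
      have := ENNReal.Tendsto.mul_const (ENNReal.Tendsto.const_mul hD
        (Or.inr (by simp : (4 : ℝ≥0∞) ≠ ∞)))
        (Or.inr (by simp : ((K : ℝ≥0∞) + 1) ≠ ∞))
      simpa using this
    have c2 : Tendsto (fun ε => 2 * N ^ 2 * A ε) (𝓝[>] 0) (𝓝 0) := by
      have := ENNReal.Tendsto.const_mul tA
        (Or.inr (ENNReal.mul_ne_top (by simp) (ENNReal.pow_ne_top hN) : (2 * N ^ 2) ≠ ∞))
      simpa using this
    have := ((c1 _ tD₀).add (c1 _ tD₁)).add (c2.add c2)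
    simpa using this
  refine tendsto_of_tendsto_of_tendsto_of_le_of_le' tendsto_const_nhds tB
    (Eventually.of_forall fun _ => zero_le) ?_
  filter_upwards [Ioo_mem_nhdsGT (one_pos : (0 : ℝ) < 1)] with ε hε
  have mf : Measurable fun x => ‖w x‖ₑ ^ 2 := mw.enorm.pow_const 2
  have hfv : ∀ α r, ∫⁻ θ, ‖w (polarPoint r (θ + α))‖ₑ ^ 2 ∂arc ≤
      ∫⁻ θ, ‖v (polarPoint r (θ + α))‖ₑ ^ 2 ∂arc := fun α r =>
    lintegral_mono fun θ => pow_le_pow_left' (hwv _) 2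
  have hKε : (∫⁻ r in Ioc (0 : ℝ) ε, (a r)⁻¹ * ENNReal.ofReal r * A r) +
      ENNReal.ofReal (ε ^ 2) ≤ ENNReal.ofReal (ε ^ 2) * (K + 1) := by
    rw [mul_add, mul_one]
    refine add_le_add ?_ le_rfl
    have h1 := mul_le_mul_right (hK ε hε).le (ENNReal.ofReal (ε ^ 2))
    rwa [← mul_assoc, mul_comm (ENNReal.ofReal (ε ^ 2)) _, mul_pow_two_inv_cancel hε.1,
      one_mul] at h1
  have s1 : ∀ α, (∀ r ∈ Ioo (0 : ℝ) 1, ∀ θ ∈ Ioo 0 (Real.pi / 2),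
      weight a (polarPoint r (θ + α)) = (a r)⁻¹) →
      (∀ r, 0 < r → ‖quarterMean v α r‖ₑ ≤ ∫⁻ s in Ioc (0 : ℝ) r, quarterNorm g α s) →
      ∫⁻ r in Ioo (0 : ℝ) ε, ENNReal.ofReal r * ∫⁻ θ, ‖w (polarPoint r (θ + α))‖ₑ ^ 2 *
        weight a (polarPoint r (θ + α)) ∂arc ≤
      ENNReal.ofReal (ε ^ 2) * (4 * sectorEnergy a g α ε * (K + 1)) := fun α hα hL => by
    rw [lintegral_sector_weight_eq mf hε.2.le hα]
    refine (lintegral_mono fun r => mul_le_mul_left (hfv α r) _).trans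
      ((lintegral_sector_sq_le ha ha0 mg (hint α) (hosc α) hL hε.2.le).trans
      ((mul_le_mul_right hKε _).trans (le_of_eq ?_)))
    ring
  have s2 : ∀ α, (∀ r ∈ Ioo (0 : ℝ) 1, ∀ θ ∈ Ioo 0 (Real.pi / 2),
      weight a (polarPoint r (θ + α)) = a r) →
      ∫⁻ r in Ioo (0 : ℝ) ε, ENNReal.ofReal r * ∫⁻ θ, ‖w (polarPoint r (θ + α))‖ₑ ^ 2 *
        weight a (polarPoint r (θ + α)) ∂arc ≤
      ENNReal.ofReal (ε ^ 2) * (2 * N ^ 2 * A ε) := fun α hα => by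
    rw [lintegral_sector_weight_eq mf hε.2.le hα]
    exact lintegral_bounded_sector_le (f := fun x => ‖w x‖ₑ ^ 2)
      (fun x => pow_le_pow_left' (hwN x) 2) α ha
  have total : ∫⁻ x in Metric.ball 0 ε, ‖w x‖ₑ ^ 2 * weight a x ≤
      ENNReal.ofReal (ε ^ 2) * B ε := by
    refine (lintegral_ball_le_sectors (mf.mul mρ) ε).trans ?_
    simp only [hB, mul_add (ENNReal.ofReal (ε ^ 2))]
    exact add_le_add
      (add_le_add (s1 0 (fun r hr θ hθ => weight_polarPoint_zero hr hθ) hL₀)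
        (s1 Real.pi (fun r hr θ hθ => weight_polarPoint_pi hr hθ) hL₁))
      (add_le_add (s2 _ fun r hr θ hθ => weight_polarPoint_pi_div_two hr hθ)
        (s2 _ fun r hr θ hθ => weight_polarPoint_three_pi_div_two hr hθ))
  refine (mul_le_mul_right total _).trans (le_of_eq ?_)
  rw [← mul_assoc, mul_pow_two_inv_cancel hε.1, one_mul]

end WeightedPlane

/-! ### Cutting off near the origin and at infinity -/

namespace WeightedPlane

/-- A fixed bump function, equal to `1` for `‖x‖ ≤ 1 / 4` and to `0` for `‖x‖ ≥ 1 / 2`. -/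
noncomputable def bump : ContDiffBump (0 : Plane) := ⟨1 / 4, 1 / 2, by norm_num, by norm_num⟩

/-- The cut-off function that vanishes for `‖x‖ ≤ ε / 4` and for `‖x‖ ≥ 1 / (2 ε)`, and equals `1`
for `ε / 2 ≤ ‖x‖ ≤ 1 / (4 ε)`. -/
noncomputable def cutoff (ε : ℝ) (x : Plane) : ℝ := bump (ε • x) - bump (ε⁻¹ • x)

lemma bump_mem_testFunctions : (bump : Plane → ℝ) ∈ testFunctions :=
  ⟨bump.contDiff, bump.hasCompactSupport⟩

lemma bump_comp_smul_mem_testFunctions {c : ℝ} (hc : c ≠ 0) :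
    (fun x : Plane => bump (c • x)) ∈ testFunctions :=
  ⟨bump.contDiff.comp (contDiff_const_smul c), bump.hasCompactSupport.comp_smul hc⟩

lemma cutoff_mem_testFunctions {ε : ℝ} (hε : 0 < ε) : cutoff ε ∈ testFunctions :=
  testFunctions.sub (bump_comp_smul_mem_testFunctions hε.ne')
    (bump_comp_smul_mem_testFunctions (inv_ne_zero hε.ne'))

lemma bump_eq_one {x : Plane} (hx : ‖x‖ ≤ 1 / 4) : bump x = 1 :=
  bump.one_of_mem_closedBall (by simpa [bump] using hx)

lemma bump_eq_zero {x : Plane} (hx : 1 / 2 ≤ ‖x‖) : bump x = 0 :=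
  bump.zero_of_le_dist (by simpa [bump] using hx)

lemma zero_notMem_tsupport_cutoff (ε : ℝ) : (0 : Plane) ∉ tsupport (cutoff ε) := by
  rw [notMem_tsupport_iff_eventuallyEq]
  have h : ∀ c : ℝ, ∀ᶠ x : Plane in 𝓝 0, ‖c • x‖ ≤ 1 / 4 := fun c => by
    have : Tendsto (fun x : Plane => ‖c • x‖) (𝓝 0) (𝓝 0) := by
      have := ((continuous_const_smul c).norm : Continuous fun x : Plane => ‖c • x‖).tendsto 0
      simpa using this
    exact this.eventually (Iic_mem_nhds (by norm_num))
  filter_upwards [h ε, h ε⁻¹] with x h1 h2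
  simp [cutoff, bump_eq_one h1, bump_eq_one h2]

lemma abs_one_sub_cutoff_le (ε : ℝ) (x : Plane) : ‖1 - cutoff ε x‖ₑ ≤ 2 := by
  have h : ‖1 - cutoff ε x‖ ≤ 2 := by
    rw [Real.norm_eq_abs, abs_le, cutoff]
    have h1 := bump.nonneg (x := ε • x)
    have h2 := bump.le_one (x := ε • x)
    have h3 := bump.nonneg (x := ε⁻¹ • x)
    have h4 := bump.le_one (x := ε⁻¹ • x)
    constructor <;> linarith
  rw [← ofReal_norm, ← ENNReal.ofReal_ofNat]
  exact ENNReal.ofReal_le_ofReal h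

lemma tendsto_one_sub_cutoff {x : Plane} (hx : x ≠ 0) :
    Tendsto (fun ε => 1 - cutoff ε x) (𝓝[>] 0) (𝓝 0) := by
  have hx' : 0 < ‖x‖ := norm_pos_iff.2 hx
  have hδ : 0 < min ‖x‖ (‖x‖⁻¹ / 4) := lt_min hx' (by positivity)
  refine tendsto_const_nhds.congr' ?_
  filter_upwards [Ioo_mem_nhdsGT hδ] with ε hε
  have h1 : ε < ‖x‖ := hε.2.trans_le (min_le_left _ _)
  have h2 : ε < ‖x‖⁻¹ / 4 := hε.2.trans_le (min_le_right _ _)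
  have e1 : bump (ε • x) = 1 := bump_eq_one (by
    rw [norm_smul, Real.norm_of_nonneg hε.1.le]
    calc ε * ‖x‖ ≤ ‖x‖⁻¹ / 4 * ‖x‖ := by gcongr
      _ = 1 / 4 := by field_simp)
  have e2 : bump (ε⁻¹ • x) = 0 := bump_eq_zero (by
    rw [norm_smul, norm_inv, Real.norm_of_nonneg hε.1.le]
    calc (1 / 2 : ℝ) ≤ 1 := by norm_num
      _ = ε⁻¹ * ε := by rw [inv_mul_cancel₀ hε.1.ne']
      _ ≤ ε⁻¹ * ‖x‖ := by have := hε.1; gcongr)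
  rw [cutoff, e1, e2]
  norm_num

lemma exists_gradient_bump_bound : ∃ C : ℝ≥0, ∀ x, ‖gradient bump x‖ₑ ≤ C := by
  have h1 : HasCompactSupport (gradient (bump : Plane → ℝ)) :=
    HasCompactSupport.intro bump.hasCompactSupport.isCompact
      fun x hx => gradient_eq_zero_of_notMem_tsupport hx
  obtain ⟨C, hC⟩ := h1.exists_bound_of_continuous
    (continuous_gradient (testFunctions.contDiff_one bump_mem_testFunctions))
  refine ⟨C.toNNReal, fun x => ?_⟩
  rw [← ofReal_norm]
  exact ENNReal.ofReal_le_ofReal (hC x)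

lemma gradient_bump_comp_smul (c : ℝ) (x : Plane) :
    gradient (fun y : Plane => bump (c • y)) x = c • gradient bump (c • x) := by
  rw [gradient, fderiv_comp_smul, gradient, map_smulₛₗ]
  simp

lemma enorm_sq_eq_ofReal (c : ℝ) : ‖c‖ₑ ^ 2 = ENNReal.ofReal (c ^ 2) := by
  rw [← ofReal_norm, ← ENNReal.ofReal_pow (norm_nonneg _), Real.norm_eq_abs, sq_abs]

lemma enorm_gradient_cutoff_sq_le {C : ℝ≥0} (hC : ∀ x, ‖gradient bump x‖ₑ ≤ C) {ε : ℝ}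
    (hε : 0 < ε) (x : Plane) :
    ‖gradient (cutoff ε) x‖ₑ ^ 2 ≤ 2 * (C : ℝ≥0∞) ^ 2 * ENNReal.ofReal (ε ^ 2) +
      2 * (C : ℝ≥0∞) ^ 2 * (ENNReal.ofReal (ε ^ 2))⁻¹ *
        (Metric.ball (0 : Plane) ε).indicator 1 x := by
  have hd : ∀ {c : ℝ}, c ≠ 0 → DifferentiableAt ℝ (fun y : Plane => bump (c • y)) x := fun hc =>
    (testFunctions.contDiff_one (bump_comp_smul_mem_testFunctions hc)).differentiable one_ne_zero x
  have e1 : gradient (cutoff ε) x = ε • gradient bump (ε • x) - ε⁻¹ • gradient bump (ε⁻¹ • x) := by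
    rw [← gradient_bump_comp_smul, ← gradient_bump_comp_smul,
      ← gradient_sub' (hd hε.ne') (hd (inv_ne_zero hε.ne'))]
    rfl
  have hi : ‖ε⁻¹‖ₑ ^ 2 = (ENNReal.ofReal (ε ^ 2))⁻¹ := by
    rw [enorm_sq_eq_ofReal, inv_pow, ENNReal.ofReal_inv_of_pos (by positivity)]
  rw [e1]
  refine (enorm_sub_sq_le _ _).trans (add_le_add ?_ ?_)
  · rw [enorm_smul, mul_pow, enorm_sq_eq_ofReal, mul_assoc, mul_comm (ENNReal.ofReal _)]
    gcongr
    exact hC _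
  · by_cases hx : x ∈ Metric.ball (0 : Plane) ε
    · rw [indicator_of_mem hx, enorm_smul, mul_pow, hi, Pi.one_apply, mul_one, mul_assoc,
        mul_comm (ENNReal.ofReal _)⁻¹]
      gcongr
      exact hC _
    · have hn : ε ≤ ‖x‖ := by simpa using hx
      have h0 : gradient bump (ε⁻¹ • x) = 0 := by
        refine gradient_eq_zero_of_notMem_tsupport ?_
        rw [bump.tsupport_eq, Metric.mem_closedBall, dist_zero_right, norm_smul, norm_inv,
          Real.norm_of_nonneg hε.le, not_le]
        calc bump.rOut < 1 := by norm_num [bump]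
          _ = ε⁻¹ * ε := by rw [inv_mul_cancel₀ hε.ne']
          _ ≤ ε⁻¹ * ‖x‖ := by gcongr
      rw [h0]
      simp

/-- If the weighted `L²` norm of `w` on the disc of radius `ε` is `o(ε)`, then the cut-offs of `w`
converge to `w` in energy. -/
lemma tendsto_energyOne_sub_cutoff {ρ : Plane → ℝ≥0∞} (hρ : Measurable ρ) {w : Plane → ℝ}
    {h : Plane → Plane} (hw : HasWeakGradient w h) (mw : Measurable w) (mh : Measurable h)
    (hE : (∫⁻ x, ‖h x‖ₑ ^ 2 * ρ x) + ∫⁻ x, ‖w x‖ₑ ^ 2 * ρ x < ∞)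
    (hvan : Tendsto (fun ε => (ENNReal.ofReal (ε ^ 2))⁻¹ *
      ∫⁻ x in Metric.ball 0 ε, ‖w x‖ₑ ^ 2 * ρ x) (𝓝[>] 0) (𝓝 0)) :
    Tendsto (fun ε => energyOne ρ (w - fun x => cutoff ε x * w x)) (𝓝[>] 0) (𝓝 0) := by
  obtain ⟨C, hC⟩ := exists_gradient_bump_bound
  obtain ⟨hE1, hE2⟩ := ENNReal.add_lt_top.1 hE
  have mcut : ∀ ε, Measurable (cutoff ε) := fun ε =>
    ((bump.continuous.comp (continuous_const_smul ε)).sub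
      (bump.continuous.comp (continuous_const_smul ε⁻¹))).measurable
  have mwρ : Measurable fun x => ‖w x‖ₑ ^ 2 * ρ x := (mw.enorm.pow_const 2).mul hρ
  have mhρ : Measurable fun x => ‖h x‖ₑ ^ 2 * ρ x := (mh.enorm.pow_const 2).mul hρ
  have dct : ∀ f : Plane → ℝ≥0∞, Measurable f → ∫⁻ x, f x < ∞ →
      Tendsto (fun ε => ∫⁻ x, ‖1 - cutoff ε x‖ₑ ^ 2 * f x) (𝓝[>] 0) (𝓝 0) := by
    intro f mf hf
    have e0 : (0 : ℝ≥0∞) = ∫⁻ _ : Plane, 0 := by simp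
    rw [e0]
    refine tendsto_lintegral_filter_of_dominated_convergence (fun x => 4 * f x)
      (Eventually.of_forall fun ε => ((measurable_const.sub (mcut ε)).enorm.pow_const 2).mul mf)
      (Eventually.of_forall fun ε => ae_of_all _ fun x => ?_) ?_ ?_
    · refine mul_le_mul_left ((pow_le_pow_left' (abs_one_sub_cutoff_le ε x) 2).trans ?_) _
      norm_num
    · rw [lintegral_const_mul _ mf]
      exact (ENNReal.mul_lt_top (by simp) hf).ne
    · filter_upwards [ae_lt_top mf hf.ne, Measure.ae_ne volume (0 : Plane)] with x hx hx0
      have t1 := (continuous_enorm.tendsto _).comp (tendsto_one_sub_cutoff hx0)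
      rw [enorm_zero] at t1
      have t2 := ENNReal.Tendsto.mul_const (ENNReal.Tendsto.pow (n := 2) t1) (Or.inr hx.ne)
      simpa using t2
  have tI := dct _ mhρ hE1
  have tII := dct _ mwρ hE2
  set W := ∫⁻ x, ‖w x‖ₑ ^ 2 * ρ x with hW
  have t0 : Tendsto (fun ε : ℝ => ENNReal.ofReal (ε ^ 2)) (𝓝[>] 0) (𝓝 0) := by
    have h1 : Continuous fun ε : ℝ => ENNReal.ofReal (ε ^ 2) :=
      ENNReal.continuous_ofReal.comp (continuous_pow 2)
    have := (h1.tendsto 0).mono_left (nhdsWithin_le_nhds (s := Ioi (0 : ℝ)))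
    simpa using this
  have tIII : Tendsto (fun ε : ℝ => 2 * (C : ℝ≥0∞) ^ 2 * (ENNReal.ofReal (ε ^ 2) * W +
      (ENNReal.ofReal (ε ^ 2))⁻¹ * ∫⁻ x in Metric.ball 0 ε, ‖w x‖ₑ ^ 2 * ρ x))
      (𝓝[>] 0) (𝓝 0) := by
    have h1 := (ENNReal.Tendsto.mul_const t0 (Or.inr hE2.ne)).add hvan
    have h2 := ENNReal.Tendsto.const_mul h1 (Or.inr (by
      exact ENNReal.mul_ne_top (by simp) (by simp) : (2 * (C : ℝ≥0∞) ^ 2) ≠ ∞))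
    simpa using h2
  have tot := ((ENNReal.Tendsto.const_mul tI (Or.inr (by simp : (2 : ℝ≥0∞) ≠ ∞))).add
    (ENNReal.Tendsto.const_mul tIII (Or.inr (by simp : (2 : ℝ≥0∞) ≠ ∞)))).add tII
  simp only [mul_zero, add_zero] at tot
  refine tendsto_of_tendsto_of_tendsto_of_le_of_le' tendsto_const_nhds tot
    (Eventually.of_forall fun _ => zero_le) ?_
  filter_upwards [self_mem_nhdsWithin] with ε hε
  have hε0 : 0 < ε := hε
  have hz := hw.sub (hw.mul_left (cutoff_mem_testFunctions hε0).1)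
  rw [energyOne_eq hz]
  have mc : Measurable fun x => ‖1 - cutoff ε x‖ₑ ^ 2 :=
    (measurable_const.sub (mcut ε)).enorm.pow_const 2
  have mball : MeasurableSet (Metric.ball (0 : Plane) ε) := Metric.isOpen_ball.measurableSet
  refine add_le_add ?_ (le_of_eq ?_)
  · calc _ ≤ ∫⁻ x, (2 * (‖1 - cutoff ε x‖ₑ ^ 2 * (‖h x‖ₑ ^ 2 * ρ x)) +
          2 * (2 * (C : ℝ≥0∞) ^ 2 * (ENNReal.ofReal (ε ^ 2) * (‖w x‖ₑ ^ 2 * ρ x) +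
            (ENNReal.ofReal (ε ^ 2))⁻¹ * (Metric.ball (0 : Plane) ε).indicator
              (fun x => ‖w x‖ₑ ^ 2 * ρ x) x))) := by
          refine lintegral_mono fun x => ?_
          have e1 : (h - fun x => cutoff ε x • h x + w x • gradient (cutoff ε) x) x =
              (1 - cutoff ε x) • h x - w x • gradient (cutoff ε) x := by
            simp only [Pi.sub_apply, sub_smul, one_smul]
            abel
          rw [e1]
          refine (mul_le_mul_left (enorm_sub_sq_le _ _) _).trans ?_
          rw [add_mul, enorm_smul, enorm_smul, mul_pow, mul_pow]
          refine add_le_add (le_of_eq (by ring)) ?_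
          have e2 : (Metric.ball (0 : Plane) ε).indicator (fun x => ‖w x‖ₑ ^ 2 * ρ x) x =
              (Metric.ball (0 : Plane) ε).indicator 1 x * (‖w x‖ₑ ^ 2 * ρ x) := by
            by_cases hx : x ∈ Metric.ball (0 : Plane) ε <;> simp [hx]
          rw [e2]
          calc 2 * (‖w x‖ₑ ^ 2 * ‖gradient (cutoff ε) x‖ₑ ^ 2) * ρ x
              ≤ 2 * (‖w x‖ₑ ^ 2 * (2 * (C : ℝ≥0∞) ^ 2 * ENNReal.ofReal (ε ^ 2) +
                2 * (C : ℝ≥0∞) ^ 2 * (ENNReal.ofReal (ε ^ 2))⁻¹ *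
                (Metric.ball (0 : Plane) ε).indicator 1 x)) * ρ x := by
                gcongr
                exact enorm_gradient_cutoff_sq_le hC hε0 x
            _ = _ := by ring
      _ = _ := by
          have m1 : Measurable fun x => ‖1 - cutoff ε x‖ₑ ^ 2 * (‖h x‖ₑ ^ 2 * ρ x) := mc.mul mhρ
          have m2 := mwρ.const_mul (ENNReal.ofReal (ε ^ 2))
          have m3 := (mwρ.indicator mball).const_mul (ENNReal.ofReal (ε ^ 2))⁻¹
          have m23 : Measurable fun x => ENNReal.ofReal (ε ^ 2) * (‖w x‖ₑ ^ 2 * ρ x) +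
              (ENNReal.ofReal (ε ^ 2))⁻¹ * (Metric.ball (0 : Plane) ε).indicator
                (fun x => ‖w x‖ₑ ^ 2 * ρ x) x := m2.add m3
          rw [lintegral_add_left (m1.const_mul 2), lintegral_const_mul _ m1,
            lintegral_const_mul _ (m23.const_mul _), lintegral_const_mul _ m23,
            lintegral_add_left m2, lintegral_const_mul _ mwρ,
            lintegral_const_mul _ (mwρ.indicator mball), lintegral_indicator mball]
  · refine lintegral_congr fun x => ?_
    have e1 : (w - fun x => cutoff ε x * w x) x = (1 - cutoff ε x) * w x := by
      simp only [Pi.sub_apply]; ring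
    rw [e1, enorm_mul]
    ring

end WeightedPlane

/-! ### Density of test functions vanishing near the origin -/

namespace WeightedPlane

lemma eLpNorm_two_sq {E : Type*} [NormedAddCommGroup E] (f : Plane → E) :
    eLpNorm f 2 ^ 2 = ∫⁻ x, ‖f x‖ₑ ^ 2 := by
  have h := eLpNorm_nnreal_pow_eq_lintegral (f := f) (μ := volume) (p := 2) two_ne_zero
  simpa only [NNReal.coe_ofNat, ENNReal.coe_ofNat, ENNReal.rpow_ofNat] using h

lemma energyOne_congr_ae {u v : Plane → ℝ} (hu : u ∈ W11loc) (h : u =ᵐ[volume] v)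
    (ρ : Plane → ℝ≥0∞) : energyOne ρ u = energyOne ρ v := by
  obtain ⟨g, hg⟩ := hu
  rw [energyOne_eq hg, energyOne_eq (hg.congr_fun_ae h)]
  congr 1
  refine lintegral_congr_ae ?_
  filter_upwards [h] with x hx
  rw [hx]

lemma energyOne_sub_triangle {u w φ : Plane → ℝ} (hu : u ∈ W11loc) (hw : w ∈ W11loc)
    (hφ : φ ∈ W11loc) {ρ : Plane → ℝ≥0∞} (hρ : Measurable ρ) :
    energyOne ρ (u - φ) ≤ 2 * energyOne ρ (u - w) + 2 * energyOne ρ (w - φ) := by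
  obtain ⟨g, hg⟩ := hu
  obtain ⟨h, hh⟩ := hw
  obtain ⟨k, hk⟩ := hφ
  have h1 := energyOne_sub_le ⟨_, hg.sub hh⟩ ⟨_, hk.sub hh⟩ hρ
  have h2 : energyOne ρ (φ - w) = energyOne ρ (w - φ) := by
    rw [energyOne_eq (hk.sub hh), energyOne_eq (hh.sub hk)]
    simp only [Pi.sub_apply, enorm_sub_rev]
  rwa [sub_sub_sub_cancel_right, h2] at h1

lemma exists_pos_mul_sq_lt {C ε : ℝ≥0∞} (hC : C ≠ ∞) (hε : 0 < ε) :
    ∃ η : ℝ≥0∞, 0 < η ∧ C * (η ^ 2 + η ^ 2) < ε := by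
  have h1 : Tendsto (fun η : ℝ≥0∞ => C * (η ^ 2 + η ^ 2)) (𝓝[>] 0) (𝓝 0) := by
    have h2 : Tendsto (fun η : ℝ≥0∞ => η ^ 2) (𝓝[>] 0) (𝓝 0) := by
      have := (ENNReal.continuous_pow 2).tendsto 0
      simpa using this.mono_left nhdsWithin_le_nhds
    have := ENNReal.Tendsto.const_mul (h2.add h2) (Or.inr hC)
    simpa using this
  obtain ⟨η, h3, h4⟩ := ((h1.eventually (gt_mem_nhds hε)).and self_mem_nhdsWithin).exists
  exact ⟨η, h4, h3⟩

/-- Functions of finite energy supported away from the origin are limits of test functions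
supported away from the origin, since the weight is bounded above and below there. -/
lemma exists_puncturedTestFunction_of_support {ρ : Plane → ℝ≥0∞} (hρ : Measurable ρ)
    (hb : ∀ δ : ℝ, 0 < δ → ∃ c : ℝ≥0, 0 < c ∧ ∀ x : Plane, δ < ‖x‖ →
      (c : ℝ≥0∞) ≤ ρ x ∧ ρ x ≤ (c : ℝ≥0∞)⁻¹) {z : Plane → ℝ} {k : Plane → Plane}
    (hz : HasWeakGradient z k) (hE : energyOne ρ z < ∞) {K : Set Plane} (hK : IsCompact K)
    (h0 : (0 : Plane) ∉ K) (hzK : tsupport z ⊆ K) (hkK : ∀ x, x ∉ K → k x = 0) {ε : ℝ≥0∞}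
    (hε : 0 < ε) :
    ∃ φ ∈ puncturedTestFunctions ∩ spaceW ρ, energyOne ρ (z - φ) < ε := by
  obtain ⟨η, hη, hηK⟩ := Metric.mem_nhds_iff.1 (hK.isClosed.isOpen_compl.mem_nhds h0)
  have hnorm : ∀ x ∈ K, η ≤ ‖x‖ := fun x hx => by
    by_contra hlt
    exact hηK (mem_ball_zero_iff.2 (not_le.1 hlt)) hx
  have hthick : ∀ x ∈ Metric.cthickening (η / 3) K, η / 3 < ‖x‖ := fun x hx => by
    rw [hK.cthickening_eq_biUnion_closedBall (by positivity)] at hx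
    obtain ⟨y, hy, hxy⟩ := mem_iUnion₂.1 hx
    have h1 := hnorm y hy
    have h2 : ‖y‖ ≤ ‖x‖ + dist x y := by
      rw [dist_eq_norm, ← norm_neg (x - y), neg_sub]
      have := norm_add_le x (y - x)
      rwa [add_sub_cancel] at this
    have h3 : dist x y ≤ η / 3 := hxy
    linarith
  have hKt : K ⊆ Metric.cthickening (η / 3) K := Metric.self_subset_cthickening K
  obtain ⟨c, hc, hcb⟩ := hb (η / 3) (by positivity)
  have hc0 : (c : ℝ≥0∞) ≠ 0 := by exact_mod_cast hc.ne'
  -- on the support, `L²` norms and weighted `L²` norms control each other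
  have low : ∀ {E : Type} [NormedAddCommGroup E] (f : Plane → E), (∀ x, x ∉ K → f x = 0) →
      ∫⁻ x, ‖f x‖ₑ ^ 2 * ρ x < ∞ → eLpNorm f 2 < ∞ := by
    intro E _ f hf hfE
    have h1 : ∫⁻ x, ‖f x‖ₑ ^ 2 ≤ (c : ℝ≥0∞)⁻¹ * ∫⁻ x, ‖f x‖ₑ ^ 2 * ρ x := by
      rw [← lintegral_const_mul' _ _ (ENNReal.inv_ne_top.2 hc0)]
      refine lintegral_mono fun x => ?_
      by_cases hx : x ∈ K
      · calc ‖f x‖ₑ ^ 2 = (c : ℝ≥0∞)⁻¹ * (‖f x‖ₑ ^ 2 * c) := by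
              rw [mul_left_comm, ENNReal.inv_mul_cancel hc0 ENNReal.coe_ne_top, mul_one]
          _ ≤ _ := by gcongr; exact (hcb x (hthick x (hKt hx))).1
      · simp [hf x hx]
    have h2 : eLpNorm f 2 ^ 2 < ∞ := by
      rw [eLpNorm_two_sq]
      exact h1.trans_lt (ENNReal.mul_lt_top (ENNReal.inv_lt_top.2 (pos_iff_ne_zero.2 hc0)) hfE)
    exact (ENNReal.pow_lt_top_iff).1 h2 |>.resolve_right two_ne_zero
  have up : ∀ {E : Type} [NormedAddCommGroup E] (f : Plane → E),
      (∀ x, x ∉ Metric.cthickening (η / 3) K → f x = 0) →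
      ∫⁻ x, ‖f x‖ₑ ^ 2 * ρ x ≤ (c : ℝ≥0∞)⁻¹ * eLpNorm f 2 ^ 2 := by
    intro E _ f hf
    rw [eLpNorm_two_sq, ← lintegral_const_mul' _ _ (ENNReal.inv_ne_top.2 hc0)]
    refine lintegral_mono fun x => ?_
    by_cases hx : x ∈ Metric.cthickening (η / 3) K
    · rw [mul_comm]
      gcongr
      exact (hcb x (hthick x hx)).2
    · simp [hf x hx]
  have hzsub : ∀ x, x ∉ K → z x = 0 := fun x hx =>
    image_eq_zero_of_notMem_tsupport fun h => hx (hzK h)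
  have hEz := hE
  rw [energyOne_eq hz] at hEz
  obtain ⟨hE1, hE2⟩ := ENNReal.add_lt_top.1 hEz
  obtain ⟨κ, hκ, hκε⟩ := exists_pos_mul_sq_lt (ENNReal.inv_ne_top.2 hc0) hε
  obtain ⟨φ, hφ, hφs, h1, h2⟩ := hz.exists_testFunction_approx one_le_two (by simp)
    ⟨hz.1.aestronglyMeasurable, low z hzsub hE2⟩ ⟨hz.2.aestronglyMeasurable, low k hkK hE1⟩
    (hK.of_isClosed_subset (isClosed_tsupport z) hzK) hκ (show 0 < η / 3 by positivity)
  have hφs' : tsupport φ ⊆ Metric.cthickening (η / 3) K :=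
    hφs.trans (Metric.cthickening_subset_of_subset _ hzK)
  have hsub := hz.sub (.of_contDiff (testFunctions.contDiff_one hφ))
  have hlt : energyOne ρ (z - φ) < ε := by
    rw [energyOne_eq hsub]
    refine lt_of_le_of_lt ?_ hκε
    rw [mul_add]
    refine add_le_add ((up _ fun x hx => ?_).trans ?_) ((up _ fun x hx => ?_).trans ?_)
    · rw [Pi.sub_apply, hkK x fun h => hx (hKt h),
        gradient_eq_zero_of_notMem_tsupport fun h => hx (hφs' h), sub_zero]
    · rw [eLpNorm_sub_comm]
      gcongr
      exact h2
    · rw [Pi.sub_apply, hzsub x fun h => hx (hKt h),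
        image_eq_zero_of_notMem_tsupport fun h => hx (hφs' h), sub_zero]
    · rw [eLpNorm_sub_comm]
      gcongr
      exact h1
  refine ⟨φ, ⟨⟨hφ, fun h => ?_⟩, ?_⟩, hlt⟩
  · have := hthick 0 (hφs' h)
    rw [norm_zero] at this
    linarith
  · refine ⟨testFunctions_subset_W11loc hφ, ?_⟩
    have h3 := energyOne_sub_le ⟨k, hz⟩ ⟨_, hsub⟩ hρ
    rw [sub_sub_cancel] at h3
    refine h3.trans_lt (ENNReal.add_lt_top.2 ⟨ENNReal.mul_lt_top (by simp) hE,
      ENNReal.mul_lt_top (by simp) (hlt.trans_le le_top)⟩)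

/-! ### Truncation -/

/-- A smooth bounded truncation, `s⁻¹ sin (s t)`, which tends to the identity as `s → 0`. -/
noncomputable def truncation (s t : ℝ) : ℝ := s⁻¹ * Real.sin (s * t)

lemma hasDerivAt_truncation {s : ℝ} (hs : s ≠ 0) (t : ℝ) :
    HasDerivAt (truncation s) (Real.cos (s * t)) t := by
  have h := (((hasDerivAt_id t).const_mul s).sin).const_mul s⁻¹
  have e : s⁻¹ * (Real.cos (s * id t) * (s * 1)) = Real.cos (s * t) := by
    simp only [id]; field_simp
  rw [e] at h
  exact h

lemma deriv_truncation {s : ℝ} (hs : s ≠ 0) : deriv (truncation s) = fun t => Real.cos (s * t) :=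
  funext fun t => (hasDerivAt_truncation hs t).deriv

lemma contDiff_truncation (s : ℝ) : ContDiff ℝ 1 (truncation s) :=
  contDiff_const.mul (Real.contDiff_sin.comp (contDiff_const.mul contDiff_id))

lemma abs_truncation_le (s t : ℝ) : |truncation s t| ≤ |s|⁻¹ := by
  rw [truncation, abs_mul, abs_inv]
  exact mul_le_of_le_one_right (by positivity) (Real.abs_sin_le_one _)

lemma abs_truncation_le_abs (s t : ℝ) : |truncation s t| ≤ |t| := by
  rcases eq_or_ne s 0 with rfl | hs
  · simp [truncation]
  · rw [truncation, abs_mul, abs_inv]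
    calc |s|⁻¹ * |Real.sin (s * t)| ≤ |s|⁻¹ * |s * t| :=
          mul_le_mul_of_nonneg_left Real.abs_sin_le_abs (by positivity)
      _ = |t| := by rw [abs_mul]; field_simp

lemma enorm_truncation_le_enorm (s t : ℝ) : ‖truncation s t‖ₑ ≤ ‖t‖ₑ := by
  rw [← ofReal_norm, ← ofReal_norm]
  exact ENNReal.ofReal_le_ofReal (abs_truncation_le_abs s t)

lemma tendsto_truncation (t : ℝ) : Tendsto (fun s => truncation s t) (𝓝[>] 0) (𝓝 t) := by
  have h : HasDerivAt (fun s => Real.sin (s * t)) t 0 := by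
    have := ((hasDerivAt_id (0 : ℝ)).mul_const t).sin
    simpa using this
  have h2 := (hasDerivAt_iff_tendsto_slope_zero.1 h).mono_left
    (nhdsWithin_mono 0 fun s (hs : s ∈ Ioi 0) => (mem_Ioi.1 hs).ne')
  simpa [truncation] using h2

/-- Truncations of a function of finite energy converge to it in energy. -/
lemma tendsto_energyOne_sub_truncation {ρ : Plane → ℝ≥0∞} (hρ : Measurable ρ) {v : Plane → ℝ}
    {g : Plane → Plane} (hv : HasWeakGradient v g) (mv : Measurable v) (mg : Measurable g)
    (hE : (∫⁻ x, ‖g x‖ₑ ^ 2 * ρ x) + ∫⁻ x, ‖v x‖ₑ ^ 2 * ρ x < ∞) :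
    Tendsto (fun s => energyOne ρ (v - fun x => truncation s (v x))) (𝓝[>] 0) (𝓝 0) := by
  obtain ⟨hE1, hE2⟩ := ENNReal.add_lt_top.1 hE
  have mT : ∀ s, Measurable (truncation s) := fun s => (contDiff_truncation s).continuous.measurable
  have dct : ∀ {E : Type} [NormedAddCommGroup E] [MeasurableSpace E] [BorelSpace E]
      (F : ℝ → Plane → E) (f : Plane → E), (∀ s, Measurable fun x => ‖F s x‖ₑ) →
      Measurable (fun x => ‖f x‖ₑ ^ 2 * ρ x) → (∀ s x, ‖F s x‖ₑ ≤ 2 * ‖f x‖ₑ) →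
      (∀ x, Tendsto (fun s => F s x) (𝓝[>] 0) (𝓝 0)) → ∫⁻ x, ‖f x‖ₑ ^ 2 * ρ x < ∞ →
      Tendsto (fun s => ∫⁻ x, ‖F s x‖ₑ ^ 2 * ρ x) (𝓝[>] 0) (𝓝 0) := by
    intro E _ _ _ F f mF mf hF hlim hf
    have e0 : (0 : ℝ≥0∞) = ∫⁻ _ : Plane, 0 := by simp
    have h4 : ∀ s x, ‖F s x‖ₑ ^ 2 * ρ x ≤ 4 * (‖f x‖ₑ ^ 2 * ρ x) := fun s x => by
      calc _ ≤ (2 * ‖f x‖ₑ) ^ 2 * ρ x := by gcongr; exact hF s x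
        _ = _ := by ring
    rw [e0]
    refine tendsto_lintegral_filter_of_dominated_convergence (fun x => 4 * (‖f x‖ₑ ^ 2 * ρ x))
      (Eventually.of_forall fun s => ((mF s).pow_const 2).mul hρ)
      (Eventually.of_forall fun s => ae_of_all _ fun x => h4 s x) ?_ ?_
    · rw [lintegral_const_mul _ mf]
      exact (ENNReal.mul_lt_top (by simp) hf).ne
    · filter_upwards [ae_lt_top mf hf.ne] with x hx
      rcases eq_or_ne (f x) 0 with h0 | h0
      · have : ∀ s, F s x = 0 := fun s => by
          have := hF s x
          rw [h0] at this
          simpa using this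
        simp [this]
      · have hρx : ρ x ≠ ∞ := fun h => by
          rw [h, ENNReal.mul_top (by simpa using h0)] at hx
          exact lt_irrefl _ hx
        have t1 := (continuous_enorm.tendsto _).comp (hlim x)
        rw [enorm_zero] at t1
        have t2 := ENNReal.Tendsto.mul_const (ENNReal.Tendsto.pow (n := 2) t1) (Or.inr hρx)
        simpa using t2
  have t1 := dct (fun s x => g x - Real.cos (s * v x) • g x) g
    (fun s => (mg.sub ((Real.measurable_cos.comp (mv.const_mul s)).smul mg)).enorm)
    ((mg.enorm.pow_const 2).mul hρ)
    (fun s x => by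
      rw [two_mul]
      refine enorm_sub_le.trans (add_le_add le_rfl ?_)
      rw [enorm_smul]
      refine mul_le_of_le_one_left' ?_
      rw [← ofReal_norm, ← ENNReal.ofReal_one]
      exact ENNReal.ofReal_le_ofReal (Real.abs_cos_le_one _))
    (fun x => by
      have h1 : Continuous fun s => g x - Real.cos (s * v x) • g x := by fun_prop
      simpa using (h1.tendsto 0).mono_left (nhdsWithin_le_nhds (s := Ioi (0 : ℝ)))) hE1
  have t2 := dct (fun s x => v x - truncation s (v x)) v
    (fun s => (mv.sub ((mT s).comp mv)).enorm) ((mv.enorm.pow_const 2).mul hρ)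
    (fun s x => by
      rw [two_mul]
      exact enorm_sub_le.trans (add_le_add le_rfl (enorm_truncation_le_enorm s _)))
    (fun x => by
      have h1 := (tendsto_const_nhds (x := v x)).sub (tendsto_truncation (v x))
      rwa [sub_self] at h1) hE2
  have t3 := t1.add t2
  rw [add_zero] at t3
  refine t3.congr' ?_
  filter_upwards [self_mem_nhdsWithin] with s hs
  have hs0 : s ≠ 0 := (show 0 < s from hs).ne'
  have hw := hv.comp_left (contDiff_truncation s) (abs_truncation_le s)
    (fun t => by rw [deriv_truncation hs0]; exact Real.abs_cos_le_one _) mv mg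
  rw [energyOne_eq (hv.sub hw), deriv_truncation hs0]
  rfl

/-- A function of finite energy whose quarter means in `Q₁` and `Q₃` tend to `0` is a limit of test
functions that vanish near the origin: it is truncated, then cut off, then mollified. -/
lemma exists_puncturedTestFunction_approx {a : ℝ → ℝ≥0∞} (ha : Measurable a)
    (h_deg : ∀ ε : ℝ, 0 < ε → ∃ c : ℝ≥0, 0 < c ∧
      ∀ r ∈ Ioc (0 : ℝ) 1, ε < r → (c : ℝ≥0∞) ≤ a r ∧ (c : ℝ≥0∞) ≤ (a r)⁻¹)
    (h_int : ∫⁻ r in Ioc (0 : ℝ) 1, a r / ENNReal.ofReal r < ∞)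
    (h_rank : ∃ K : ℝ≥0, 0 < K ∧ ∀ ε ∈ Ioo (0 : ℝ) 1,
      (ENNReal.ofReal (ε ^ 2))⁻¹ *
        (∫⁻ r in Ioc (0 : ℝ) ε, (a r)⁻¹ * ENNReal.ofReal r *
          (∫⁻ s in Ioc (0 : ℝ) r, a s / ENNReal.ofReal s)) < K)
    {v : Plane → ℝ} {g : Plane → Plane} (hv : HasWeakGradient v g) (mv : Measurable v)
    (mg : Measurable g) (hE : energyOne (weight a) v < ∞)
    (hint : ∀ α r, 0 < r → Integrable (fun θ => v (polarPoint r (θ + α))) arc)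
    (hosc : ∀ α, HasQuarterOscillationBound v g α)
    (hL₀ : ∀ r, 0 < r → ‖quarterMean v 0 r‖ₑ ≤ ∫⁻ s in Ioc (0 : ℝ) r, quarterNorm g 0 s)
    (hL₁ : ∀ r, 0 < r → ‖quarterMean v Real.pi r‖ₑ ≤
      ∫⁻ s in Ioc (0 : ℝ) r, quarterNorm g Real.pi s) {ε : ℝ≥0∞} (hε : 0 < ε) :
    ∃ φ ∈ puncturedTestFunctions ∩ spaceW (weight a), energyOne (weight a) (v - φ) < ε := by
  have mρ := measurable_weight ha
  have hE' := hE
  rw [energyOne_eq hv] at hE'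
  obtain ⟨hE1, hE2⟩ := ENNReal.add_lt_top.1 hE'
  obtain ⟨η, hη, hηε⟩ := exists_pos_mul_sq_lt (by simp : (10 : ℝ≥0∞) ≠ ∞) hε
  have hη2 : 0 < η ^ 2 := ENNReal.pow_pos hη 2
  obtain ⟨s, hs, hs0⟩ := (((tendsto_energyOne_sub_truncation mρ hv mv mg hE').eventually
    (gt_mem_nhds hη2)).and self_mem_nhdsWithin).exists
  have hs0' : s ≠ 0 := (show 0 < s from hs0).ne'
  set w : Plane → ℝ := fun x => truncation s (v x) with hw
  have mw : Measurable w := (contDiff_truncation s).continuous.measurable.comp mv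
  have hwg := hv.comp_left (contDiff_truncation s) (abs_truncation_le s)
    (fun t => by rw [deriv_truncation hs0']; exact Real.abs_cos_le_one _) mv mg
  rw [deriv_truncation hs0'] at hwg
  have mh : Measurable fun x => Real.cos (s * v x) • g x :=
    (Real.measurable_cos.comp (mv.const_mul s)).smul mg
  have hwv : ∀ x, ‖w x‖ₑ ≤ ‖v x‖ₑ := fun x => enorm_truncation_le_enorm s _
  have hwN : ∀ x, ‖w x‖ₑ ≤ ENNReal.ofReal |s|⁻¹ := fun x => by
    rw [← ofReal_norm]
    exact ENNReal.ofReal_le_ofReal (abs_truncation_le s _)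
  have hwE : (∫⁻ x, ‖Real.cos (s * v x) • g x‖ₑ ^ 2 * weight a x) +
      ∫⁻ x, ‖w x‖ₑ ^ 2 * weight a x < ∞ := by
    refine (add_le_add (lintegral_mono fun x => ?_) (lintegral_mono fun x => ?_)).trans_lt hE'
    · refine mul_le_mul_left (pow_le_pow_left' ?_ 2) _
      rw [enorm_smul]
      refine mul_le_of_le_one_left' ?_
      rw [← ofReal_norm, ← ENNReal.ofReal_one]
      exact ENNReal.ofReal_le_ofReal (Real.abs_cos_le_one _)
    · exact mul_le_mul_left (pow_le_pow_left' (hwv x) 2) _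
  have hvan := tendsto_lintegral_ball_zero ha (fun r hr => ne_zero_ne_top_of_bounds h_deg hr) h_int
    h_rank mg mw hE1 hint hosc hL₀ hL₁ hwv ENNReal.ofReal_ne_top hwN
  obtain ⟨δ, hδ, hδ0⟩ := (((tendsto_energyOne_sub_cutoff mρ hwg mw mh hwE hvan).eventually
    (gt_mem_nhds hη2)).and self_mem_nhdsWithin).exists
  have hψ := cutoff_mem_testFunctions (show 0 < δ from hδ0)
  have hz := hwg.mul_left hψ.1
  have hEw : energyOne (weight a) w < ∞ := by rw [energyOne_eq hwg]; exact hwE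
  have hEz : energyOne (weight a) (fun x => cutoff δ x * w x) < ∞ := by
    have h1 := energyOne_sub_le ⟨_, hwg⟩ ⟨_, hwg.sub hz⟩ mρ
    rw [sub_sub_cancel] at h1
    exact h1.trans_lt (ENNReal.add_lt_top.2 ⟨ENNReal.mul_lt_top (by simp) hEw,
      ENNReal.mul_lt_top (by simp) (hδ.trans_le le_top)⟩)
  obtain ⟨φ, hφ, hφE⟩ := exists_puncturedTestFunction_of_support mρ
    (fun δ hδ => exists_weight_bounds h_deg hδ) hz hEz hψ.2 (zero_notMem_tsupport_cutoff δ)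
    (tsupport_mul_subset_left) (fun x hx => by
      rw [image_eq_zero_of_notMem_tsupport hx, gradient_eq_zero_of_notMem_tsupport hx]
      simp) hη2
  refine ⟨φ, hφ, ?_⟩
  have t1 := energyOne_sub_triangle ⟨_, hv⟩ ⟨_, hwg⟩ hφ.2.1 mρ
  have t2 := energyOne_sub_triangle ⟨_, hwg⟩ ⟨_, hz⟩ hφ.2.1 mρ
  refine lt_of_le_of_lt ?_ hηε
  calc energyOne (weight a) (v - φ)
      ≤ 2 * η ^ 2 + 2 * (2 * η ^ 2 + 2 * η ^ 2) := by
        refine t1.trans (add_le_add (mul_le_mul_right hs.le _) (mul_le_mul_right (t2.trans ?_) _))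
        exact add_le_add (mul_le_mul_right hδ.le _) (mul_le_mul_right hφE.le _)
    _ = 10 * η ^ 2 := by ring
    _ ≤ 10 * (η ^ 2 + η ^ 2) := mul_le_mul_right le_self_add _

end WeightedPlane

/-! ### Quarter limits -/

namespace WeightedPlane

/-- `v` is a measurable version of `u` with measurable weak gradient `g`, for which the fundamental
theorem of calculus holds on almost every ray. -/
structure IsRadialRepresentative (u v : Plane → ℝ) (g : Plane → Plane) : Prop where
  measurable : Measurable v
  measurable_grad : Measurable g
  ae_eq : v =ᵐ[volume] u
  hasWeakGradient : HasWeakGradient v g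
  hasRadialDerivative : HasRadialDerivative v g

lemma exists_isRadialRepresentative {u : Plane → ℝ} (hu : u ∈ W11loc) :
    ∃ v g, IsRadialRepresentative u v g ∧ ∀ α, HasQuarterOscillationBound v g α := by
  obtain ⟨g, mg, hg⟩ := (hasWeakGradient_weakGradient hu).exists_measurable
  obtain ⟨v, mv, hvu, hr, ho⟩ := hg.exists_radial_version mg
  exact ⟨v, g, ⟨mv, mg, hvu, hg.congr_fun_ae hvu.symm, hr⟩, ho⟩

lemma IsRadialRepresentative.sub_testFunction {u v : Plane → ℝ} {g : Plane → Plane}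
    (h : IsRadialRepresentative u v g) {φ : Plane → ℝ} (hφ : φ ∈ testFunctions) :
    IsRadialRepresentative (u - φ) (v - φ) (g - gradient φ) where
  measurable := h.measurable.sub hφ.1.continuous.measurable
  measurable_grad :=
    h.measurable_grad.sub (continuous_gradient (testFunctions.contDiff_one hφ)).measurable
  ae_eq := h.ae_eq.sub .rfl
  hasWeakGradient := h.hasWeakGradient.sub (.of_contDiff (testFunctions.contDiff_one hφ))
  hasRadialDerivative :=
    h.hasRadialDerivative.sub (hasRadialDerivative_of_contDiff (testFunctions.contDiff_one hφ))

lemma IsRadialRepresentative.isRadialVersion {u v : Plane → ℝ} {g : Plane → Plane}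
    (h : IsRadialRepresentative u v g) : IsRadialVersion u v :=
  h.hasRadialDerivative.isRadialVersion h.ae_eq

lemma IsRadialRepresentative.energyOne_eq {u v : Plane → ℝ} {g : Plane → Plane}
    (h : IsRadialRepresentative u v g) (ρ : Plane → ℝ≥0∞) :
    energyOne ρ u = (∫⁻ x, ‖g x‖ₑ ^ 2 * ρ x) + ∫⁻ x, ‖v x‖ₑ ^ 2 * ρ x := by
  rw [← energyOne_congr_ae ⟨g, h.hasWeakGradient⟩ h.ae_eq,
    WeightedPlane.energyOne_eq h.hasWeakGradient]

lemma IsRadialRepresentative.integrable_quarter {u v : Plane → ℝ} {g : Plane → Plane}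
    (h : IsRadialRepresentative u v g) (α : ℝ) {r : ℝ} (hr : 0 < r) :
    Integrable (fun θ => v (polarPoint r (θ + α))) arc :=
  WeightedPlane.integrable_quarter h.measurable h.measurable_grad
    (fun R => h.hasWeakGradient.1.lintegral_enorm_ball_lt_top R)
    (fun R => h.hasWeakGradient.2.lintegral_enorm_ball_lt_top R) h.hasRadialDerivative α hr

/-- One radial version suffices: two of them agree on almost every ray, hence they have the same
quarter means. -/
lemma IsRadialVersion.isQuarterLimit {u v : Plane → ℝ} (hv : IsRadialVersion u v) {α L : ℝ}
    (hint : ∀ r, 0 < r → Integrable (fun θ => v (polarPoint r (θ + α))) arc)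
    (hL : Tendsto (quarterMean v α) (𝓝[>] 0) (𝓝 L)) : IsQuarterLimit u α L := by
  refine ⟨⟨v, hv⟩, fun v' hv' => ?_⟩
  have key : ∀ r, 0 < r →
      (fun θ => v (polarPoint r (θ + α))) =ᵐ[arc] fun θ => v' (polarPoint r (θ + α)) := by
    intro r hr
    filter_upwards [ae_arc_add (hv.ae_eq_ray hv') α] with θ hθ
    exact hθ r hr
  refine ⟨fun r hr => intervalIntegrable_quarter_iff.2 ((hint r hr).congr (key r hr)),
    hL.congr' ?_⟩
  filter_upwards [self_mem_nhdsWithin] with r hr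
  rw [quarterMean_eq, quarterMean_eq, integral_congr_ae (key r hr)]

lemma IsQuarterLimit.limUnder_eq {u : Plane → ℝ} {α L : ℝ} (h : IsQuarterLimit u α L) :
    limUnder (𝓝[>] 0) (quarterMean (radialVersion u) α) = L := by
  have h1 : IsRadialVersion u (radialVersion u) := by
    rw [radialVersion, dif_pos h.1]
    exact h.1.choose_spec
  exact (h.2 _ h1).2.limUnder_eq

lemma tendsto_quarterMean_of_continuous {φ : Plane → ℝ} (hφ : Continuous φ) (α : ℝ) :
    Tendsto (quarterMean φ α) (𝓝[>] 0) (𝓝 (φ 0)) := by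
  have h1 : Continuous fun r => ∫ θ in (0 : ℝ)..(Real.pi / 2), φ (polarPoint r (θ + α)) := by
    refine intervalIntegral.continuous_parametric_intervalIntegral_of_continuous' ?_ _ _
    exact hφ.comp (continuous_polarPoint.comp
      (continuous_fst.prodMk (continuous_snd.add continuous_const)))
  have h2 := ((h1.const_mul (2 / Real.pi)).tendsto 0).mono_left
    (nhdsWithin_le_nhds (s := Ioi (0 : ℝ)))
  have h3 : ∀ θ, polarPoint 0 θ = 0 := fun θ => by rw [polarPoint_eq_smul, zero_smul]
  have h4 : 2 / Real.pi * (Real.pi / 2 * φ 0) = φ 0 := by field_simp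
  simp only [h3, intervalIntegral.integral_const, smul_eq_mul, sub_zero, h4] at h2
  exact h2

lemma IsRadialRepresentative.isQuarterLimit_sub {u v : Plane → ℝ} {g : Plane → Plane}
    (h : IsRadialRepresentative u v g) {φ : Plane → ℝ} (hφ : φ ∈ testFunctions) {α L : ℝ}
    (hL : IsQuarterLimit u α L) : IsQuarterLimit (u - φ) α (L - φ 0) := by
  refine (h.sub_testFunction hφ).isRadialVersion.isQuarterLimit
    (fun r hr => (h.sub_testFunction hφ).integrable_quarter α hr) ?_
  refine ((hL.2 v h.isRadialVersion).2.sub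
    (tendsto_quarterMean_of_continuous hφ.1.continuous α)).congr' ?_
  filter_upwards [self_mem_nhdsWithin] with r hr
  have hφi : Integrable (fun θ => φ (polarPoint r (θ + α))) arc :=
    intervalIntegrable_quarter_iff.1 ((hφ.1.continuous.comp ((continuous_polarPoint_right r).comp
      (continuous_add_const α))).intervalIntegrable _ _)
  simp only [quarterMean_eq, Pi.sub_apply]
  rw [integral_sub (h.integrable_quarter α hr) hφi]
  ring

section Weight

variable {a : ℝ → ℝ≥0∞}

lemma IsRadialRepresentative.exists_isQuarterLimit (ha : Measurable a)
    (ha0 : ∀ r ∈ Ioc (0 : ℝ) 1, a r ≠ 0 ∧ a r ≠ ∞)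
    (h_int : ∫⁻ r in Ioc (0 : ℝ) 1, a r / ENNReal.ofReal r < ∞) {u v : Plane → ℝ}
    {g : Plane → Plane} (h : IsRadialRepresentative u v g) (hE : energyOne (weight a) u < ∞)
    {α : ℝ} (hα : ∀ r ∈ Ioo (0 : ℝ) 1, ∀ θ ∈ Ioo 0 (Real.pi / 2),
      weight a (polarPoint r (θ + α)) = (a r)⁻¹) :
    ∃ L, IsQuarterLimit u α L ∧
      ∀ r, 0 < r → ‖quarterMean v α r - L‖ₑ ≤ ∫⁻ s in Ioc (0 : ℝ) r, quarterNorm g α s := by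
  rw [h.energyOne_eq] at hE
  have hG : ∫⁻ r in Ioc (0 : ℝ) 1, quarterNorm g α r < ∞ := by
    have h1 := (sq_lintegral_quarterNorm_le ha ha0 h.measurable_grad α le_rfl).trans_lt
      (ENNReal.mul_lt_top ((sectorEnergy_one_le h.measurable_grad
        (measurable_weight ha) hα).trans_lt
        (ENNReal.mul_lt_top (by simp) (ENNReal.add_lt_top.1 hE).1)) h_int)
    exact ((ENNReal.pow_lt_top_iff).1 h1).resolve_right two_ne_zero
  obtain ⟨L, hL, hb⟩ := exists_tendsto_quarterMean h.measurable h.measurable_grad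
    (fun R => h.hasWeakGradient.1.lintegral_enorm_ball_lt_top R)
    (fun R => h.hasWeakGradient.2.lintegral_enorm_ball_lt_top R) h.hasRadialDerivative α hG
  exact ⟨L, h.isRadialVersion.isQuarterLimit (fun r hr => h.integrable_quarter α hr) hL, hb⟩

lemma IsQuarterLimit.unique {u : Plane → ℝ} {α L L' : ℝ} (h : IsQuarterLimit u α L)
    (h' : IsQuarterLimit u α L') : L = L' := by
  rw [← h.limUnder_eq, h'.limUnder_eq]

/-- The quarter limits are continuous functionals on the weighted Sobolev space. -/
lemma exists_sq_enorm_quarterLimit_le (ha : Measurable a)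
    (ha0 : ∀ r ∈ Ioc (0 : ℝ) 1, a r ≠ 0 ∧ a r ≠ ∞)
    (h_int : ∫⁻ r in Ioc (0 : ℝ) 1, a r / ENNReal.ofReal r < ∞)
    (h_int' : ∫⁻ r in Ioc (0 : ℝ) 1, ENNReal.ofReal r / a r < ∞) :
    ∃ C : ℝ≥0∞, C ≠ ∞ ∧ ∀ {u : Plane → ℝ} {α L : ℝ}, u ∈ spaceW (weight a) →
      (∀ r ∈ Ioo (0 : ℝ) 1, ∀ θ ∈ Ioo 0 (Real.pi / 2),
        weight a (polarPoint r (θ + α)) = (a r)⁻¹) →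
      IsQuarterLimit u α L → ‖L‖ₑ ^ 2 ≤ C * energyOne (weight a) u := by
  set κ := ∫⁻ r in Ioc (1 / 2 : ℝ) 1, (a r)⁻¹ * ENNReal.ofReal r with hκ
  set A := ∫⁻ s in Ioc (0 : ℝ) 1, a s / ENNReal.ofReal s with hA
  have mκ : Measurable fun r => (a r)⁻¹ * ENNReal.ofReal r := ha.inv.mul ENNReal.measurable_ofReal
  have hκt : κ ≠ ∞ := by
    refine (lt_of_le_of_lt ?_ h_int').ne
    refine (lintegral_mono_set (Ioc_subset_Ioc_left (by norm_num : (0 : ℝ) ≤ 1 / 2))).trans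
      (le_of_eq ?_)
    simp only [div_eq_mul_inv, mul_comm]
  have hκ0 : κ ≠ 0 := by
    intro h0
    rw [hκ, lintegral_eq_zero_iff mκ, EventuallyEq, ae_restrict_iff' measurableSet_Ioc] at h0
    have h1 : ∀ᵐ r : ℝ, r ∉ Ioc (1 / 2 : ℝ) 1 := by
      filter_upwards [h0] with r hr hm
      have h2 := hr hm
      have hr0 : 0 < r := by linarith [hm.1]
      rw [Pi.zero_apply, mul_eq_zero, ENNReal.inv_eq_zero] at h2
      rcases h2 with h2 | h2
      · exact (ha0 r ⟨hr0, hm.2⟩).2 h2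
      · exact absurd h2 (by simpa using hr0)
    have h3 := measure_eq_zero_iff_ae_notMem.2 h1
    rw [Real.volume_Ioc] at h3
    norm_num at h3
  refine ⟨κ⁻¹ * (2 + 4 * A * κ), ENNReal.mul_ne_top (ENNReal.inv_ne_top.2 hκ0)
    (ENNReal.add_ne_top.2 ⟨by simp, ENNReal.mul_ne_top (ENNReal.mul_ne_top (by simp) h_int.ne)
      hκt⟩), fun {u α L} hu hα hL => ?_⟩
  obtain ⟨v, g, hR, -⟩ := exists_isRadialRepresentative hu.1
  obtain ⟨L', hL', hb⟩ := hR.exists_isQuarterLimit ha ha0 h_int hu.2 hα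
  obtain rfl := hL.unique hL'
  have key := sq_enorm_limit_mul_le ha ha0 hR.measurable hR.measurable_grad
    (measurable_weight ha) hα hb
  rw [← hκ, ← hA] at key
  have h1 : ‖L‖ₑ ^ 2 * κ ≤ (2 + 4 * A * κ) * energyOne (weight a) u := by
    refine key.trans ?_
    rw [hR.energyOne_eq]
    set G := ∫⁻ x, ‖g x‖ₑ ^ 2 * weight a x
    set V := ∫⁻ x, ‖v x‖ₑ ^ 2 * weight a x
    calc 2 * V + 2 * (2 * G * A) * κ = 2 * V + 4 * A * κ * G := by ring
      _ ≤ 2 * (G + V) + 4 * A * κ * (G + V) := by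
          gcongr
          · exact le_add_self
          · exact le_self_add
      _ = _ := by ring
  calc ‖L‖ₑ ^ 2 = κ⁻¹ * (‖L‖ₑ ^ 2 * κ) := by
        rw [mul_left_comm, ENNReal.inv_mul_cancel hκ0 hκt, mul_one]
    _ ≤ κ⁻¹ * ((2 + 4 * A * κ) * energyOne (weight a) u) := mul_le_mul_right h1 _
    _ = _ := by ring

lemma lintegral_weight_ball_lt_top (ha : Measurable a)
    (h_int : ∫⁻ r in Ioc (0 : ℝ) 1, a r / ENNReal.ofReal r < ∞)
    (h_int' : ∫⁻ r in Ioc (0 : ℝ) 1, ENNReal.ofReal r / a r < ∞) :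
    ∫⁻ x in Metric.ball (0 : Plane) 1, weight a x < ∞ := by
  have m1 : Measurable fun _ : Plane => (1 : ℝ≥0∞) := measurable_const
  have s1 : ∀ α, (∀ r ∈ Ioo (0 : ℝ) 1, ∀ θ ∈ Ioo 0 (Real.pi / 2),
      weight a (polarPoint r (θ + α)) = (a r)⁻¹) →
      ∫⁻ r in Ioo (0 : ℝ) 1, ENNReal.ofReal r * ∫⁻ θ, 1 * weight a (polarPoint r (θ + α)) ∂arc <
        ∞ := fun α hα => by
    rw [lintegral_sector_weight_eq m1 le_rfl hα]
    simp only [lintegral_const, one_mul, arc_univ]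
    rw [lintegral_const_mul' _ _ ENNReal.ofReal_ne_top]
    refine ENNReal.mul_lt_top ENNReal.ofReal_lt_top ?_
    simpa only [div_eq_mul_inv, mul_comm] using h_int'
  have s2 : ∀ α, (∀ r ∈ Ioo (0 : ℝ) 1, ∀ θ ∈ Ioo 0 (Real.pi / 2),
      weight a (polarPoint r (θ + α)) = a r) →
      ∫⁻ r in Ioo (0 : ℝ) 1, ENNReal.ofReal r * ∫⁻ θ, 1 * weight a (polarPoint r (θ + α)) ∂arc <
        ∞ := fun α hα => by
    rw [lintegral_sector_weight_eq m1 le_rfl hα]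
    refine (lintegral_bounded_sector_le (f := fun _ => 1) (fun _ => le_rfl) α ha).trans_lt ?_
    exact ENNReal.mul_lt_top ENNReal.ofReal_lt_top (ENNReal.mul_lt_top (by simp) h_int)
  have key := lintegral_ball_le_sectors (m1.mul (measurable_weight ha)) 1
  simp only [Pi.mul_apply] at key
  simp only [one_mul] at key s1 s2
  refine key.trans_lt (ENNReal.add_lt_top.2 ⟨ENNReal.add_lt_top.2 ⟨?_, ?_⟩,
    ENNReal.add_lt_top.2 ⟨?_, ?_⟩⟩)
  · exact s1 0 fun r hr θ hθ => weight_polarPoint_zero hr hθ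
  · exact s1 Real.pi fun r hr θ hθ => weight_polarPoint_pi hr hθ
  · exact s2 _ fun r hr θ hθ => weight_polarPoint_pi_div_two hr hθ
  · exact s2 _ fun r hr θ hθ => weight_polarPoint_three_pi_div_two hr hθ

/-- Test functions have finite energy, because the weight is locally integrable. -/
lemma testFunctions_subset_spaceW (ha : Measurable a)
    (h_int : ∫⁻ r in Ioc (0 : ℝ) 1, a r / ENNReal.ofReal r < ∞)
    (h_int' : ∫⁻ r in Ioc (0 : ℝ) 1, ENNReal.ofReal r / a r < ∞) :
    testFunctions ⊆ spaceW (weight a) := by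
  intro φ hφ
  refine ⟨testFunctions_subset_W11loc hφ, ?_⟩
  have hφ1 := testFunctions.contDiff_one hφ
  rw [energyOne_eq (.of_contDiff hφ1)]
  set K := tsupport φ with hK
  have mK : MeasurableSet K := (isClosed_tsupport φ).measurableSet
  have hρ : ∫⁻ x in K, weight a x < ∞ := by
    have h1 : ∫⁻ x in K, weight a x ≤
        (∫⁻ x in Metric.ball (0 : Plane) 1, weight a x) + ∫⁻ _ in K, 1 := by
      have mb : MeasurableSet (Metric.ball (0 : Plane) 1) := Metric.isOpen_ball.measurableSet
      rw [← lintegral_indicator mb, ← lintegral_indicator mK, ← lintegral_indicator mK,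
        ← lintegral_add_left ((measurable_weight ha).indicator mb)]
      refine lintegral_mono fun x => ?_
      by_cases hx : x ∈ K
      · rw [indicator_of_mem hx, indicator_of_mem hx]
        by_cases hb : x ∈ Metric.ball (0 : Plane) 1
        · rw [indicator_of_mem hb]; exact le_self_add
        · rw [weight, if_neg fun h => hb h.2, if_neg fun h => hb h.2]; exact le_add_self
      · rw [indicator_of_notMem hx]; exact zero_le
    refine h1.trans_lt (ENNReal.add_lt_top.2 ⟨lintegral_weight_ball_lt_top ha h_int h_int', ?_⟩)
    rw [setLIntegral_one]
    exact hφ.2.isCompact.measure_lt_top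
  have key : ∀ {E : Type} [NormedAddCommGroup E] (f : Plane → E), Continuous f →
      (∀ x, x ∉ K → f x = 0) → ∫⁻ x, ‖f x‖ₑ ^ 2 * weight a x < ∞ := by
    intro E _ f hf h0
    obtain ⟨C, hC⟩ := (HasCompactSupport.intro hφ.2.isCompact h0).exists_bound_of_continuous hf
    have h1 : ∫⁻ x, ‖f x‖ₑ ^ 2 * weight a x ≤ ENNReal.ofReal C ^ 2 * ∫⁻ x in K, weight a x := by
      rw [← lintegral_const_mul' _ _ (by simp), ← lintegral_indicator mK]
      refine lintegral_mono fun x => ?_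
      by_cases hx : x ∈ K
      · rw [indicator_of_mem hx, ← ofReal_norm]
        gcongr
        exact hC x
      · simp [h0 x hx]
    exact h1.trans_lt (ENNReal.mul_lt_top (by simp) hρ)
  exact ENNReal.add_lt_top.2 ⟨key _ (continuous_gradient hφ1)
    fun x hx => gradient_eq_zero_of_notMem_tsupport hx, key _ hφ.1.continuous
    fun x hx => image_eq_zero_of_notMem_tsupport hx⟩

end Weight

lemma eq_zero_of_forall_le_mul {x C : ℝ≥0∞} (hC : C ≠ ∞) (h : ∀ ε : ℝ≥0∞, 0 < ε → x ≤ C * ε) :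
    x = 0 := by
  have h1 : Tendsto (fun ε : ℝ≥0∞ => C * ε) (𝓝[>] 0) (𝓝 0) := by
    have := ENNReal.Tendsto.const_mul (tendsto_id (x := 𝓝 (0 : ℝ≥0∞))) (Or.inr hC)
    rw [mul_zero] at this
    exact this.mono_left nhdsWithin_le_nhds
  refine le_antisymm (ge_of_tendsto h1 ?_) zero_le
  filter_upwards [self_mem_nhdsWithin] with ε hε
  exact h ε hε

end WeightedPlane

theorem mainTheorem3 (a : ℝ → ℝ≥0∞) (ha : Measurable a)
    (h_deg : ∀ ε : ℝ, 0 < ε → ∃ c : ℝ≥0, 0 < c ∧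
      ∀ r ∈ Ioc (0 : ℝ) 1, ε < r → (c : ℝ≥0∞) ≤ a r ∧ (c : ℝ≥0∞) ≤ (a r)⁻¹)
    (h_int : ∫⁻ r in Ioc (0 : ℝ) 1, a r / ENNReal.ofReal r < ∞)
    (h_int' : ∫⁻ r in Ioc (0 : ℝ) 1, ENNReal.ofReal r / a r < ∞)
    (h_rank : ∃ K : ℝ≥0, 0 < K ∧ ∀ ε ∈ Ioo (0 : ℝ) 1,
      (ENNReal.ofReal (ε ^ 2))⁻¹ *
        (∫⁻ r in Ioc (0 : ℝ) ε, (a r)⁻¹ * ENNReal.ofReal r *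
          (∫⁻ s in Ioc (0 : ℝ) r, a s / ENNReal.ofReal s)) < K)
    (u : Plane → ℝ) (hu : u ∈ spaceW (weight a)) :
    IsQuarterLimit u 0 (ellPlus u) ∧ IsQuarterLimit u Real.pi (ellMinus u) ∧
      (u ∈ spaceH (weight a) ↔ ellPlus u = ellMinus u) ∧
      (u ∈ spaceH₀ (weight a) ↔ ellPlus u = 0 ∧ ellMinus u = 0) := by
  have ha0 : ∀ r ∈ Ioc (0 : ℝ) 1, a r ≠ 0 ∧ a r ≠ ∞ := fun r hr => ne_zero_ne_top_of_bounds h_deg hr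
  have mρ := measurable_weight ha
  have hα₀ : ∀ r ∈ Ioo (0 : ℝ) 1, ∀ θ ∈ Ioo 0 (Real.pi / 2),
      weight a (polarPoint r (θ + 0)) = (a r)⁻¹ := fun r hr θ hθ => weight_polarPoint_zero hr hθ
  have hα₁ : ∀ r ∈ Ioo (0 : ℝ) 1, ∀ θ ∈ Ioo 0 (Real.pi / 2),
      weight a (polarPoint r (θ + Real.pi)) = (a r)⁻¹ := fun r hr θ hθ => weight_polarPoint_pi hr hθ
  have hT := testFunctions_subset_spaceW ha h_int h_int'
  -- if both limits of `w` vanish, then `w` is a limit of test functions vanishing near the origin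
  have density : ∀ w ∈ spaceW (weight a), IsQuarterLimit w 0 0 → IsQuarterLimit w Real.pi 0 →
      ∀ ε : ℝ≥0∞, 0 < ε → ∃ φ ∈ puncturedTestFunctions ∩ spaceW (weight a),
        energyOne (weight a) (w - φ) < ε := by
    intro w hw h₀ h₁ ε hε
    obtain ⟨v, g, hR, hosc⟩ := exists_isRadialRepresentative hw.1
    obtain ⟨L₀, hL₀, hb₀⟩ := hR.exists_isQuarterLimit ha ha0 h_int hw.2 hα₀
    obtain ⟨L₁, hL₁, hb₁⟩ := hR.exists_isQuarterLimit ha ha0 h_int hw.2 hα₁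
    obtain rfl := h₀.unique hL₀
    obtain rfl := h₁.unique hL₁
    simp only [sub_zero] at hb₀ hb₁
    have hEv := energyOne_congr_ae ⟨g, hR.hasWeakGradient⟩ hR.ae_eq (weight a)
    obtain ⟨φ, hφ, hφE⟩ := exists_puncturedTestFunction_approx ha h_deg h_int h_rank
      hR.hasWeakGradient hR.measurable hR.measurable_grad (hEv.trans_lt hw.2)
      (fun α r hr => hR.integrable_quarter α hr) hosc hb₀ hb₁ hε
    refine ⟨φ, hφ, ?_⟩
    have hs := hR.sub_testFunction hφ.1.1
    rwa [← energyOne_congr_ae ⟨_, hs.hasWeakGradient⟩ hs.ae_eq]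
  obtain ⟨v, g, hR, -⟩ := exists_isRadialRepresentative hu.1
  obtain ⟨L₀, hL₀, -⟩ := hR.exists_isQuarterLimit ha ha0 h_int hu.2 hα₀
  obtain ⟨L₁, hL₁, -⟩ := hR.exists_isQuarterLimit ha ha0 h_int hu.2 hα₁
  have e₀ : ellPlus u = L₀ := hL₀.limUnder_eq
  have e₁ : ellMinus u = L₁ := hL₁.limUnder_eq
  obtain ⟨C, hC, hCb⟩ := exists_sq_enorm_quarterLimit_le ha ha0 h_int h_int'
  -- continuity of the limits, applied to the difference of `u` and a test function
  have cont : ∀ φ ∈ testFunctions,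
      ‖L₀ - φ 0‖ₑ ^ 2 ≤ C * energyOne (weight a) (u - φ) ∧
      ‖L₁ - φ 0‖ₑ ^ 2 ≤ C * energyOne (weight a) (u - φ) := fun φ hφ =>
    ⟨hCb (sub_mem_spaceW mρ hu (hT hφ)) hα₀ (hR.isQuarterLimit_sub hφ hL₀),
      hCb (sub_mem_spaceW mρ hu (hT hφ)) hα₁ (hR.isQuarterLimit_sub hφ hL₁)⟩
  rw [e₀, e₁]
  refine ⟨hL₀, hL₁, ⟨fun hH => ?_, fun hL => ?_⟩, ⟨fun hH => ?_, fun hL => ?_⟩⟩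
  · have h1 : ‖L₀ - L₁‖ₑ ^ 2 = 0 := by
      refine eq_zero_of_forall_le_mul (ENNReal.mul_ne_top (by simp : (4 : ℝ≥0∞) ≠ ∞) hC)
        fun ε hε => ?_
      obtain ⟨φ, hφ, hφE⟩ := hH.2 ε hε
      obtain ⟨c₀, c₁⟩ := cont φ hφ.1
      have h2 := enorm_sub_sq_le (L₀ - φ 0) (L₁ - φ 0)
      rw [sub_sub_sub_cancel_right] at h2
      have h3 : C * energyOne (weight a) (u - φ) ≤ C * ε := mul_le_mul_right hφE.le _
      calc _ ≤ 2 * (C * ε) + 2 * (C * ε) := h2.trans (add_le_add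
            (mul_le_mul_right (c₀.trans h3) _) (mul_le_mul_right (c₁.trans h3) _))
        _ = 4 * C * ε := by ring
    have h2 := pow_eq_zero_iff two_ne_zero |>.1 h1
    exact sub_eq_zero.1 (enorm_eq_zero.1 h2)
  · -- subtracting a multiple of a bump function makes both limits vanish
    refine ⟨hu, fun ε hε => ?_⟩
    set ψ : Plane → ℝ := fun x => L₀ * bump x with hψ
    have hψt : ψ ∈ testFunctions := testFunctions.mul_left contDiff_const bump_mem_testFunctions
    have hψ0 : ψ 0 = L₀ := by rw [hψ]; simp [bump_eq_one (x := 0) (by simp)]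
    have k₀ := hR.isQuarterLimit_sub hψt hL₀
    have k₁ := hR.isQuarterLimit_sub hψt hL₁
    rw [hψ0, sub_self] at k₀
    rw [hψ0, ← hL, sub_self] at k₁
    obtain ⟨φ, hφ, hφE⟩ := density (u - ψ) (sub_mem_spaceW mρ hu (hT hψt)) k₀ k₁ ε hε
    have hsum := testFunctions.add hψt hφ.1.1
    refine ⟨ψ + φ, ⟨hsum, hT hsum⟩, ?_⟩
    rwa [← sub_sub]
  · have h1 : ∀ φ ∈ puncturedTestFunctions, φ 0 = 0 := fun φ hφ =>
      image_eq_zero_of_notMem_tsupport hφ.2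
    have h2 : ∀ L : ℝ, (∀ φ ∈ testFunctions,
        ‖L - φ 0‖ₑ ^ 2 ≤ C * energyOne (weight a) (u - φ)) → L = 0 := fun L hLφ => by
      have h3 : ‖L‖ₑ ^ 2 = 0 := eq_zero_of_forall_le_mul hC fun ε hε => by
        obtain ⟨φ, hφ, hφE⟩ := hH.2 ε hε
        have h4 := hLφ φ hφ.1.1
        rw [h1 φ hφ.1, sub_zero] at h4
        exact h4.trans (mul_le_mul_right hφE.le _)
      exact enorm_eq_zero.1 (pow_eq_zero_iff two_ne_zero |>.1 h3)
    exact ⟨h2 L₀ fun φ hφ => (cont φ hφ).1, h2 L₁ fun φ hφ => (cont φ hφ).2⟩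
  · obtain ⟨rfl, rfl⟩ := hL
    exact ⟨hu, density u hu hL₀ hL₁⟩
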